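/- Let $Q$ be a finite group with subgroups $F,G$ such that $FG=Q$ and $F\cap G=1$. For $x\in G$, $a\in F$ write $xa=(x\rhd a)(x\lhd a)$ with $x\rhd a\in F$, $x\lhd a\in G$, and put $F_x=\{a\in F: x\lhd a=x\}$. For a commutative ring $E$ let $H_E=E^G\#EF$ be the bismash product: the free $E$-module with basis $\mathcal B=\{p_x\#a: x\in G,a\in F\}$, product $(p_x\#a)(p_y\#b)=\delta_{y,x\lhd a}\,p_x\#ab$, counit $\varepsilon(p_x\#a)=\delta_{x,1}$, comultiplication $\Delta(p_x\#a)=\sum_{y\in G}(p_{xy^{-1}}\#(y\rhd a))\otimes(p_y\#a)$ and antipode $S(p_x\#a)=p_{(x\lhd a)^{-1}}\#(x\rhd a)^{-1}$. For a field $E$, a bilinear form on an $H_E$-module is invariant if $\sum\langle h_1v,h_2w\rangle=\varepsilon(h)\langle v,w\rangle$ for all $h,v,w$; the dual of a finite-dimensional module carries the action $(h\varphi)(v)=\varphi(S(h)v)$. The type (indicator) $\nu(W)$ of an irreducible $H_E$-module $W$ is $+1$ (respectively $-1$) if $W$ has a non-degenerate invariant symmetric (respectively skew-symmetric) form, and $0$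 if it has neither. Let $p$ be an odd prime, $R$ a discrete valuation ring with field of fractions $K$, maximal ideal $\pi R$ and residue field $k=R/\pi R$ of characteristic $p$, and suppose that $K$ contains a number field $\mathbb L$ which is a splitting field for $H_{\mathbb Q}$ (all irreducible $H_{\mathbb L}$-modules have only scalar endomorphisms). (For example, $R$ may be the completion of the ring of integers of $\mathbb L$ at a prime above $p$.) Brauer characters. Write $|F|=p^e m$ with $p\nmid m$, let $R'$ be a discrete valuation ring with field of fractions $K'\supseteq K$ that dominates $R$ (that is, $R\subseteq R'$ and $R\to R'$ is a local homomorphism) and contains a primitive $m$-th root of unity $\omega$, with image $\bar\omega$ in the residue field. Let $\mathcal B_{p'}=\{p_y\#a: a\in F_y,\ p\nmid \mathrm{ord}(a)\}$; it is stable under $S$. The Brauer character $\hat\phi_W:\mathcal B_{p'}\to K'$ of a finite-dimensional $H_k$-module $W$ sends $p_y\#a$ to $\sum_{j=0}^{m-1}\mu_j\,\omega^{j}$, where $\mu_j$ is the algebraic multiplicity of $\bar\omega^{j}$ as an eigenvalue of $p_y\#a$ on $W$. It is called irreducible if $W$ is irreducible. For an $H_K$-module with character $\hat\chi$ and an irreducible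 Brauer character $\hat\phi$, the decomposition number $d(\hat\chi|_{\mathcal B_{p'}},\hat\phi)$ is the coefficient of $\hat\phi$ in the expression of $\hat\chi|_{\mathcal B_{p'}}$ as an integral linear combination of irreducible Brauer characters. Let $V$ be an irreducible self-dual $H_K$-module with character $\hat\chi$, and let $P$ be an irreducible $H_k$-module with Brauer character $\hat\phi$ such that (1) $\hat\phi^*=\hat\phi$, where $\hat\phi^*=\hat\phi\circ S$; (2) $d(\hat\chi|_{\mathcal B_{p'}},\hat\phi)$ is odd. Let $\langle\ ,\ \rangle$ be any non-degenerate invariant symmetric or skew-symmetric bilinear form on $V$. Let $L$ be a maximal integral $R\mathcal B$-lattice in $V$, that is, an element maximal under inclusion among the finitely generated $R$-submodules $L$ of $V$ that are stable under $\mathcal B$ and satisfy $KL=V$ and $\langle L,L\rangle\subseteq R$; let $L^*=\{l\in V:\langle L,l\rangle\subseteq R\}$. Then $\pi L^*\subseteq L\subseteq L^*$; let $Y=L/\pi L^*$ and $Z=L^*/L$ be the resulting $H_k$-modules, with the invariant $k$-valued forms given by the images in $k$ of $\langle v,w\rangle$ for $v,w\in L$, respectively of $\pi\langle v,w\rangle$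 for $v,w\in L^*$. Let $Y'=Y_1^\perp/Y_1$ and $Z'=Z_1^\perp/Z_1$ be Witt kernels, where $Y_1\subseteq Y$ and $Z_1\subseteq Z$ are any submodules maximal among those on which the form vanishes identically. Then the multiplicity of $P$ as a composition factor of $Y'\oplus Z'$ is odd. Consequently $P$ has the same type as $V$, that is, $\nu(P)=\nu(V)\in\{1,-1\}$. -/

import Mathlib

open scoped TensorProduct

set_option linter.unusedSectionVars false

noncomputable section

namespace Bismash

/-! ### The actions coming from a factorization `Q = FG`, `F ∩ G = 1` -/

section Actions

variable {Q : Type*} [Group Q] {F G : Subgroup Q} (h : F.IsComplement' G)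

/-- `x ▷ a`: the `F`-component of `x a`. -/
def act (x : G) (a : F) : F := (h.equiv ((x : Q) * a)).1

/-- `x ◁ a`: the `G`-component of `x a`. -/
def lact (x : G) (a : F) : G := (h.equiv ((x : Q) * a)).2

theorem mul_eq (x : G) (a : F) : (x : Q) * a = (act h x a : Q) * (lact h x a : Q) :=
  (h.equiv_fst_mul_equiv_snd ((x : Q) * a)).symm

theorem act_lact_unique {x : G} {a : F} {b : F} {y : G} (e : (x : Q) * a = (b : Q) * y) :
    act h x a = b ∧ lact h x a = y := by
  have e' : h.equiv ((x : Q) * a) = (b, y) := by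
    apply h.equiv.symm.injective
    rw [Equiv.symm_apply_apply, e]
    rfl
  exact ⟨congrArg Prod.fst e', congrArg Prod.snd e'⟩

@[simp] theorem lact_one (x : G) : lact h x 1 = x :=
  (act_lact_unique h (b := 1) (y := x) (by simp)).2

@[simp] theorem one_lact (a : F) : lact h 1 a = 1 :=
  (act_lact_unique h (b := a) (y := 1) (by simp)).2

@[simp] theorem one_act (a : F) : act h 1 a = a :=
  (act_lact_unique h (b := a) (y := 1) (by simp)).1

theorem lact_mul (x : G) (a b : F) : lact h x (a * b) = lact h (lact h x a) b := by
  refine (act_lact_unique h (b := act h x a * act h (lact h x a) b) ?_).2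
  rw [Subgroup.coe_mul, Subgroup.coe_mul, ← mul_assoc, mul_eq h x a, mul_assoc,
    mul_eq h (lact h x a) b, mul_assoc]

theorem mul_act (x y : G) (a : F) : act h (x * y) a = act h x (act h y a) := by
  refine (act_lact_unique h (y := lact h x (act h y a) * lact h y a) ?_).1
  rw [Subgroup.coe_mul, Subgroup.coe_mul, mul_assoc, mul_eq h y a, ← mul_assoc,
    mul_eq h x (act h y a), mul_assoc]

theorem inv_lact_act (x : G) (a : F) : lact h x⁻¹ (act h x a) = (lact h x a)⁻¹ := by
  refine (act_lact_unique h (b := a) ?_).2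
  have := mul_eq h x a
  rw [Subgroup.coe_inv, Subgroup.coe_inv, inv_mul_eq_iff_eq_mul, ← mul_assoc, this]
  simp

theorem act_inv_of_fixed {x : G} {a : F} (hx : lact h x a = x) :
    (act h x a : Q) = x * a * (x : Q)⁻¹ := by
  have := mul_eq h x a
  rw [hx] at this
  rw [this]; simp

end Actions

end Bismash

/-- The underlying `E`-module of the bismash product `E^G # E F`: an element is given by its
coefficients in the distinguished basis `p_x # a`, `x ∈ G`, `a ∈ F`. -/
def Bismash {Q : Type*} [Group Q] {F G : Subgroup Q} (_h : F.IsComplement' G) (E : Type*) :=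
  G → F → E

namespace Bismash

section Algebra

variable {Q : Type*} [Group Q] {F G : Subgroup Q} (h : F.IsComplement' G)
variable (E : Type*) [CommRing E]

instance : AddCommGroup (Bismash h E) := inferInstanceAs (AddCommGroup (G → F → E))
instance : Module E (Bismash h E) := inferInstanceAs (Module E (G → F → E))

variable {E} in
@[ext] theorem ext {f g : Bismash h E} (e : ∀ x a, f x a = g x a) : f = g :=
  funext fun x => funext fun a => e x a

@[simp] theorem add_apply (f g : Bismash h E) (x : G) (a : F) : (f + g) x a = f x a + g x a := rfl
@[simp] theorem zero_apply (x : G) (a : F) : (0 : Bismash h E) x a = 0 := rfl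
@[simp] theorem smul_apply (r : E) (f : Bismash h E) (x : G) (a : F) :
    (r • f) x a = r * f x a := rfl

theorem sum_apply {ι : Type*} (s : Finset ι) (f : ι → Bismash h E) (x : G) (a : F) :
    (∑ i ∈ s, f i) x a = ∑ i ∈ s, f i x a :=
  map_sum (⟨⟨fun f : Bismash h E => f x a, rfl⟩, fun _ _ => rfl⟩ : Bismash h E →+ E) f s

open Classical in
/-- The basis element `p_x # a`. -/
def p (x : G) (a : F) : Bismash h E := fun y b => if y = x ∧ b = a then 1 else 0

open Classical in
theorem p_apply (x y : G) (a b : F) : p h E x a y b = if y = x ∧ b = a then 1 else 0 := rfl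

variable [Fintype F] [Fintype G]

/-- The product of the bismash product; on basis elements it is
`(p_x # a)(p_y # b) = δ_{y, x ◁ a} p_x # ab`, see `p_mul_p`. -/
instance : Mul (Bismash h E) :=
  ⟨fun f g x c => ∑ a : F, f x a * g (lact h x a) (a⁻¹ * c)⟩

open Classical in
/-- The unit is `∑_x p_x # 1`, see `one_eq`. -/
instance : One (Bismash h E) := ⟨fun _ a => if a = 1 then 1 else 0⟩

theorem mul_apply (f g : Bismash h E) (x : G) (c : F) :
    (f * g) x c = ∑ a : F, f x a * g (lact h x a) (a⁻¹ * c) := rfl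

open Classical in
theorem one_apply (x : G) (a : F) : (1 : Bismash h E) x a = if a = 1 then 1 else 0 := rfl

instance : Ring (Bismash h E) :=
  { (inferInstance : AddCommGroup (Bismash h E)), (inferInstance : Mul (Bismash h E)),
    (inferInstance : One (Bismash h E)) with
    left_distrib := fun f g k => by
      ext x a; simp [mul_apply, mul_add, Finset.sum_add_distrib]
    right_distrib := fun f g k => by
      ext x a; simp [mul_apply, add_mul, Finset.sum_add_distrib]
    zero_mul := fun f => by ext x a; simp [mul_apply]
    mul_zero := fun f => by ext x a; simp [mul_apply]
    one_mul := fun f => by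
      ext x a
      rw [mul_apply, Finset.sum_eq_single 1] <;> simp +contextual [one_apply]
    mul_one := fun f => by
      ext x a
      rw [mul_apply, Finset.sum_eq_single a]
      · simp [one_apply]
      · intro b _ hb
        have : b⁻¹ * a ≠ 1 := fun e => hb (inv_mul_eq_one.mp e)
        simp [one_apply, this]
      · simp
    mul_assoc := fun f g k => by
      ext x c
      simp only [mul_apply, Finset.sum_mul, Finset.mul_sum]
      rw [Finset.sum_comm]
      refine Finset.sum_congr rfl fun a _ => ?_
      refine (Fintype.sum_equiv (Equiv.mulLeft a) _ _ fun b => ?_).symm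
      simp [lact_mul, mul_assoc] }

instance : Algebra E (Bismash h E) :=
  Algebra.ofModule
    (fun r f g => by ext x a; simp [mul_apply, Finset.mul_sum, mul_assoc])
    (fun r f g => by
      ext x a
      simp only [mul_apply, Finset.mul_sum, smul_apply]
      exact Finset.sum_congr rfl fun b _ => by ring)

instance : Module.Finite E (Bismash h E) := inferInstanceAs (Module.Finite E (G → F → E))

open Classical in
theorem p_mul_p (x y : G) (a b : F) :
    p h E x a * p h E y b = if y = lact h x a then p h E x (a * b) else 0 := by
  ext z c
  rw [mul_apply, Finset.sum_eq_single a]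
  · by_cases hz : z = x
    · subst hz
      by_cases hy : y = lact h z a
      · subst hy
        simp [p_apply, inv_mul_eq_iff_eq_mul]
      · simp [p_apply, hy, Ne.symm hy]
    · split_ifs <;> simp [p_apply, hz]
  · intro d _ hd
    simp [p_apply, hd]
  · simp

theorem one_eq : (1 : Bismash h E) = ∑ x : G, p h E x 1 := by
  ext z c
  simp [sum_apply, p_apply, one_apply, ite_and]

variable {E} in
theorem eq_sum (f : Bismash h E) : f = ∑ x : G, ∑ a : F, f x a • p h E x a := by
  ext z c
  simp [sum_apply, p_apply, ite_and]

/-! ### Counit, comultiplication and antipode -/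

variable {E}

/-- The linear map on `E^G # E F` with prescribed values on the basis elements `p_x # a`. -/
def ofBasis {M : Type*} [AddCommGroup M] [Module E M] (T : G → F → M) : Bismash h E →ₗ[E] M where
  toFun f := ∑ x : G, ∑ a : F, f x a • T x a
  map_add' f g := by simp [add_smul, Finset.sum_add_distrib]
  map_smul' r f := by simp [mul_smul, Finset.smul_sum]

@[simp] theorem ofBasis_p {M : Type*} [AddCommGroup M] [Module E M] (T : G → F → M)
    (x : G) (a : F) : ofBasis h T (p h E x a) = T x a := by
  simp [ofBasis, p_apply, ite_and]

open Classical in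
/-- `ε(p_x # a) = δ_{x,1}`. -/
def counit : Bismash h E →ₗ[E] E := ofBasis h fun x _ => if x = 1 then 1 else 0

/-- `Δ(p_x # a) = ∑_{y ∈ G} (p_{x y⁻¹} # (y ▷ a)) ⊗ (p_y # a)`. -/
def comul : Bismash h E →ₗ[E] Bismash h E ⊗[E] Bismash h E :=
  ofBasis h fun x a => ∑ y : G, p h E (x * y⁻¹) (act h y a) ⊗ₜ[E] p h E y a

/-- `S(p_x # a) = p_{(x ◁ a)⁻¹} # (x ▷ a)⁻¹`. -/
def antipode : Bismash h E →ₗ[E] Bismash h E :=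
  ofBasis h fun x a => p h E (lact h x a)⁻¹ (act h x a)⁻¹

end Algebra

section Modules

variable {Q : Type*} [Group Q] {F G : Subgroup Q} (h : F.IsComplement' G) [Fintype F] [Fintype G]
variable {E : Type*} [CommRing E] {M : Type*} [AddCommGroup M] [Module E M]

theorem antipode_p (x : G) (a : F) :
    antipode h (p h E x a) = p h E (lact h x a)⁻¹ (act h x a)⁻¹ := by simp [antipode]

/-- A module over the bismash product from operators `T x a` (the actions of `p_x # a`)
that satisfy the defining relations. -/
@[reducible] def moduleOfOperators (T : G → F → Module.End E M) (h1 : ∑ x : G, T x 1 = 1)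
    (hne : ∀ x y a b, y ≠ lact h x a → T x a * T y b = 0)
    (heq : ∀ x a b, T x a * T (lact h x a) b = T x (a * b)) : Module (Bismash h E) M :=
  Module.compHom M (S := Bismash h E) (R := Module.End E M)
    { toFun := ofBasis h T
      map_one' := by rw [one_eq, map_sum]; simpa using h1
      map_zero' := map_zero _
      map_add' := map_add _
      map_mul' := fun f g => by
        classical
        have key : ∀ x a y b, ofBasis h T (p h E x a * p h E y b) = T x a * T y b := by
          intro x a y b
          rw [p_mul_p]
          split_ifs with e
          · subst e; simp [heq]
          · rw [map_zero, hne _ _ _ _ e]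
        rw [eq_sum h f, eq_sum h g]
        simp only [Finset.sum_mul, Finset.mul_sum, map_sum, smul_mul_assoc, mul_smul_comm,
          map_smul, key, ofBasis_p] }

variable [Module (Bismash h E) M] [IsScalarTower E (Bismash h E) M]

/-- The action of an element of `E^G # E F` on a module, as an `E`-linear endomorphism. -/
def op (f : Bismash h E) : Module.End E M := Algebra.lsmul E E M f

@[simp] theorem op_apply (f : Bismash h E) (v : M) : op h f v = f • v := rfl

/-- A bilinear form is invariant if `∑ ⟨f₁ v, f₂ w⟩ = ε(f) ⟨v, w⟩` for all `f`, `v`, `w`. -/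
def IsInvariant (B : LinearMap.BilinForm E M) : Prop :=
  ∀ (f : Bismash h E) (v w : M),
    TensorProduct.lift (B.compl₁₂
      ((LinearMap.toSpanSingleton (Bismash h E) M v).restrictScalars E)
      ((LinearMap.toSpanSingleton (Bismash h E) M w).restrictScalars E)) (comul h f)
      = counit h f * B v w

open Classical in
theorem isInvariant_iff (B : LinearMap.BilinForm E M) :
    IsInvariant h B ↔ ∀ (x : G) (a : F) (v w : M),
      ∑ y : G, B (p h E (x * y⁻¹) (act h y a) • v) (p h E y a • w)
        = if x = 1 then B v w else 0 := by
  constructor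
  · intro H x a v w
    simpa [comul, counit, ite_mul] using H (p h E x a) v w
  · intro H f v w
    have := fun x a => H x a v w
    rw [eq_sum h f]
    simp only [map_sum, map_smul, Finset.sum_mul, smul_eq_mul, mul_assoc]
    refine Finset.sum_congr rfl fun x _ => Finset.sum_congr rfl fun a _ => ?_
    congr 1
    simpa [comul, counit, ite_mul] using this x a

/-- The antipode is the adjoint of an invariant form. -/
theorem IsInvariant.adjoint_p {B : LinearMap.BilinForm E M} (hB : IsInvariant h B) (x : G) (a : F)
    (v w : M) : B (p h E x a • v) w = B v (antipode h (p h E x a) • w) := by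
  classical
  have H := (isInvariant_iff h B).1 hB
  have hc : ∀ y : G, B (p h E x a • v) (p h E y 1 • w) =
      if x * y = 1 then B v (p h E (lact h y (act h y⁻¹ a)) (act h y⁻¹ a)⁻¹ • w) else 0 := by
    intro y
    set c := act h y⁻¹ a with hcdef
    have hyc : act h y c = a := by rw [hcdef, ← mul_act]; simp
    have := H (x * y) c v (p h E (lact h y c) c⁻¹ • w)
    rw [Finset.sum_eq_single y] at this
    · rw [← this, smul_smul (p h E y c), p_mul_p, if_pos rfl]
      simp [hyc]
    · intro z _ hz
      rw [smul_smul (p h E z c), p_mul_p, if_neg]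
      · simp
      · intro e
        apply hz
        have e2 := congrArg (fun t => lact h t c⁻¹) e
        simpa [← lact_mul] using e2.symm
    · simp
  have hw : w = ∑ y : G, p h E y 1 • w := by rw [← Finset.sum_smul, ← one_eq, one_smul]
  conv_lhs => rw [hw]
  rw [map_sum]
  simp only [hc]
  rw [Finset.sum_eq_single x⁻¹]
  · simp [antipode_p, inv_lact_act]
  · intro y _ hy
    rw [if_neg]
    intro e
    exact hy (eq_inv_of_mul_eq_one_right e)
  · simp

theorem IsInvariant.adjoint {B : LinearMap.BilinForm E M} (hB : IsInvariant h B)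
    (f : Bismash h E) (v w : M) : B (f • v) w = B v (antipode h f • w) := by
  rw [eq_sum h f]
  simp only [map_sum, map_smul, Finset.sum_smul, LinearMap.sum_apply, smul_assoc,
    LinearMap.smul_apply, hB.adjoint_p]

/-- `V` is isomorphic to its dual, on which `f` acts by `(f • φ)(v) = φ(S(f) v)`. -/
def IsSelfDual (E M : Type*) [CommRing E] [AddCommGroup M] [Module E M] [Module (Bismash h E) M] :
    Prop :=
  ∃ e : M ≃ₗ[E] Module.Dual E M, ∀ (f : Bismash h E) (v w : M),
    e (f • v) w = e v (antipode h f • w)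

/-- `±1`-symmetry of a bilinear form: symmetric or skew-symmetric. -/
def IsSymmOrSkew (B : LinearMap.BilinForm E M) : Prop :=
  (∀ v w, B v w = B w v) ∨ (∀ v w, B v w = -B w v)

open Classical in
/-- The Frobenius–Schur indicator (type) of an irreducible module: `1` (resp. `-1`) if there is
a non-degenerate invariant symmetric (resp. skew-symmetric) form, and `0` otherwise. -/
def indicator (E M : Type*) [CommRing E] [AddCommGroup M] [Module E M] [Module (Bismash h E) M]
    [IsScalarTower E (Bismash h E) M] : ℤ :=
  if ∃ B : LinearMap.BilinForm E M, B.Nondegenerate ∧ IsInvariant h B ∧ ∀ v w, B v w = B w v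
  then 1
  else if ∃ B : LinearMap.BilinForm E M,
    B.Nondegenerate ∧ IsInvariant h B ∧ ∀ v w, B v w = -B w v
  then -1
  else 0

/-- The orthogonal submodule `N^⊥ = {v | ⟨v, N⟩ = 0}`. -/
def perp (B : LinearMap.BilinForm E M) (hB : IsInvariant h B) (N : Submodule (Bismash h E) M) :
    Submodule (Bismash h E) M where
  carrier := {v | ∀ u ∈ N, B v u = 0}
  add_mem' ha hb u hu := by simp [ha u hu, hb u hu]
  zero_mem' u _ := by simp
  smul_mem' f v hv u hu := by
    rw [hB.adjoint]; exact hv _ (N.smul_mem _ hu)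

/-- `N` is maximal among the submodules on which the form vanishes identically. -/
def IsMaximalIsotropic (B : LinearMap.BilinForm E M) (N : Submodule (Bismash h E) M) : Prop :=
  Maximal (fun N' : Submodule (Bismash h E) M => ∀ u ∈ N', ∀ v ∈ N', B u v = 0) N

/-- The Witt kernel `N^⊥ / N` attached to a (maximal isotropic) submodule `N`. -/
abbrev WittKernel (B : LinearMap.BilinForm E M) (hB : IsInvariant h B)
    (N : Submodule (Bismash h E) M) : Type _ :=
  perp h B hB N ⧸ N.submoduleOf (perp h B hB N)

/-- `E` is a splitting field for `E^G # E F`: every irreducible module (each is a quotient of the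
regular module by a left ideal) has only scalar endomorphisms. -/
def IsSplittingField (E : Type*) [Field E] : Prop :=
  ∀ I : Submodule (Bismash h E) (Bismash h E), IsSimpleModule (Bismash h E) (Bismash h E ⧸ I) →
    ∀ f : Module.End (Bismash h E) (Bismash h E ⧸ I), ∃ c : E, ∀ v, f v = c • v

end Modules

end Bismash

section Multiplicity

variable {A : Type*} [Ring A]

/-- The number of factors of a composition series that are isomorphic to `P`. -/
def CompositionSeries.countFactors {M : Type*} [AddCommGroup M] [Module A M]
    (s : CompositionSeries (Submodule A M)) (P : Type*) [AddCommGroup P] [Module A P] : ℕ :=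
  Nat.card {i : Fin s.length //
    Nonempty (P ≃ₗ[A] (s i.succ ⧸ (s i.castSucc).submoduleOf (s i.succ)))}

open Classical in
/-- The multiplicity of the irreducible module `P` as a composition factor of `M` (and `0` if `M`
has no finite composition series). -/
def compositionMultiplicity (A P M : Type*) [Ring A] [AddCommGroup P] [Module A P]
    [AddCommGroup M] [Module A M] : ℕ :=
  if hs : ∃ s : CompositionSeries (Submodule A M), s.head = ⊥ ∧ s.last = ⊤ then
    hs.choose.countFactors P
  else 0

end Multiplicity

namespace Bismash

/-! ### Lattices over a discrete valuation ring and their reductions -/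

section Lattices

variable {Q : Type*} [Group Q] {F G : Subgroup Q} (h : F.IsComplement' G) [Fintype F] [Fintype G]
variable (R K V : Type*) [CommRing R] [IsDomain R] [IsDiscreteValuationRing R]
variable [Field K] [Algebra R K] [IsFractionRing R K]
variable [AddCommGroup V] [Module R V] [Module K V] [IsScalarTower R K V]
variable [Module (Bismash h K) V] [IsScalarTower K (Bismash h K) V]

open IsLocalRing

/-- The `R𝓑`-submodules of the `K^G # K F`-module `V`, `𝓑 = {p_x # a}`: the `R`-submodules that
are stable under all `p_x # a`. -/
structure RBSubmodule extends Submodule R V where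
  stable : ∀ (x : G) (a : F) (v : V), v ∈ carrier → p h K x a • v ∈ carrier

variable {R K V}

instance : Membership V (RBSubmodule h R K V) := ⟨fun M v => v ∈ M.toSubmodule⟩

instance : LE (RBSubmodule h R K V) := ⟨fun M N => M.toSubmodule ≤ N.toSubmodule⟩

/-- An `R𝓑`-lattice in `V`: finitely generated (over `R𝓑`, or what is the same, over `R`) and
spanning `V` over `K`. -/
structure IsLattice (L : RBSubmodule h R K V) : Prop where
  fg : L.toSubmodule.FG
  span_eq_top : Submodule.span K (L.toSubmodule : Set V) = ⊤

/-- An integral lattice: `⟨L, L⟩ ⊆ R`. -/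
def IsIntegralLattice (B : LinearMap.BilinForm K V) (L : RBSubmodule h R K V) : Prop :=
  IsLattice h L ∧ ∀ v ∈ L, ∀ w ∈ L, B v w ∈ (algebraMap R K).range

/-- A maximal element of the set of integral lattices. -/
def IsMaximalIntegralLattice (B : LinearMap.BilinForm K V) (L : RBSubmodule h R K V) : Prop :=
  IsIntegralLattice h B L ∧ ∀ L' : RBSubmodule h R K V, IsIntegralLattice h B L' → L ≤ L' → L' ≤ L

theorem range_mul_mem (r : R) {z : K} (hz : z ∈ (algebraMap R K).range) :
    algebraMap R K r * z ∈ (algebraMap R K).range :=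
  mul_mem ⟨r, rfl⟩ hz

theorem form_smul_left (B : LinearMap.BilinForm K V) (r : R) (v w : V) :
    B (r • v) w = algebraMap R K r * B v w := by
  rw [← algebraMap_smul K r v, map_smul, LinearMap.smul_apply, smul_eq_mul]

theorem form_smul_right (B : LinearMap.BilinForm K V) (r : R) (v w : V) :
    B v (r • w) = algebraMap R K r * B v w := by
  rw [← algebraMap_smul K r w, map_smul, smul_eq_mul]

theorem IsSymmOrSkew.swap {B : LinearMap.BilinForm K V} (hs : IsSymmOrSkew B) {v w : V}
    (S : AddSubgroup K) (hvw : B v w ∈ S) : B w v ∈ S := by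
  rcases hs with hs | hs
  · rwa [hs w v]
  · rw [hs w v]; exact neg_mem hvw

/-- The dual lattice `L^* = {l ∈ V | ⟨L, l⟩ ⊆ R}`. -/
def dual {B : LinearMap.BilinForm K V} (hB : IsInvariant h B) (hs : IsSymmOrSkew B)
    (L : RBSubmodule h R K V) : RBSubmodule h R K V where
  carrier := {l | ∀ v ∈ L, B v l ∈ (algebraMap R K).range}
  add_mem' ha hb v hv := by rw [map_add]; exact add_mem (ha v hv) (hb v hv)
  zero_mem' v _ := by rw [map_zero]; exact zero_mem _
  smul_mem' r l hl v hv := by rw [form_smul_right]; exact range_mul_mem r (hl v hv)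
  stable x a l hl v hv := by
    refine hs.swap (algebraMap R K).range.toAddSubgroup ?_
    rw [hB.adjoint_p, antipode_p]
    refine hs.swap (algebraMap R K).range.toAddSubgroup ?_
    exact hl _ (L.stable _ _ v hv)

theorem op_smul_comm (r : R) (f : Bismash h K) (v : V) : f • (r • v) = r • (f • v) := by
  rw [← algebraMap_smul K r v, ← algebraMap_smul K r (f • v), smul_comm]

/-- The submodule `r M`. -/
def scale (r : R) (M : RBSubmodule h R K V) : RBSubmodule h R K V where
  __ := M.toSubmodule.map (LinearMap.lsmul R V r)
  stable x a v hv := by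
    obtain ⟨w, hw, rfl⟩ := hv
    exact ⟨p h K x a • w, M.stable x a w hw, (op_smul_comm h r _ w).symm⟩

theorem mem_scale {r : R} {M : RBSubmodule h R K V} {v : V} :
    v ∈ scale h r M ↔ ∃ w ∈ M, r • w = v := Iff.rfl

/-- The sum `M + N`. -/
def sup (M N : RBSubmodule h R K V) : RBSubmodule h R K V where
  __ := M.toSubmodule ⊔ N.toSubmodule
  stable x a v hv := by
    obtain ⟨y, hy, z, hz, rfl⟩ := Submodule.mem_sup.1 hv
    rw [smul_add]
    exact Submodule.add_mem_sup (M.stable x a y hy) (N.stable x a z hz)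

open Classical in
/-- The submodule generated by a vector. -/
def gen (v : V) : RBSubmodule h R K V where
  __ := Submodule.span R (Set.range fun w : G × F => p h K w.1 w.2 • v)
  stable x a u hu := by
    refine Submodule.span_induction (p := fun u _ => p h K x a • u ∈
      Submodule.span R (Set.range fun w : G × F => p h K w.1 w.2 • v)) ?_ ?_ ?_ ?_ hu
    · rintro _ ⟨w, rfl⟩
      simp only [smul_smul, p_mul_p]
      split_ifs
      · exact Submodule.subset_span ⟨(x, a * w.2), rfl⟩
      · rw [zero_smul]; exact zero_mem _
    · rw [smul_zero]; exact zero_mem _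
    · intro y z _ _ hy hz; rw [smul_add]; exact add_mem hy hz
    · intro r y _ hy; rw [op_smul_comm]; exact Submodule.smul_mem _ r hy

theorem mem_gen (v : V) : v ∈ gen (R := R) (K := K) h v := by
  have : v = ∑ x : G, p h K x 1 • v := by rw [← Finset.sum_smul, ← one_eq, one_smul]
  change v ∈ Submodule.span R (Set.range fun w : G × F => p h K w.1 w.2 • v)
  nth_rewrite 2 [this]
  exact Submodule.sum_mem _ fun x _ => Submodule.subset_span ⟨(x, 1), rfl⟩

theorem gen_le {M : RBSubmodule h R K V} {v : V} (hv : v ∈ M) : gen h v ≤ M := by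
  refine Submodule.span_le.2 ?_
  rintro _ ⟨w, rfl⟩
  exact M.stable _ _ v hv

theorem gen_fg (v : V) : (gen (R := R) (K := K) h v).toSubmodule.FG :=
  Submodule.fg_span (Set.finite_range _)

theorem exists_pow_smul_mem {L : RBSubmodule h R K V}
    (hL : Submodule.span K (L.toSubmodule : Set V) = ⊤) {π : R} (hπ : Irreducible π) (v : V) :
    ∃ n : ℕ, π ^ n • v ∈ L := by
  have hv : v ∈ Submodule.span K (L.toSubmodule : Set V) := hL ▸ Submodule.mem_top
  have mono : ∀ {n m : ℕ} {u : V}, n ≤ m → π ^ n • u ∈ L.toSubmodule →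
      π ^ m • u ∈ L.toSubmodule := by
    intro n m u hnm hu
    obtain ⟨d, rfl⟩ := Nat.exists_eq_add_of_le' hnm
    rw [pow_add, mul_smul]
    exact L.smul_mem _ hu
  refine Submodule.span_induction (p := fun u _ => ∃ n : ℕ, π ^ n • u ∈ L.toSubmodule)
    ?_ ?_ ?_ ?_ hv
  · intro u hu; exact ⟨0, by simpa using hu⟩
  · exact ⟨0, by simp⟩
  · rintro y z _ _ ⟨n, hn⟩ ⟨m, hm⟩
    refine ⟨max n m, ?_⟩
    rw [smul_add]
    exact add_mem (mono (le_max_left _ _) hn) (mono (le_max_right _ _) hm)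
  · rintro c y _ ⟨n, hn⟩
    obtain ⟨a, b, hb, rfl⟩ := IsFractionRing.div_surjective (A := R) c
    have hb0 : b ≠ 0 := nonZeroDivisors.ne_zero hb
    obtain ⟨m, u, rfl⟩ := IsDiscreteValuationRing.eq_unit_mul_pow_irreducible hb0 hπ
    refine ⟨n + m, ?_⟩
    have hπ0 : algebraMap R K π ≠ 0 := by
      simpa using hπ.ne_zero
    have hu0 : algebraMap R K (u : R) ≠ 0 := by
      simp
    have : π ^ (n + m) • ((algebraMap R K a / algebraMap R K (m * π ^ 0 * 0 + u * π ^ m)) • y)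
        = (a * ((u⁻¹ : Rˣ) : R)) • (π ^ n • y) := by
      have hui : algebraMap R K (u : R) * algebraMap R K ((u⁻¹ : Rˣ) : R) = 1 := by
        rw [← map_mul]; simp
      simp only [← algebraMap_smul K (_ : R) (_ : V), smul_smul]
      congr 1
      simp only [map_mul, map_pow, pow_add, mul_zero, zero_add]
      field_simp
      linear_combination (algebraMap R K a) * (-hui)
    simp only [mul_zero, zero_add] at this
    rw [this]
    exact L.smul_mem _ hn

/-- `π L^* ⊆ L` for a maximal integral lattice `L`. -/
theorem smul_dual_le {B : LinearMap.BilinForm K V} (hB : IsInvariant h B) (hs : IsSymmOrSkew B)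
    {L : RBSubmodule h R K V} (hL : IsMaximalIntegralLattice h B L) {π : R} (hπ : Irreducible π)
    {x : V} (hx : x ∈ dual h hB hs L) : π • x ∈ L := by
  have hxle := gen_le h hx
  have hfg := gen_fg (R := R) (K := K) h x
  set N := gen (R := R) (K := K) h x with hN
  have hbound : ∃ n : ℕ, ∀ v ∈ N, π ^ n • v ∈ L := by
    choose f hf using fun w : G × F => exists_pow_smul_mem h hL.1.1.span_eq_top hπ
      (p h K w.1 w.2 • x)
    refine ⟨∑ w, f w, fun v hv => ?_⟩
    refine Submodule.span_induction (p := fun u _ => π ^ (∑ w, f w) • u ∈ L.toSubmodule)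
      ?_ ?_ ?_ ?_ hv
    · rintro _ ⟨w, rfl⟩
      obtain ⟨d, hd⟩ := Nat.exists_eq_add_of_le'
        (Finset.single_le_sum (f := f) (fun i _ => Nat.zero_le _) (Finset.mem_univ w))
      rw [hd, pow_add, mul_smul]
      exact L.smul_mem _ (hf w)
    · simp
    · intro y z _ _ hy hz; rw [smul_add]; exact add_mem hy hz
    · intro r y _ hy; rw [smul_comm]; exact L.smul_mem r hy
  have step : ∀ n : ℕ, (∀ v ∈ N, π ^ (n + 2) • v ∈ L) → ∀ v ∈ N, π ^ (n + 1) • v ∈ L := by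
    intro n hn v hv
    have hint : IsIntegralLattice h B (sup h L (scale h (π ^ (n + 1)) N)) := by
      refine ⟨⟨hL.1.1.fg.sup (hfg.map _), ?_⟩, ?_⟩
      · refine top_le_iff.1 (hL.1.1.span_eq_top ▸ Submodule.span_mono ?_)
        exact SetLike.coe_subset_coe.2 (le_sup_left : L.toSubmodule ≤ _)
      · intro u₁ hu₁ u₂ hu₂
        obtain ⟨l₁, hl₁, z₁, ⟨n₁, hn₁, rfl⟩, rfl⟩ := Submodule.mem_sup.1 hu₁
        obtain ⟨l₂, hl₂, z₂, ⟨n₂, hn₂, rfl⟩, rfl⟩ := Submodule.mem_sup.1 hu₂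
        simp only [LinearMap.lsmul_apply, map_add, LinearMap.add_apply]
        have hd₁ : n₁ ∈ dual h hB hs L := hxle hn₁
        have hd₂ : n₂ ∈ dual h hB hs L := hxle hn₂
        refine add_mem (add_mem (hL.1.2 _ hl₁ _ hl₂) ?_) (add_mem ?_ ?_)
        · rw [form_smul_left]
          exact range_mul_mem _ (hs.swap (algebraMap R K).range.toAddSubgroup (hd₁ _ hl₂))
        · rw [form_smul_right]
          exact range_mul_mem _ (hd₂ _ hl₁)
        · have e : B (π ^ (n + 1) • n₁) (π ^ (n + 1) • n₂)
              = algebraMap R K (π ^ n) * B (π ^ (n + 2) • n₁) n₂ := by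
            simp only [form_smul_left, form_smul_right, map_pow]; ring
          rw [e]
          exact range_mul_mem _ (hd₂ _ (hn _ hn₁))
    have hle := hL.2 _ hint (le_sup_left : L.toSubmodule ≤ _)
    exact hle (Submodule.mem_sup_right ⟨v, hv, rfl⟩)
  obtain ⟨n, hn⟩ := hbound
  have hfin : ∀ n : ℕ, (∀ v ∈ N, π ^ (n + 1) • v ∈ L) → ∀ v ∈ N, π • v ∈ L := by
    intro n
    induction n with
    | zero => intro H v hv; simpa using H v hv
    | succ n ih => intro H; exact ih (step n H)
  refine hfin n (fun v hv => ?_) x (mem_gen h x)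
  rw [pow_succ', mul_smul]
  exact L.smul_mem _ (hn v hv)

/-! ### The `k^G # k F`-module `M / N`, for `𝔭 M ⊆ N`, `k = R / 𝔭` -/

/-- The quotient `M / N` of `R𝓑`-submodules with `𝔭 M ⊆ N`. -/
def Reduction (M N : RBSubmodule h R K V)
    (_hMN : ∀ r ∈ maximalIdeal R, ∀ v ∈ M, r • v ∈ N) : Type _ :=
  M.toSubmodule ⧸ N.toSubmodule.submoduleOf M.toSubmodule

namespace Reduction

variable {h} {M N : RBSubmodule h R K V} {hMN : ∀ r ∈ maximalIdeal R, ∀ v ∈ M, r • v ∈ N}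

instance : AddCommGroup (Reduction h M N hMN) :=
  inferInstanceAs (AddCommGroup (M.toSubmodule ⧸ N.toSubmodule.submoduleOf M.toSubmodule))

instance : Module R (Reduction h M N hMN) :=
  inferInstanceAs (Module R (M.toSubmodule ⧸ N.toSubmodule.submoduleOf M.toSubmodule))

variable (hMN) in
/-- The canonical map `M → M / N`. -/
def mk : M.toSubmodule →ₗ[R] Reduction h M N hMN :=
  (N.toSubmodule.submoduleOf M.toSubmodule).mkQ

theorem mk_surjective : Function.Surjective (mk hMN) := Submodule.mkQ_surjective _

theorem mk_eq_zero {v : M.toSubmodule} : mk hMN v = 0 ↔ (v : V) ∈ N :=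
  Submodule.Quotient.mk_eq_zero _

theorem isTorsion : Module.IsTorsionBySet R (Reduction h M N hMN) (maximalIdeal R : Set R) := by
  rintro y ⟨r, hr⟩
  obtain ⟨v, rfl⟩ := mk_surjective y
  change r • mk hMN v = 0
  rw [← map_smul, mk_eq_zero]
  exact hMN r hr v v.2

instance : Module (ResidueField R) (Reduction h M N hMN) :=
  Module.IsTorsionBySet.module (I := maximalIdeal R) isTorsion

@[simp] theorem residue_smul (r : R) (y : Reduction h M N hMN) : residue R r • y = r • y :=
  Module.IsTorsionBySet.mk_smul (I := maximalIdeal R) isTorsion r y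

/-- The action of `p_x # a` on `M`. -/
def operatorAux (M : RBSubmodule h R K V) (x : G) (a : F) : M.toSubmodule →ₗ[R] M.toSubmodule where
  toFun v := ⟨p h K x a • (v : V), M.stable x a v v.2⟩
  map_add' _ _ := Subtype.ext (smul_add _ _ _)
  map_smul' r _ := Subtype.ext (op_smul_comm h r _ _)

/-- The action of `p_x # a` on `M / N`, induced from the one on `M`. -/
def operator (x : G) (a : F) : Module.End (ResidueField R) (Reduction h M N hMN) :=
  let T : Reduction h M N hMN →ₗ[R] Reduction h M N hMN :=
    Submodule.mapQ (N.toSubmodule.submoduleOf M.toSubmodule)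
      (N.toSubmodule.submoduleOf M.toSubmodule) (operatorAux M x a) fun v hv => N.stable x a (v : V) hv
  { toFun := T
    map_add' := map_add T
    map_smul' := fun r y => by
      obtain ⟨r, rfl⟩ := residue_surjective r
      rw [residue_smul, map_smul]
      exact (residue_smul r _).symm }

theorem operator_mk (x : G) (a : F) (v : M.toSubmodule) :
    operator x a (mk hMN v) = mk hMN ⟨p h K x a • (v : V), M.stable x a v v.2⟩ := rfl

/-- `M / N` is a module over `k^G # k F`: `p_x # a` acts through its action on `M`. -/
instance : Module (Bismash h (ResidueField R)) (Reduction h M N hMN) :=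
  moduleOfOperators h operator
    (by
      ext y
      obtain ⟨v, rfl⟩ := mk_surjective y
      simp only [LinearMap.sum_apply, operator_mk, ← map_sum, Module.End.one_apply]
      congr 1
      ext
      simp only [AddSubmonoidClass.coe_finsetSum]
      rw [← Finset.sum_smul, ← one_eq, one_smul])
    (by
      classical
      intro x z a b hz
      ext y
      obtain ⟨v, rfl⟩ := mk_surjective y
      simp only [Module.End.mul_apply, operator_mk, smul_smul, p_mul_p, if_neg hz, zero_smul,
        LinearMap.zero_apply]
      exact map_zero _)
    (by
      classical
      intro x a b
      ext y
      obtain ⟨v, rfl⟩ := mk_surjective y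
      simp only [Module.End.mul_apply, operator_mk, smul_smul, p_mul_p, if_true])

theorem smul_eq (f : Bismash h (ResidueField R)) (y : Reduction h M N hMN) :
    f • y = ∑ x : G, ∑ a : F, f x a • operator x a y := by
  change (ofBasis h operator f) y = _
  simp [ofBasis, LinearMap.sum_apply]

theorem p_smul (x : G) (a : F) (y : Reduction h M N hMN) :
    p h (ResidueField R) x a • y = operator x a y := by
  change (ofBasis h operator (p h (ResidueField R) x a)) y = _
  rw [ofBasis_p]

theorem p_smul_mk (x : G) (a : F) (v : M.toSubmodule) :
    p h (ResidueField R) x a • mk hMN v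
      = mk hMN ⟨p h K x a • (v : V), M.stable x a v v.2⟩ := by
  rw [p_smul, operator_mk]

instance : IsScalarTower (ResidueField R) (Bismash h (ResidueField R)) (Reduction h M N hMN) :=
  ⟨fun r f y => by simp [smul_eq, Finset.smul_sum, mul_smul]⟩

/-! The form on `M / N` induced by `c⟨-,-⟩`, for `c ∈ K` with `c⟨M, M⟩ ⊆ R` and
`c⟨M, N⟩, c⟨N, M⟩ ⊆ 𝔭`: it sends `(v + N, w + N)` to the image of `c⟨v, w⟩` in `k`. -/

section Form

variable (B : LinearMap.BilinForm K V) (c : K)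

theorem exists_value (hM : ∀ v ∈ M, ∀ w ∈ M, c * B v w ∈ (algebraMap R K).range)
    (y z : Reduction h M N hMN) : ∃ r : R,
    algebraMap R K r = c * B (mk_surjective y).choose (mk_surjective z).choose :=
  hM _ (mk_surjective y).choose.2 _ (mk_surjective z).choose.2

/-- The value of the induced form, computed with chosen representatives. -/
def value (hM : ∀ v ∈ M, ∀ w ∈ M, c * B v w ∈ (algebraMap R K).range)
    (y z : Reduction h M N hMN) : ResidueField R :=
  residue R (exists_value B c hM y z).choose


theorem value_mk (hM : ∀ v ∈ M, ∀ w ∈ M, c * B v w ∈ (algebraMap R K).range)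
    (hN : ∀ v ∈ M, ∀ w ∈ N, ∃ r ∈ maximalIdeal R, algebraMap R K r = c * B v w)
    (hN' : ∀ v ∈ N, ∀ w ∈ M, ∃ r ∈ maximalIdeal R, algebraMap R K r = c * B v w)
    (v w : M.toSubmodule) (r : R) (hr : algebraMap R K r = c * B v w) :
    value B c hM (mk hMN v) (mk hMN w) = residue R r := by
  have hv := (mk_surjective (mk hMN v)).choose_spec
  have hw := (mk_surjective (mk hMN w)).choose_spec
  have hs := (exists_value B c hM (mk hMN v) (mk hMN w)).choose_spec
  unfold value
  set s := (exists_value B c hM (mk hMN v) (mk hMN w)).choose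
  set v' := (mk_surjective (mk hMN v)).choose
  set w' := (mk_surjective (mk hMN w)).choose
  have hv' : ((v' - v : M.toSubmodule) : V) ∈ N := by
    rw [← mk_eq_zero (hMN := hMN), map_sub, hv, sub_self]
  have hw' : ((w' - w : M.toSubmodule) : V) ∈ N := by
    rw [← mk_eq_zero (hMN := hMN), map_sub, hw, sub_self]
  obtain ⟨r₁, hr₁, e₁⟩ := hN' _ hv' _ w'.2
  obtain ⟨r₂, hr₂, e₂⟩ := hN _ v.2 _ hw'
  have e : s = r + r₁ + r₂ := by
    apply IsFractionRing.injective R K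
    rw [map_add, map_add, hs, hr, e₁, e₂]
    simp only [AddSubgroupClass.coe_sub, map_sub, LinearMap.sub_apply]
    ring
  rw [e, map_add, map_add, (residue_eq_zero_iff r₁).2 hr₁, (residue_eq_zero_iff r₂).2 hr₂,
    add_zero, add_zero]

/-- The form on `M / N` induced by `c⟨-,-⟩`. -/
def form (hM : ∀ v ∈ M, ∀ w ∈ M, c * B v w ∈ (algebraMap R K).range)
    (hN : ∀ v ∈ M, ∀ w ∈ N, ∃ r ∈ maximalIdeal R, algebraMap R K r = c * B v w)
    (hN' : ∀ v ∈ N, ∀ w ∈ M, ∃ r ∈ maximalIdeal R, algebraMap R K r = c * B v w) : LinearMap.BilinForm (ResidueField R) (Reduction h M N hMN) :=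
  LinearMap.mk₂ (ResidueField R) (value B c hM)
    (fun y y' z => by
      obtain ⟨v, rfl⟩ := mk_surjective y
      obtain ⟨v', rfl⟩ := mk_surjective y'
      obtain ⟨w, rfl⟩ := mk_surjective z
      obtain ⟨r, hr⟩ := hM _ v.2 _ w.2
      obtain ⟨r', hr'⟩ := hM _ v'.2 _ w.2
      rw [← map_add, value_mk B c hM hN hN' v w r hr, value_mk B c hM hN hN' v' w r' hr',
        value_mk B c hM hN hN' (v + v') w (r + r'), map_add]
      rw [map_add, hr, hr', Submodule.coe_add, map_add, LinearMap.add_apply, mul_add])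
    (fun s y z => by
      obtain ⟨s, rfl⟩ := residue_surjective s
      obtain ⟨v, rfl⟩ := mk_surjective y
      obtain ⟨w, rfl⟩ := mk_surjective z
      obtain ⟨r, hr⟩ := hM _ v.2 _ w.2
      rw [residue_smul, ← map_smul, value_mk B c hM hN hN' v w r hr,
        value_mk B c hM hN hN' (s • v) w (s * r), map_mul, smul_eq_mul]
      rw [map_mul, hr, Submodule.coe_smul, form_smul_left]; ring)
    (fun y z z' => by
      obtain ⟨v, rfl⟩ := mk_surjective y
      obtain ⟨w, rfl⟩ := mk_surjective z
      obtain ⟨w', rfl⟩ := mk_surjective z'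
      obtain ⟨r, hr⟩ := hM _ v.2 _ w.2
      obtain ⟨r', hr'⟩ := hM _ v.2 _ w'.2
      rw [← map_add, value_mk B c hM hN hN' v w r hr, value_mk B c hM hN hN' v w' r' hr',
        value_mk B c hM hN hN' v (w + w') (r + r'), map_add]
      rw [map_add, hr, hr', Submodule.coe_add, map_add, mul_add])
    (fun s y z => by
      obtain ⟨s, rfl⟩ := residue_surjective s
      obtain ⟨v, rfl⟩ := mk_surjective y
      obtain ⟨w, rfl⟩ := mk_surjective z
      obtain ⟨r, hr⟩ := hM _ v.2 _ w.2
      rw [residue_smul, ← map_smul, value_mk B c hM hN hN' v w r hr,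
        value_mk B c hM hN hN' v (s • w) (s * r), map_mul, smul_eq_mul]
      rw [map_mul, hr, Submodule.coe_smul, form_smul_right]; ring)

theorem form_mk (hM : ∀ v ∈ M, ∀ w ∈ M, c * B v w ∈ (algebraMap R K).range)
    (hN : ∀ v ∈ M, ∀ w ∈ N, ∃ r ∈ maximalIdeal R, algebraMap R K r = c * B v w)
    (hN' : ∀ v ∈ N, ∀ w ∈ M, ∃ r ∈ maximalIdeal R, algebraMap R K r = c * B v w)
    (v w : M.toSubmodule) (r : R) (hr : algebraMap R K r = c * B v w) :
    form (hMN := hMN) B c hM hN hN' (mk hMN v) (mk hMN w) = residue R r :=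
  value_mk B c hM hN hN' v w r hr

theorem form_isInvariant (hM : ∀ v ∈ M, ∀ w ∈ M, c * B v w ∈ (algebraMap R K).range)
    (hN : ∀ v ∈ M, ∀ w ∈ N, ∃ r ∈ maximalIdeal R, algebraMap R K r = c * B v w)
    (hN' : ∀ v ∈ N, ∀ w ∈ M, ∃ r ∈ maximalIdeal R, algebraMap R K r = c * B v w)
    (hB : IsInvariant h B) :
    IsInvariant h (form (hMN := hMN) B c hM hN hN') := by
  classical
  rw [isInvariant_iff]
  intro x a y z
  obtain ⟨v, rfl⟩ := mk_surjective y
  obtain ⟨w, rfl⟩ := mk_surjective z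
  have H := (isInvariant_iff h B).1 hB x a v w
  have hex := fun u : G => hM _ (M.stable (x * u⁻¹) (act h u a) v v.2) _ (M.stable u a w w.2)
  choose r hr using hex
  obtain ⟨s, hs⟩ := hM _ v.2 _ w.2
  have e : ∑ u : G, r u = if x = 1 then s else 0 := by
    apply IsFractionRing.injective R K
    rw [map_sum]
    simp only [hr, ← Finset.mul_sum, H]
    split_ifs
    · exact hs.symm
    · simp
  simp only [p_smul_mk]
  have e' : ∀ u : G, form (hMN := hMN) B c hM hN hN'
      (mk hMN ⟨p h K (x * u⁻¹) (act h u a) • (v : V), M.stable _ _ v v.2⟩)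
      (mk hMN ⟨p h K u a • (w : V), M.stable u a w w.2⟩) = residue R (r u) :=
    fun u => form_mk B c hM hN hN' _ _ _ (hr u)
  simp only [e', ← map_sum, e, form_mk B c hM hN hN' v w s hs]
  split_ifs <;> simp

end Form

end Reduction

/-! ### The modules `Y = L / π L^*` and `Z = L^* / L` with their forms -/

section YZ

variable {B : LinearMap.BilinForm K V} (hB : IsInvariant h B) (hs : IsSymmOrSkew B)
variable {L : RBSubmodule h R K V} {π : R}

theorem exists_eq_mul_of_mem_maximalIdeal (hπ : Irreducible π) {r : R} (hr : r ∈ maximalIdeal R) : ∃ s, r = π * s := by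
  rw [hπ.maximalIdeal_eq, Ideal.mem_span_singleton] at hr
  exact hr

theorem mul_mem_maximalIdeal (hπ : Irreducible π) (s : R) : π * s ∈ maximalIdeal R :=
  Ideal.mul_mem_right _ _ ((mem_maximalIdeal _).2 hπ.not_isUnit)

theorem smul_mem_scale_dual (hL : IsMaximalIntegralLattice h B L) (hπ : Irreducible π)
    (r : R) (hr : r ∈ maximalIdeal R) (v : V) (hv : v ∈ L) :
    r • v ∈ scale h π (dual h hB hs L) := by
  obtain ⟨s, rfl⟩ := exists_eq_mul_of_mem_maximalIdeal hπ hr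
  refine ⟨s • v, fun w hw => ?_, (mul_smul _ _ _).symm⟩
  exact hL.1.2 _ hw _ (L.smul_mem s hv)

theorem smul_dual_mem (hL : IsMaximalIntegralLattice h B L) (hπ : Irreducible π)
    (r : R) (hr : r ∈ maximalIdeal R) (v : V) (hv : v ∈ dual h hB hs L) :
    r • v ∈ L := by
  obtain ⟨s, rfl⟩ := exists_eq_mul_of_mem_maximalIdeal hπ hr
  rw [mul_smul]
  exact smul_dual_le h hB hs hL hπ ((dual h hB hs L).smul_mem s hv)

/-- `Y = L / π L^*`. -/
abbrev Y (hL : IsMaximalIntegralLattice h B L) (hπ : Irreducible π) : Type _ :=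
  Reduction h L (scale h π (dual h hB hs L)) (smul_mem_scale_dual h hB hs hL hπ)

/-- `Z = L^* / L`. -/
abbrev Z (hL : IsMaximalIntegralLattice h B L) (hπ : Irreducible π) : Type _ :=
  Reduction h (dual h hB hs L) L (smul_dual_mem h hB hs hL hπ)

/-- The form on `Y`: the image of `⟨v, w⟩` in `k`. -/
def formY (hL : IsMaximalIntegralLattice h B L) (hπ : Irreducible π) : LinearMap.BilinForm (ResidueField R) (Y h hB hs hL hπ) :=
  Reduction.form B 1
    (fun v hv w hw => by rw [one_mul]; exact hL.1.2 v hv w hw)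
    (fun v hv w hw => by
      obtain ⟨u, hu, rfl⟩ := hw
      obtain ⟨r, hr⟩ := hu v hv
      refine ⟨π * r, mul_mem_maximalIdeal hπ r, ?_⟩
      rw [LinearMap.lsmul_apply, form_smul_right, map_mul, hr, one_mul])
    (fun v hv w hw => by
      obtain ⟨u, hu, rfl⟩ := hv
      obtain ⟨r, hr⟩ := hs.swap (algebraMap R K).range.toAddSubgroup (hu w hw)
      refine ⟨π * r, mul_mem_maximalIdeal hπ r, ?_⟩
      rw [LinearMap.lsmul_apply, form_smul_left, map_mul, hr, one_mul])

theorem formY_isInvariant (hL : IsMaximalIntegralLattice h B L) (hπ : Irreducible π) : IsInvariant h (formY h hB hs hL hπ) :=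
  Reduction.form_isInvariant _ _ _ _ _ hB

/-- The form on `Z`: the image of `π⟨v, w⟩` in `k`. -/
def formZ (hL : IsMaximalIntegralLattice h B L) (hπ : Irreducible π) : LinearMap.BilinForm (ResidueField R) (Z h hB hs hL hπ) :=
  Reduction.form B (algebraMap R K π)
    (fun v hv w hw => by
      rw [← form_smul_left]
      exact hw _ (smul_dual_le h hB hs hL hπ hv))
    (fun v hv w hw => by
      obtain ⟨r, hr⟩ := hs.swap (algebraMap R K).range.toAddSubgroup (hv w hw)
      exact ⟨π * r, mul_mem_maximalIdeal hπ r, by rw [map_mul, hr]⟩)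
    (fun v hv w hw => by
      obtain ⟨r, hr⟩ := hw v hv
      exact ⟨π * r, mul_mem_maximalIdeal hπ r, by rw [map_mul, hr]⟩)

theorem formZ_isInvariant (hL : IsMaximalIntegralLattice h B L) (hπ : Irreducible π) : IsInvariant h (formZ h hB hs hL hπ) :=
  Reduction.form_isInvariant _ _ _ _ _ hB

end YZ

end Lattices

/-! ### Brauer characters and decomposition numbers -/

section Brauer

open IsLocalRing

variable {Q : Type*} [Group Q] {F G : Subgroup Q} (h : F.IsComplement' G)

/-- The index set of `𝓑_{p'} = {p_y # a | a ∈ F_y, a is p-regular}`, where `F_y` is the stabilizer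
of `y` for `◁`. -/
def BReg (q : ℕ) : Type _ := {w : G × F // lact h w.1 w.2 = w.1 ∧ (orderOf w.2).Coprime q}

/-- The antipode on `𝓑_{p'}`: `S(p_y # a) = p_{(y ◁ a)⁻¹} # (y ▷ a)⁻¹`. -/
def BReg.antipode {q : ℕ} (w : BReg h q) : BReg h q :=
  ⟨((lact h w.1.1 w.1.2)⁻¹, (act h w.1.1 w.1.2)⁻¹), by
    obtain ⟨⟨x, a⟩, hx, ha⟩ := w
    dsimp only at hx ha ⊢
    have e := act_inv_of_fixed h hx
    rw [hx]
    refine ⟨(act_lact_unique h (b := a⁻¹) (y := x⁻¹) ?_).2, ?_⟩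
    · simp only [Subgroup.coe_inv, e]; group
    · have e2 := MulEquiv.orderOf_eq (MulAut.conj (x : Q)) (a : Q)
      rw [MulAut.conj_apply] at e2
      rw [orderOf_inv, ← Subgroup.orderOf_coe, e, e2, Subgroup.orderOf_coe]
      exact ha⟩

variable [Fintype F] [Fintype G]

theorem antipode_p_eq {q : ℕ} (E : Type*) [CommRing E] (w : BReg h q) :
    antipode h (p h E w.1.1 w.1.2) = p h E (w.antipode h).1.1 (w.antipode h).1.2 :=
  antipode_p h _ _

/-- The restriction to `𝓑_{p'}` of the character of a `K^G # K F`-module `V`, with values in an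
extension field `K'` of `K`. -/
def character (q : ℕ) (K K' V : Type*) [Field K] [Field K'] [Algebra K K'] [AddCommGroup V]
    [Module K V] [Module (Bismash h K) V] [IsScalarTower K (Bismash h K) V] : BReg h q → K' :=
  fun w => algebraMap K K' (LinearMap.trace K V (op h (p h K w.1.1 w.1.2)))

variable (q : ℕ) {R' : Type*} [CommRing R'] [IsLocalRing R']
variable (k K' : Type*) [Field k] [Field K'] [Algebra k (ResidueField R')] [Algebra R' K']

/-- The Brauer character of a finite-dimensional `k^G # k F`-module `W`. Here `ω ∈ R'` is a
primitive `m`-th root of unity, `m` the largest divisor of `|F|` prime to `q = char k`. The nonzero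
eigenvalues of `p_y # a ∈ 𝓑_{p'}` on `W` are powers of the image `ω̄` of `ω` in the residue field
of `R'`; the value of the Brauer character is the sum of the corresponding powers of `ω`, each
taken as often as the algebraic multiplicity of the eigenvalue says. -/
def brauerCharacter (ω : R') (W : Type*) [AddCommGroup W] [Module k W] [Module.Finite k W]
    [Module (Bismash h k) W] [IsScalarTower k (Bismash h k) W] : BReg h q → K' :=
  fun w => ∑ j ∈ Finset.range (ordCompl[q] (Fintype.card F)),
    (((op h (p h k w.1.1 w.1.2) : Module.End k W).charpoly.map
      (algebraMap k (ResidueField R'))).rootMultiplicity (residue R' ω ^ j) : K')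
      * algebraMap R' K' (ω ^ j)

/-- The set of irreducible Brauer characters. Every irreducible module is isomorphic to a quotient
of the regular module by a left ideal. -/
def irreducibleBrauerCharacters (ω : R') : Set (BReg h q → K') :=
  {φ | ∃ I : Submodule (Bismash h k) (Bismash h k), IsSimpleModule (Bismash h k) (Bismash h k ⧸ I) ∧
    φ = brauerCharacter h q k K' ω (Bismash h k ⧸ I)}

/-- `d` is the decomposition number `d(χ, φ)`: the coefficient of the irreducible Brauer character
`φ` when `χ` is written as an integral linear combination of irreducible Brauer characters. -/
def IsDecompositionNumber (ω : R') (χ φ : BReg h q → K') (d : ℤ) : Prop :=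
  ∃ c : (BReg h q → K') →₀ ℤ, ↑c.support ⊆ irreducibleBrauerCharacters h q k K' ω ∧
    χ = c.sum (fun ψ n => n • ψ) ∧ c φ = d

end Brauer

end Bismash

end

/-!
Write `H_E` for `E^G # E F`, `k` for the residue field of `R`, and `φ_W` for the Brauer character of
an `H_k`-module `W`.

*The parity argument.* For a maximal integral lattice `L`, multiplication by `π` embeds
`Z = L^* / L` into `L / πL` with quotient `Y = L / πL^*`. The Brauer character of `L / πL` is the
restricted character of `V` (`brauerCharacter_reduction`), so the multiplicities of `P` in `Y` and
`Z` add up to the odd decomposition number (`compositionMultiplicity_add_eq`). Maximality of `L`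
gives `L^** = L`, which makes the forms on `Y` and `Z` non-degenerate. If `N` is an isotropic
submodule of a module `M` with a non-degenerate invariant form, then `M / N^⊥` is dual to `N`, so
that `φ_M = φ_N + φ_{N^⊥ / N} + φ_N ∘ S`; as `φ_P ∘ S = φ_P`, the multiplicities of `P` in `M` and
in the Witt kernel `N^⊥ / N` have the same parity (`odd_compositionMultiplicity_wittKernel`).

*The type.* By Schur's lemma a self-dual irreducible `V` has an invariant form that is symmetric or
skew-symmetric, unique up to a scalar, and a maximal integral lattice exists. One of `Y` and `Z`
contains `P` with odd multiplicity. Peeling off irreducible submodules `N` of that module, and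
passing to `N^⊥ / (N ∩ N^⊥)` with its induced form, one finally meets an `N ≅ P` on which the form
is non-degenerate (`exists_form_of_odd`). So `P` has a form with the symmetry of the one on `V`, and
it has none of the opposite symmetry because `2 ≠ 0` in `k`.

*The residue field is a splitting field.* This is what makes decomposition numbers well defined and
equal to composition multiplicities: irreducible Brauer characters are then linearly independent
(`eq_zero_of_sum_brauerCharacter_eq_zero`). The assumption is only that the number field `𝕃` splits
`H_ℚ`. Let `F₀`, with `N` elements, be the residue field of the ring of integers of `𝕃` at the prime
below `π`. For `a` in the stabilizer `F_x` of order prime to `N`, the roots of unity `ω` and `ω ^ N`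
are conjugate over `𝕃`, so `p_x # a` and `p_x # a ^ N` have equal traces on all `H_𝕃`-modules. Since
`𝕃` splits `H_ℚ`, a central element built from the conjugates of `p_x # a⁻¹` acts by scalars on
irreducible modules, and comparing traces on the regular module shows that `a` and `a ^ N` are
conjugate in `F_x` (`exists_conj_of_trace_eq`). Over `F₀`, traces over the endomorphism field `D` of
an irreducible module are then fixed by the `N`-th power map, whence `D = F₀`
(`isSplittingField_of_conj`); and a splitting field stays one in every extension
(`scalar_end_of_extend`).
-/

/-! ### Characteristic polynomials and traces of endomorphisms -/

section LinearAlgebra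

variable {E : Type*} [Field E]

theorem LinearMap.charpoly_eq_charpoly_restrict_mul_charpoly_mapQ {V : Type*} [AddCommGroup V]
    [Module E V] [Module.Finite E V] (W : Submodule E V) (e : V →ₗ[E] V) (he : W ≤ W.comap e) :
    e.charpoly = (e.restrict he).charpoly * (W.mapQ W e he).charpoly := by
  classical
  let bW := Module.Free.chooseBasis E W
  let bQ := Module.Free.chooseBasis E (V ⧸ W)
  let b := Module.Basis.sumQuot bW bQ
  let B : Matrix (Module.Free.ChooseBasisIndex E W) (Module.Free.ChooseBasisIndex E (V ⧸ W)) E :=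
    Matrix.of fun i l => (b.repr (e (b (Sum.inr l)))) (Sum.inl i)
  have key : LinearMap.toMatrix b b e = Matrix.fromBlocks (LinearMap.toMatrix bW bW (e.restrict he))
      B 0 (LinearMap.toMatrix bQ bQ (W.mapQ W e he)) := by
    ext u v
    cases u with
    | inl i =>
      cases v with
      | inl k =>
        simp only [b, Module.Basis.sumQuot_inl, Matrix.fromBlocks_apply₁₁, LinearMap.toMatrix_apply]
        apply Module.Basis.sumQuot_repr_inl_of_mem
      | inr l => simp [B, LinearMap.toMatrix_apply, Matrix.fromBlocks_apply₁₂]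
    | inr j =>
      cases v with
      | inl k =>
        suffices W.mkQ (e (bW k)) = 0 by simp [LinearMap.toMatrix_apply, b, this]
        rw [← LinearMap.mem_ker, Submodule.ker_mkQ]
        exact he (Submodule.coe_mem (bW k))
      | inr l =>
        simp only [LinearMap.toMatrix_apply, Module.Basis.sumQuot_repr_inr,
          Matrix.fromBlocks_apply₂₂, b]
        rw [← Module.Basis.sumQuot_inr bW bQ l, W.mapQ_apply]
        simp
  rw [← LinearMap.charpoly_toMatrix e b, key, Matrix.charpoly_fromBlocks_zero₂₁,
    LinearMap.charpoly_toMatrix, LinearMap.charpoly_toMatrix]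

/-- Characteristic polynomials are multiplicative along short exact sequences. -/
theorem LinearMap.charpoly_eq_mul_of_exact {N M P : Type*} [AddCommGroup N] [AddCommGroup M]
    [AddCommGroup P] [Module E N] [Module E M] [Module E P] [Module.Finite E N] [Module.Finite E M]
    [Module.Finite E P] (f : N →ₗ[E] M) (g : M →ₗ[E] P) (hf : Function.Injective f)
    (hg : Function.Surjective g) (hfg : Function.Exact f g)
    (S : N →ₗ[E] N) (T : M →ₗ[E] M) (U : P →ₗ[E] P)
    (hS : ∀ v, f (S v) = T (f v)) (hU : ∀ v, g (T v) = U (g v)) :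
    T.charpoly = S.charpoly * U.charpoly := by
  have hT : LinearMap.range f ≤ (LinearMap.range f).comap T := by
    rintro _ ⟨v, rfl⟩
    exact ⟨S v, hS v⟩
  rw [LinearMap.charpoly_eq_charpoly_restrict_mul_charpoly_mapQ (LinearMap.range f) T hT]
  congr 1
  · have e1 : T.restrict hT = (LinearEquiv.ofInjective f hf).conj S := by
      refine LinearMap.ext ?_
      rintro ⟨_, v, rfl⟩
      apply Subtype.ext
      have : (LinearEquiv.ofInjective f hf).symm ⟨f v, v, rfl⟩ = v := by
        rw [LinearEquiv.symm_apply_eq]; rfl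
      simp [LinearEquiv.conj_apply, this, hS]
    rw [e1, LinearEquiv.charpoly_conj]
  · have hker : LinearMap.range f = LinearMap.ker g := by
      ext v; exact (hfg v).symm
    let e : (M ⧸ LinearMap.range f) ≃ₗ[E] P :=
      (Submodule.quotEquivOfEq _ _ hker).trans (g.quotKerEquivOfSurjective hg)
    have e1 : U = e.conj ((LinearMap.range f).mapQ _ T hT) := by
      refine LinearMap.ext fun y => ?_
      obtain ⟨v, rfl⟩ := hg y
      have : e.symm (g v) = Submodule.Quotient.mk v := by
        rw [LinearEquiv.symm_apply_eq]; rfl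
      rw [LinearEquiv.conj_apply_apply, this, Submodule.mapQ_apply, ← hU]
      rfl
    rw [e1, LinearEquiv.charpoly_conj]

theorem LinearMap.trace_eq_neg_nextCoeff_charpoly {M : Type*} [AddCommGroup M] [Module E M]
    [Module.Finite E M] (T : M →ₗ[E] M) : LinearMap.trace E M T = -T.charpoly.nextCoeff := by
  classical
  let b := Module.Free.chooseBasis E M
  rw [LinearMap.trace_eq_matrix_trace E b, ← LinearMap.charpoly_toMatrix T b]
  cases isEmpty_or_nonempty (Module.Free.ChooseBasisIndex E M)
  · simp [Matrix.trace, Polynomial.nextCoeff, Matrix.charpoly]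
  · exact Matrix.trace_eq_neg_charpoly_nextCoeff _

theorem LinearMap.trace_eq_add_of_exact {N M P : Type*} [AddCommGroup N] [AddCommGroup M]
    [AddCommGroup P] [Module E N] [Module E M] [Module E P] [Module.Finite E N] [Module.Finite E M]
    [Module.Finite E P] (f : N →ₗ[E] M) (g : M →ₗ[E] P) (hf : Function.Injective f)
    (hg : Function.Surjective g) (hfg : Function.Exact f g)
    (S : N →ₗ[E] N) (T : M →ₗ[E] M) (U : P →ₗ[E] P)
    (hS : ∀ v, f (S v) = T (f v)) (hU : ∀ v, g (T v) = U (g v)) :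
    LinearMap.trace E M T = LinearMap.trace E N S + LinearMap.trace E P U := by
  simp only [LinearMap.trace_eq_neg_nextCoeff_charpoly]
  rw [LinearMap.charpoly_eq_mul_of_exact f g hf hg hfg S T U hS hU,
    (LinearMap.charpoly_monic S).nextCoeff_mul (LinearMap.charpoly_monic U)]
  ring

open Polynomial in
/-- In characteristic `q`, raising a matrix to the `q`-th power applies the Frobenius map to the
coefficients of its characteristic polynomial. -/
theorem Matrix.charpoly_pow_char {n : Type*} [Fintype n] [DecidableEq n] (q : ℕ) [Fact q.Prime]
    [CharP E q] (M : Matrix n n E) : (M ^ q).charpoly = M.charpoly.map (frobenius E q) := by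
  cases isEmpty_or_nonempty n
  · simp [Matrix.charpoly]
  apply expand_injective (Fact.out : q.Prime).pos
  rw [← map_expand, map_frobenius_expand]
  unfold charpoly
  rw [AlgHom.map_det, ← coe_detMonoidHom, ← (detMonoidHom : Matrix n n E[X] →* E[X]).map_pow]
  apply congr_arg det
  refine matPolyEquiv.injective ?_
  rw [map_pow, matPolyEquiv_charmatrix, sub_pow_char_of_commute, ← C_pow]
  · exact (id (matPolyEquiv_eq_X_pow_sub_C q M) :)
  · exact (C M).commute_X

theorem LinearMap.trace_pow_char {M : Type*} [AddCommGroup M] [Module E M] [Module.Finite E M]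
    (q : ℕ) [Fact q.Prime] [CharP E q] (T : Module.End E M) :
    LinearMap.trace E M (T ^ q) = LinearMap.trace E M T ^ q := by
  classical
  let b := Module.Free.chooseBasis E M
  rw [LinearMap.trace_eq_neg_nextCoeff_charpoly, LinearMap.trace_eq_neg_nextCoeff_charpoly,
    ← LinearMap.charpoly_toMatrix (T ^ q) b, ← LinearMap.charpoly_toMatrix T b,
    ← LinearMap.toMatrix_pow, Matrix.charpoly_pow_char q,
    Polynomial.nextCoeff_map (RingHom.injective _)]
  exact (map_neg (_root_.frobenius E q) _).symm

theorem LinearMap.trace_pow_char_pow {M : Type*} [AddCommGroup M] [Module E M] [Module.Finite E M]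
    (q : ℕ) [Fact q.Prime] [CharP E q] (n : ℕ) (T : Module.End E M) :
    LinearMap.trace E M (T ^ q ^ n) = LinearMap.trace E M T ^ q ^ n := by
  induction n with
  | zero => simp
  | succ n ih => rw [pow_succ, pow_mul, LinearMap.trace_pow_char, ih, pow_mul]

/-- If `T ^ (m + 1) = T` and `ζ` is a primitive `m`-th root of unity in an extension field of
characteristic zero, then the traces of all positive powers of `T` are given by a single family of
eigenvalue multiplicities. -/
theorem LinearMap.exists_trace_pow_eq_sum {E' M : Type*} [Field E'] [CharZero E'] [Algebra E E']
    [AddCommGroup M] [Module E M] [Module.Finite E M] {m : ℕ} [NeZero m] {ζ : E'}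
    (hζ : IsPrimitiveRoot ζ m) (T : Module.End E M) (hT : T ^ (m + 1) = T) :
    ∃ n : ℕ → ℕ, ∀ s, 0 < s → algebraMap E E' (LinearMap.trace E M (T ^ s))
      = ∑ j ∈ Finset.range m, (n j : E') * (ζ ^ j) ^ s := by
  classical
  have hm : 0 < m := Nat.pos_of_neZero m
  have hm0 : (m : E') ≠ 0 := Nat.cast_ne_zero.2 hm.ne'
  let b := Module.Free.chooseBasis E M
  let A : Matrix _ _ E' := (LinearMap.toMatrix b b T).map (algebraMap E E')
  have hA : A ^ (m + 1) = A := by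
    have := congrArg (fun X => (LinearMap.toMatrix b b X).map (algebraMap E E')) hT
    rwa [← LinearMap.toMatrix_pow, Matrix.map_pow] at this
  have htr : ∀ s, algebraMap E E' (LinearMap.trace E M (T ^ s)) = Matrix.trace (A ^ s) := by
    intro s
    rw [LinearMap.trace_eq_matrix_trace E b, ← LinearMap.toMatrix_pow, ← Matrix.map_pow]
    simp [Matrix.trace, Matrix.map_apply]
  -- the spectral idempotents of `A`
  let e : ℕ → Matrix _ _ E' := fun j =>
    (m : E')⁻¹ • ∑ i ∈ Finset.range m, (ζ ^ j)⁻¹ ^ (i + 1) • A ^ (i + 1)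
  have hAe : ∀ j, A * e j = ζ ^ j • e j := by
    intro j
    have hz : ζ ^ j ≠ 0 := pow_ne_zero _ (hζ.ne_zero hm.ne')
    simp only [e, mul_smul_comm, Finset.mul_sum, ← pow_succ']
    rw [smul_comm (ζ ^ j)]
    congr 1
    rw [Finset.smul_sum]
    have h1 : ∀ i, ζ ^ j • (ζ ^ j)⁻¹ ^ (i + 1) • A ^ (i + 1) = (ζ ^ j)⁻¹ ^ i • A ^ (i + 1) := by
      intro i
      rw [smul_smul]; congr 1
      rw [pow_succ]; field_simp
    simp only [h1]
    obtain ⟨l, rfl⟩ : ∃ l, m = l + 1 := ⟨m - 1, by omega⟩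
    rw [Finset.sum_range_succ, Finset.sum_range_succ']
    congr 1
    have : (ζ ^ j)⁻¹ ^ (l + 1) = 1 := by
      rw [inv_pow, ← pow_mul, mul_comm, pow_mul, hζ.pow_eq_one]; simp
    rw [this, hA]; simp
  have hApe : ∀ i j, A ^ i * e j = (ζ ^ j) ^ i • e j := by
    intro i j
    induction i with
    | zero => simp
    | succ i ih => rw [pow_succ, mul_assoc, hAe, mul_smul_comm, ih, smul_smul, pow_succ, mul_comm]
  have hidem : ∀ j, e j * e j = e j := by
    intro j
    have hz : ζ ^ j ≠ 0 := pow_ne_zero _ (hζ.ne_zero hm.ne')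
    conv_lhs => enter [1]; simp only [e]
    rw [smul_mul_assoc, Finset.sum_mul]
    simp only [smul_mul_assoc, hApe, smul_smul, ← mul_pow, inv_mul_cancel₀ hz, one_pow, one_smul]
    rw [Finset.sum_const, Finset.card_range, ← Nat.cast_smul_eq_nsmul E', smul_smul,
      inv_mul_cancel₀ hm0, one_smul]
  have hsum : ∑ j ∈ Finset.range m, ζ ^ j • e j = A := by
    simp only [e, Finset.smul_sum, smul_smul]
    rw [Finset.sum_comm]
    obtain ⟨l, hl⟩ : ∃ l, m = l + 1 := ⟨m - 1, by omega⟩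
    have h2 : ∀ i ∈ Finset.range m, ∑ j ∈ Finset.range m,
        (ζ ^ j * ((m : E')⁻¹ * (ζ ^ j)⁻¹ ^ (i + 1))) • A ^ (i + 1)
          = if i = 0 then A else 0 := by
      intro i hi
      rw [← Finset.sum_smul]
      have h3 : ∀ j, ζ ^ j * ((m : E')⁻¹ * (ζ ^ j)⁻¹ ^ (i + 1)) = (m : E')⁻¹ * ((ζ⁻¹) ^ i) ^ j := by
        intro j
        have hz : ζ ≠ 0 := hζ.ne_zero hm.ne'
        have h6 : ζ ^ j * ζ⁻¹ ^ j = 1 := by rw [← mul_pow, mul_inv_cancel₀ hz, one_pow]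
        rw [← inv_pow ζ j, pow_succ, ← pow_mul, ← pow_mul, mul_comm i j]
        linear_combination ((m : E')⁻¹ * ζ⁻¹ ^ (j * i)) * h6
      simp only [h3, ← Finset.mul_sum]
      split_ifs with hi0
      · subst hi0; simp [hm0]
      · have hne : ζ⁻¹ ^ i ≠ 1 := by
          intro h4
          rw [inv_pow, inv_eq_one] at h4
          exact hζ.pow_ne_one_of_pos_of_lt hi0 (Finset.mem_range.1 hi) h4
        have h5 := geom_sum_eq hne m
        rw [h5, ← pow_mul, mul_comm i m, pow_mul, inv_pow, hζ.pow_eq_one]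
        simp
    rw [Finset.sum_congr rfl h2, Finset.sum_ite_eq' , if_pos (Finset.mem_range.2 hm)]
  have hpow : ∀ s, 0 < s → A ^ s = ∑ j ∈ Finset.range m, (ζ ^ j) ^ s • e j := by
    intro s hs
    obtain ⟨s, rfl⟩ : ∃ t, s = t + 1 := ⟨s - 1, by omega⟩
    rw [pow_succ]
    conv_lhs => enter [2]; rw [← hsum]
    rw [Finset.mul_sum]
    refine Finset.sum_congr rfl fun j _ => ?_
    rw [mul_smul_comm, hApe, smul_smul, pow_succ']
  have hnat : ∀ j, ∃ n : ℕ, Matrix.trace (e j) = n := by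
    intro j
    have hi : IsIdempotentElem (Matrix.toLin' (e j)) := by
      unfold IsIdempotentElem
      rw [Module.End.mul_eq_comp, ← Matrix.toLin'_mul, hidem]
    exact ⟨_, (Matrix.trace_toLin'_eq _).symm.trans
      (LinearMap.IsIdempotentElem.isProj_range _ hi).trace⟩
  choose n hn using hnat
  refine ⟨n, fun s hs => ?_⟩
  rw [htr, hpow s hs, Matrix.trace_sum]
  refine Finset.sum_congr rfl fun j _ => ?_
  rw [Matrix.trace_smul, hn, smul_eq_mul, mul_comm]

end LinearAlgebra

/-! ### Operators with `T ^ (m + 1) = T` and reduction of root multiplicities -/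

section RootsOfUnity

open Polynomial

variable {E E' M : Type*} [Field E] [Field E'] [Algebra E E'] [AddCommGroup M] [Module E M]
  [Module.Finite E M]

theorem LinearMap.pow_eq_self_of_isRoot_charpoly {T : Module.End E M} {n : ℕ} (hT : T ^ n = T)
    {μ : E'} (hμ : (T.charpoly.map (algebraMap E E')).IsRoot μ) : μ ^ n = μ := by
  classical
  rw [← LinearMap.charpoly_baseChange, ← Module.End.hasEigenvalue_iff_isRoot_charpoly] at hμ
  obtain ⟨v, hv⟩ := hμ.exists_hasEigenvector
  have h1 : (T.baseChange E') ^ n = T.baseChange E' := by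
    rw [← LinearMap.baseChange_pow, hT]
  have h2 := hv.pow_apply n
  rw [h1, hv.apply_eq_smul] at h2
  exact (smul_left_injective _ hv.2 h2).symm

theorem LinearMap.splits_charpoly_of_pow_eq_self {T : Module.End E M} {m : ℕ} (hm : 0 < m)
    (hT : T ^ (m + 1) = T) {ζ : E'} (hζ : IsPrimitiveRoot ζ m) :
    (T.charpoly.map (algebraMap E E')).Splits := by
  have : NeZero m := ⟨hm.ne'⟩
  refine (IsAlgClosed.splits ((T.charpoly.map (algebraMap E E')).map
    (algebraMap E' (AlgebraicClosure E')))).of_splits_map_of_injective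
    (RingHom.injective _) ?_
  intro μ hμ
  rw [Polynomial.map_map, ← IsScalarTower.algebraMap_eq] at hμ
  have h1 := LinearMap.pow_eq_self_of_isRoot_charpoly hT (isRoot_of_mem_roots hμ)
  by_cases h0 : μ = 0
  · exact ⟨0, by simp [h0]⟩
  · have h2 : μ ^ m = 1 := by
      rw [pow_succ] at h1
      exact mul_right_cancel₀ h0 (by rw [h1, one_mul])
    obtain ⟨j, _, hj⟩ := (hζ.map_of_injective
      (FaithfulSMul.algebraMap_injective E' (AlgebraicClosure E'))).eq_pow_of_pow_eq_one h2
    exact ⟨ζ ^ j, by rw [map_pow, hj]⟩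

theorem LinearMap.eq_zero_or_eq_pow_of_mem_roots_charpoly {T : Module.End E M} {m : ℕ} (hm : 0 < m)
    (hT : T ^ (m + 1) = T) {ζ : E'} (hζ : IsPrimitiveRoot ζ m) {μ : E'}
    (hμ : μ ∈ (T.charpoly.map (algebraMap E E')).roots) : μ = 0 ∨ ∃ j < m, ζ ^ j = μ := by
  have : NeZero m := ⟨hm.ne'⟩
  have h1 := LinearMap.pow_eq_self_of_isRoot_charpoly hT (isRoot_of_mem_roots hμ)
  by_cases h0 : μ = 0
  · exact Or.inl h0
  · have h2 : μ ^ m = 1 := by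
      rw [pow_succ] at h1
      exact mul_right_cancel₀ h0 (by rw [h1, one_mul])
    exact Or.inr (hζ.eq_pow_of_pow_eq_one h2)

/-- The trace of an operator with `T ^ (m + 1) = T`, as the sum of its eigenvalues. -/
theorem LinearMap.trace_eq_sum_rootMultiplicity {T : Module.End E M} {m : ℕ} (hm : 0 < m)
    (hT : T ^ (m + 1) = T) {ζ : E'} (hζ : IsPrimitiveRoot ζ m) :
    algebraMap E E' (LinearMap.trace E M T) = ∑ j ∈ Finset.range m,
      ((T.charpoly.map (algebraMap E E')).rootMultiplicity (ζ ^ j) : E') * ζ ^ j := by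
  classical
  have hs := LinearMap.splits_charpoly_of_pow_eq_self hm hT hζ
  rw [← LinearMap.trace_baseChange, Module.End.trace_eq_sum_roots_charpoly_of_splits
    (by rwa [LinearMap.charpoly_baseChange]), LinearMap.charpoly_baseChange,
    Finset.sum_multiset_count]
  simp only [count_roots, nsmul_eq_mul]
  have hinj : Set.InjOn (fun j => ζ ^ j) (Finset.range m : Set ℕ) := by
    intro i hi j hj hij
    exact hζ.pow_inj (by simpa using hi) (by simpa using hj) hij
  rw [← Finset.sum_image (s := Finset.range m) (g := fun j => ζ ^ j)
    (f := fun μ => ((T.charpoly.map (algebraMap E E')).rootMultiplicity μ : E') * μ) hinj]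
  refine Finset.sum_congr_of_eq_on_inter ?_ ?_ fun _ _ _ => rfl
  · intro μ h1 h2
    rcases LinearMap.eq_zero_or_eq_pow_of_mem_roots_charpoly hm hT hζ
      (Multiset.mem_toFinset.1 h1) with h0 | ⟨j, hj, hj'⟩
    · rw [h0, mul_zero]
    · exact absurd (Finset.mem_image.2 ⟨j, Finset.mem_range.2 hj, hj'⟩) h2
  · intro μ _ h2
    rw [← count_roots, Multiset.count_eq_zero_of_notMem (fun h => h2 (Multiset.mem_toFinset.2 h)),
      Nat.cast_zero, zero_mul]

/-- Root multiplicities at powers of a primitive `m`-th root of unity `ω` do not change under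
reduction, for a polynomial whose roots are `0` and powers of `ω`, as long as the order of `ω` is
preserved. -/
theorem Polynomial.rootMultiplicity_map_eq_of_isPrimitiveRoot {A K k : Type*} [CommRing A]
    [IsDomain A] [Field K] [Field k] {i : A →+* K} (hi : Function.Injective i) (φ : A →+* k)
    {f : A[X]} (hf : f.Monic) (hs : (f.map i).Splits) {ω : A} {m : ℕ} (hm : 0 < m)
    (hφ : IsPrimitiveRoot (φ ω) m)
    (hroots : ∀ μ ∈ (f.map i).roots, μ = 0 ∨ ∃ j < m, i ω ^ j = μ) {j : ℕ} (hj : j < m) :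
    (f.map φ).rootMultiplicity (φ ω ^ j) = (f.map i).rootMultiplicity (i ω ^ j) := by
  classical
  have hsplit : f.Splits := by
    refine hs.of_splits_map_of_injective hi fun μ hμ => ?_
    rcases hroots μ hμ with rfl | ⟨l, _, rfl⟩
    · exact ⟨0, map_zero _⟩
    · exact ⟨ω ^ l, map_pow _ _ _⟩
  have hr1 := hsplit.roots_map_of_ne_zero (φ := φ) (hf.map φ).ne_zero
  have hr2 := hsplit.roots_map_of_injective hi
  have hmem : ∀ μ ∈ f.roots, μ = 0 ∨ ∃ l < m, ω ^ l = μ := by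
    intro μ hμ
    rcases hroots (i μ) (by rw [hr2]; exact Multiset.mem_map_of_mem _ hμ) with h | ⟨l, hl, h⟩
    · exact Or.inl (hi (by rw [h, map_zero]))
    · exact Or.inr ⟨l, hl, hi (by rw [map_pow, h])⟩
  rw [← count_roots, ← count_roots, hr1, hr2, ← map_pow, ← map_pow,
    Multiset.count_map, Multiset.count_map]
  congr 1
  refine Multiset.filter_congr fun μ hμ => ?_
  constructor
  · intro h
    rcases hmem μ hμ with rfl | ⟨l, hl, rfl⟩
    · rw [map_zero, map_pow] at h
      exact absurd h (pow_ne_zero _ (hφ.ne_zero hm.ne'))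
    · rw [map_pow, map_pow] at h
      rw [hφ.pow_inj hj hl h]
  · intro h
    rw [hi h]

end RootsOfUnity

noncomputable section

namespace Bismash

/-! ### The antipode and invariance of forms -/

section Actions

variable {Q : Type*} [Group Q] {F G : Subgroup Q} (h : F.IsComplement' G)

theorem act_mul (x : G) (a b : F) : act h x (a * b) = act h x a * act h (lact h x a) b := by
  refine (act_lact_unique h (y := lact h (lact h x a) b) ?_).1
  rw [Subgroup.coe_mul, Subgroup.coe_mul, ← mul_assoc, mul_eq h x a, mul_assoc,
    mul_eq h (lact h x a) b, mul_assoc]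

theorem act_lact_inv (x : G) (a : F) : act h (lact h x a)⁻¹ (act h x a)⁻¹ = a⁻¹ ∧
    lact h (lact h x a)⁻¹ (act h x a)⁻¹ = x⁻¹ := by
  apply act_lact_unique
  have := mul_eq h x a
  simp only [Subgroup.coe_inv]
  rw [← mul_inv_rev, ← mul_inv_rev, this]

theorem lact_inv_of_fixed {x : G} {a : F} (hx : lact h x a = x) : lact h x a⁻¹ = x := by
  conv_lhs => rw [← hx]
  rw [← lact_mul]; simp

theorem lact_pow_of_fixed {x : G} {a : F} (hx : lact h x a = x) (n : ℕ) : lact h x (a ^ n) = x := by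
  induction n with
  | zero => simp
  | succ n ih => rw [pow_succ, lact_mul, ih, hx]

theorem lact_injective (a : F) : Function.Injective fun x : G => lact h x a := by
  intro x y hxy
  have := congrArg (fun t => lact h t a⁻¹) hxy
  simpa [← lact_mul] using this

end Actions

section Antipode

variable {Q : Type*} [Group Q] {F G : Subgroup Q} (h : F.IsComplement' G) [Fintype F] [Fintype G]
variable {E : Type*} [CommRing E]

/-- Induction on linear combinations of the basis elements `p_x # a`. -/
theorem induction_p {motive : Bismash h E → Prop} (f : Bismash h E) (zero : motive 0)
    (add : ∀ f g, motive f → motive g → motive (f + g))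
    (smul_p : ∀ (r : E) x a, motive (r • p h E x a)) : motive f := by
  rw [eq_sum h f]
  refine Finset.sum_induction _ motive add zero fun x _ => ?_
  exact Finset.sum_induction _ motive add zero fun a _ => smul_p _ x a

theorem antipode_antipode (f : Bismash h E) : antipode h (antipode h f) = f := by
  induction f using induction_p with
  | zero => simp
  | add f g hf hg => rw [map_add, map_add, hf, hg]
  | smul_p r x a =>
    rw [map_smul, map_smul, antipode_p, antipode_p, (act_lact_inv h x a).1,
      (act_lact_inv h x a).2, inv_inv, inv_inv]

theorem antipode_mul (f g : Bismash h E) :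
    antipode h (f * g) = antipode h g * antipode h f := by
  classical
  induction f using induction_p with
  | zero => simp
  | add f f' hf hf' => rw [add_mul, map_add, hf, hf', map_add, mul_add]
  | smul_p r x a =>
    induction g using induction_p with
    | zero => simp
    | add f f' hf hf' => rw [mul_add, map_add, hf, hf', map_add, add_mul]
    | smul_p s y b =>
      rw [smul_mul_smul_comm, map_smul, map_smul, map_smul, smul_mul_smul_comm, mul_comm s r,
        p_mul_p, antipode_p, antipode_p, p_mul_p, (act_lact_inv h y b).2]
      congr 1
      by_cases hy : y = lact h x a
      · subst hy
        rw [if_pos rfl, if_pos rfl, antipode_p, lact_mul, act_mul, mul_inv_rev]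
      · rw [if_neg hy, if_neg (fun e => hy (inv_injective e).symm), map_zero]

variable {M : Type*} [AddCommGroup M] [Module E M] [Module (Bismash h E) M]
  [IsScalarTower E (Bismash h E) M]

/-- A form is invariant as soon as the antipode is its adjoint. -/
theorem isInvariant_of_adjoint {B : LinearMap.BilinForm E M}
    (hB : ∀ (f : Bismash h E) v w, B (f • v) w = B v (antipode h f • w)) : IsInvariant h B := by
  classical
  rw [isInvariant_iff]
  intro x a v w
  have key : ∀ y : G, B (p h E (x * y⁻¹) (act h y a) • v) (p h E y a • w)
      = if x = 1 then B v (p h E (lact h y a) 1 • w) else 0 := by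
    intro y
    rw [hB, antipode_p, smul_smul, p_mul_p, (act_lact_inv h _ _).2]
    by_cases hx : x = 1
    · subst hx
      rw [if_pos (by simp), if_pos rfl, one_mul, inv_lact_act, ← mul_act]
      simp
    · rw [if_neg, if_neg hx]
      · simp
      · intro e
        apply hx
        simpa using e
  simp only [key]
  split_ifs with hx
  · rw [← map_sum, ← Finset.sum_smul]
    have : ∑ y : G, p h E (lact h y a) 1 = ∑ y : G, p h E y 1 :=
      (Function.Injective.bijective_of_finite (lact_injective h a)).sum_comp (fun y => p h E y 1)
    rw [this, ← one_eq, one_smul]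
  · simp

theorem isInvariant_iff_adjoint {B : LinearMap.BilinForm E M} :
    IsInvariant h B ↔ ∀ (f : Bismash h E) v w, B (f • v) w = B v (antipode h f • w) :=
  ⟨fun hB => hB.adjoint h, isInvariant_of_adjoint h⟩

theorem op_mul (f g : Bismash h E) : (op h (f * g) : Module.End E M) = op h f * op h g :=
  map_mul (Algebra.lsmul E E M) f g

theorem op_add (f g : Bismash h E) : (op h (f + g) : Module.End E M) = op h f + op h g :=
  map_add (Algebra.lsmul E E M) f g

theorem op_smul (r : E) (f : Bismash h E) : (op h (r • f) : Module.End E M) = r • op h f :=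
  map_smul (Algebra.lsmul E E M) r f

theorem op_pow (f : Bismash h E) (n : ℕ) : (op h (f ^ n) : Module.End E M) = op h f ^ n :=
  map_pow (Algebra.lsmul E E M) f n

theorem op_zero : (op h (0 : Bismash h E) : Module.End E M) = 0 :=
  map_zero (Algebra.lsmul E E M)

end Antipode

/-! ### Powers, conjugation and a central element -/

section Central

variable {Q : Type*} [Group Q] {F G : Subgroup Q} (h : F.IsComplement' G) [Fintype F] [Fintype G]
variable (E : Type*) [CommRing E]

theorem p_pow {x : G} {a : F} (hx : lact h x a = x) {n : ℕ} (hn : 0 < n) :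
    p h E x a ^ n = p h E x (a ^ n) := by
  classical
  induction n, hn using Nat.le_induction with
  | base => simp
  | succ n _ ih => rw [pow_succ, ih, p_mul_p, lact_pow_of_fixed h hx, if_pos rfl, pow_succ]

theorem p_conj {x : G} {a c : F} (hx : lact h x a = x) :
    p h E (lact h x c) c⁻¹ * p h E x a * p h E x c = p h E (lact h x c) (c⁻¹ * a * c) := by
  classical
  have h1 : lact h (lact h x c) c⁻¹ = x := by rw [← lact_mul]; simp
  rw [p_mul_p, if_pos h1.symm, p_mul_p, lact_mul, h1, hx, if_pos rfl]

/-- The sum of the conjugates of `p_x # a`, for `a` in the stabilizer of `x`. It is central, see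
`commute_conjSum`. -/
def conjSum (x : G) (a : F) : Bismash h E := ∑ c : F, p h E (lact h x c) (c⁻¹ * a * c)

theorem commute_conjSum {x : G} {a : F} (hx : lact h x a = x) (f : Bismash h E) :
    Commute (conjSum h E x a) f := by
  classical
  induction f using induction_p with
  | zero => exact Commute.zero_right _
  | add f g hf hg => exact hf.add_right hg
  | smul_p r y b =>
    refine Commute.smul_right ?_ r
    unfold Commute SemiconjBy conjSum
    rw [Finset.sum_mul, Finset.mul_sum,
      ← Fintype.sum_equiv (Equiv.mulRight b) _
        (fun c => p h E y b * p h E (lact h x c) (c⁻¹ * a * c)) fun c => rfl]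
    refine Finset.sum_congr rfl fun c _ => ?_
    have h1 : lact h (lact h x c) (c⁻¹ * a * c) = lact h x c := by
      rw [← lact_mul, mul_assoc, mul_inv_cancel_left, lact_mul, hx]
    simp only [p_mul_p, h1, Equiv.coe_mulRight, lact_mul]
    by_cases hy : y = lact h x c
    · subst hy
      rw [if_pos rfl, if_pos rfl]
      congr 1; group
    · rw [if_neg hy, if_neg]
      intro e
      exact hy (lact_injective h b e).symm

/-- The regular character of `conjSum x a * (p_x # b)` counts, up to the factor `|F|`, the elements
of the stabilizer of `x` that conjugate `a` to `b⁻¹`; see `trace_regular`. -/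
theorem conjSum_mul_p_apply {x : G} {a : F} (hx : lact h x a = x) (b : F) [DecidableEq G]
    [DecidableEq F] :
    ∑ y : G, (conjSum h E x a * p h E x b) y 1
      = (Finset.univ.filter fun c : F => lact h x c = x ∧ c⁻¹ * a * c * b = 1).card := by
  classical
  unfold conjSum
  rw [Finset.sum_mul]
  simp only [sum_apply]
  rw [Finset.sum_comm, Finset.card_filter, Nat.cast_sum]
  refine Finset.sum_congr rfl fun c _ => ?_
  have h1 : lact h (lact h x c) (c⁻¹ * a * c) = lact h x c := by
    rw [← lact_mul, mul_assoc, mul_inv_cancel_left, lact_mul, hx]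
  simp only [p_mul_p, h1]
  by_cases hc : lact h x c = x
  · by_cases hb : c⁻¹ * a * c * b = 1
    · simp [hc, hb, p_apply]
    · have hb' : ¬ (1 : F) = c⁻¹ * a * c * b := fun e => hb e.symm
      simp [hc, hb, hb', p_apply]
  · have hc' : ¬ x = lact h x c := fun e => hc e.symm
    simp [hc, hc']

/-- The basis `p_x # a`. -/
def basis : Module.Basis (G × F) E (Bismash h E) :=
  Module.Basis.ofEquivFun
    { toFun := fun f w => f w.1 w.2
      invFun := fun g x a => g (x, a)
      left_inv := fun _ => rfl
      right_inv := fun _ => rfl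
      map_add' := fun _ _ => rfl
      map_smul' := fun _ _ => rfl }

theorem basis_repr (f : Bismash h E) (w : G × F) : (basis h E).repr f w = f w.1 w.2 := rfl

open Classical in
theorem basis_apply (w : G × F) : basis h E w = p h E w.1 w.2 := by
  refine (basis h E).ext_elem (fun v => ?_)
  rw [Module.Basis.repr_self, basis_repr, p_apply, Finsupp.single_apply]
  simp only [Prod.ext_iff, eq_comm]

/-- The trace of the regular representation. -/
theorem trace_regular (f : Bismash h E) :
    LinearMap.trace E (Bismash h E) (op h f) = Fintype.card F * ∑ y : G, f y 1 := by
  classical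
  rw [LinearMap.trace_eq_matrix_trace E (basis h E)]
  have key : ∀ w : G × F, LinearMap.toMatrix (basis h E) (basis h E) (op h f) w w = f w.1 1 := by
    intro w
    rw [LinearMap.toMatrix_apply, basis_repr, basis_apply]
    change (f * p h E w.1 w.2) w.1 w.2 = _
    rw [mul_apply, Finset.sum_eq_single 1]
    · simp [p_apply]
    · intro a _ ha
      simp [p_apply, ha]
    · simp
  simp only [Matrix.trace, Matrix.diag, key]
  rw [Fintype.sum_prod_type, Finset.mul_sum]
  simp

end Central

/-! ### Extension of scalars -/

section BaseChange

variable {Q : Type*} [Group Q] {F G : Subgroup Q} (h : F.IsComplement' G) [Fintype F] [Fintype G]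
variable (E E' : Type*) [CommRing E] [CommRing E'] [Algebra E E']

variable {E} in
/-- The image of an element under a ring homomorphism `E → E'` of the coefficients. -/
def extendFun (f : Bismash h E) : Bismash h E' := fun x a => algebraMap E E' (f x a)

variable {E} in
theorem extendFun_apply (f : Bismash h E) (x : G) (a : F) :
    extendFun h E' f x a = algebraMap E E' (f x a) := rfl

/-- The ring homomorphism `E^G # E F → E'^G # E' F` given by a ring homomorphism `E → E'`. -/
def extend : Bismash h E →+* Bismash h E' where
  toFun := extendFun h E'
  map_one' := by
    classical
    ext x a; rw [extendFun_apply, one_apply, one_apply]; split_ifs <;> simp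
  map_mul' f g := by
    ext x a
    simp only [extendFun_apply, mul_apply, map_sum, map_mul]
  map_zero' := by ext x a; exact map_zero _
  map_add' f g := by ext x a; exact map_add _ _ _

theorem extend_apply (f : Bismash h E) (x : G) (a : F) :
    extend h E E' f x a = algebraMap E E' (f x a) := rfl

@[simp] theorem extend_p (x : G) (a : F) : extend h E E' (p h E x a) = p h E' x a := by
  classical
  ext y b
  rw [extend_apply, p_apply, p_apply]; split_ifs <;> simp

theorem extend_smul (r : E) (f : Bismash h E) :
    extend h E E' (r • f) = algebraMap E E' r • extend h E E' f := by
  ext x a; exact map_mul (algebraMap E E') r (f x a)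

end BaseChange

end Bismash

end

/-! ### Density and finiteness for modules over finite-dimensional algebras -/

section Density

variable {E A : Type*} [Field E] [Ring A] [Algebra E A]

/-- A form of the density theorem: if `W i₀` has only scalar endomorphisms and is not isomorphic to
the other members of a finite family of simple modules, then every linear endomorphism of `W i₀` is
the action of an element of the algebra that annihilates the other members. -/
theorem exists_smul_eq_of_scalar_end {ι : Type*} [Fintype ι] (W : ι → Type*)
    [∀ i, AddCommGroup (W i)] [∀ i, Module E (W i)] [∀ i, Module A (W i)]
    [∀ i, IsScalarTower E A (W i)] [∀ i, Module.Finite E (W i)] [∀ i, IsSimpleModule A (W i)]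
    (i₀ : ι) (hs : ∀ g : Module.End A (W i₀), ∃ c : E, ∀ v, g v = c • v)
    (hne : ∀ i, i ≠ i₀ → IsEmpty (W i₀ ≃ₗ[A] W i)) (g : Module.End E (W i₀)) :
    ∃ f : A, (∀ v : W i₀, f • v = g v) ∧ ∀ i, i ≠ i₀ → ∀ v : W i, f • v = 0 := by
  classical
  have schur : ∀ i, i ≠ i₀ → ∀ φ : W i₀ →ₗ[A] W i, φ = 0 := fun i hi φ =>
    (LinearMap.bijective_or_eq_zero φ).resolve_left fun hb =>
      (hne i hi).false (LinearEquiv.ofBijective φ hb)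
  have schur' : ∀ i, i ≠ i₀ → ∀ φ : W i →ₗ[A] W i₀, φ = 0 := fun i hi φ =>
    (LinearMap.bijective_or_eq_zero φ).resolve_left fun hb =>
      (hne i hi).false (LinearEquiv.ofBijective φ hb).symm
  have key : ∀ (φ : Module.End A (∀ i, W i)) (m : ∀ i, W i),
      Pi.single i₀ (g ((φ m) i₀)) = φ (Pi.single i₀ (g (m i₀))) := by
    intro φ m
    obtain ⟨c, hc⟩ := hs (LinearMap.proj i₀ ∘ₗ φ ∘ₗ LinearMap.single A W i₀)
    have hc' : ∀ w, φ (Pi.single i₀ w) i₀ = c • w := hc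
    have hm : (φ m) i₀ = c • m i₀ := by
      conv_lhs => rw [← Finset.univ_sum_single m]
      rw [map_sum, Finset.sum_apply, Finset.sum_eq_single i₀, hc']
      · intro j _ hj
        exact LinearMap.congr_fun
          (schur' j hj (LinearMap.proj i₀ ∘ₗ φ ∘ₗ LinearMap.single A W j)) (m j)
      · simp
    funext i
    by_cases hi : i = i₀
    · subst hi
      rw [Pi.single_eq_same, hm, hc', map_smul]
    · rw [Pi.single_eq_of_ne hi]
      exact (LinearMap.congr_fun
        (schur i hi (LinearMap.proj i ∘ₗ φ ∘ₗ LinearMap.single A W i₀)) _).symm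
  let f₀ : Module.End (Module.End A (∀ i, W i)) (∀ i, W i) :=
    { toFun := fun m => Pi.single i₀ (g (m i₀))
      map_add' := fun m m' => by rw [Pi.add_apply, map_add, Pi.single_add]
      map_smul' := fun φ m => key φ m }
  obtain ⟨s, hspan⟩ := Module.Finite.fg_top (R := E) (M := ∀ i, W i)
  obtain ⟨f, hf⟩ := jacobson_density f₀ s
  have hall : ∀ m : ∀ i, W i, Pi.single i₀ (g (m i₀)) = f • m := by
    intro m
    have hm : m ∈ Submodule.span E (s : Set (∀ i, W i)) := hspan ▸ Submodule.mem_top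
    induction hm using Submodule.span_induction with
    | mem m hm => exact hf m hm
    | zero => simp
    | add m m' _ _ h1 h2 => rw [Pi.add_apply, map_add, Pi.single_add, h1, h2, smul_add]
    | smul c m _ h1 => rw [Pi.smul_apply, map_smul, Pi.single_smul, h1, smul_comm]
  refine ⟨f, fun v => ?_, fun i hi v => ?_⟩
  · have := congrFun (hall (Pi.single i₀ v)) i₀
    simpa using this.symm
  · have := congrFun (hall (Pi.single i v)) i
    rw [Pi.single_eq_of_ne hi] at this
    simpa using this.symm

end Density

noncomputable section

namespace Bismash

section Modules

variable {Q : Type*} [Group Q] {F G : Subgroup Q} (h : F.IsComplement' G) [Fintype F] [Fintype G]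
variable {E : Type*} [Field E] {M : Type*} [AddCommGroup M] [Module E M] [Module (Bismash h E) M]
  [IsScalarTower E (Bismash h E) M]

instance finite_submodule [Module.Finite E M] (N : Submodule (Bismash h E) M) :
    Module.Finite E N :=
  inferInstanceAs (Module.Finite E (N.restrictScalars E))

instance finite_quotient [Module.Finite E M] (N : Submodule (Bismash h E) M) :
    Module.Finite E (M ⧸ N) :=
  Module.Finite.of_surjective (N.mkQ.restrictScalars E) N.mkQ_surjective

theorem isNoetherian_of_finite (M : Type*) [AddCommGroup M] [Module E M] [Module (Bismash h E) M]
    [IsScalarTower E (Bismash h E) M] [Module.Finite E M] : IsNoetherian (Bismash h E) M :=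
  isNoetherian_of_tower E inferInstance

theorem isArtinian_of_finite (M : Type*) [AddCommGroup M] [Module E M] [Module (Bismash h E) M]
    [IsScalarTower E (Bismash h E) M] [Module.Finite E M] : IsArtinian (Bismash h E) M :=
  isArtinian_of_tower E inferInstance

theorem finite_of_isSimpleModule (M : Type*) [AddCommGroup M] [Module E M]
    [Module (Bismash h E) M] [IsScalarTower E (Bismash h E) M] [IsSimpleModule (Bismash h E) M] :
    Module.Finite E M := by
  obtain ⟨I, _, ⟨e⟩⟩ := isSimpleModule_iff_quot_maximal.1 ‹IsSimpleModule (Bismash h E) M›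
  exact Module.Finite.of_surjective (e.symm.toLinearMap.restrictScalars E) e.symm.surjective

theorem exists_isSimpleModule_submodule [Module.Finite E M] [Nontrivial M] :
    ∃ N : Submodule (Bismash h E) M, IsSimpleModule (Bismash h E) N := by
  have := isArtinian_of_finite h (E := E) M
  obtain ⟨N, hN⟩ := IsAtomic.exists_atom (Submodule (Bismash h E) M)
  exact ⟨N, isSimpleModule_iff_isAtom.2 hN⟩

theorem charpoly_op_eq_mul_of_exact {N P : Type*} [AddCommGroup N] [Module E N]
    [Module (Bismash h E) N] [IsScalarTower E (Bismash h E) N] [AddCommGroup P] [Module E P]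
    [Module (Bismash h E) P] [IsScalarTower E (Bismash h E) P] [Module.Finite E N]
    [Module.Finite E M] [Module.Finite E P] (i : N →ₗ[Bismash h E] M) (g : M →ₗ[Bismash h E] P)
    (hi : Function.Injective i) (hg : Function.Surjective g) (hig : Function.Exact i g)
    (f : Bismash h E) : (op h f : Module.End E M).charpoly
      = (op h f : Module.End E N).charpoly * (op h f : Module.End E P).charpoly :=
  LinearMap.charpoly_eq_mul_of_exact (i.restrictScalars E) (g.restrictScalars E) hi hg hig _ _ _
    (fun v => map_smul i f v) (fun v => map_smul g f v)

theorem trace_op_eq_add [Module.Finite E M] (N : Submodule (Bismash h E) M) (f : Bismash h E) :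
    LinearMap.trace E M (op h f) = LinearMap.trace E N (op h f)
      + LinearMap.trace E (M ⧸ N) (op h f) :=
  LinearMap.trace_eq_add_of_exact (N.subtype.restrictScalars E) (N.mkQ.restrictScalars E)
    N.injective_subtype N.mkQ_surjective (LinearMap.exact_subtype_mkQ N) _ _ _
    (fun _ => rfl) (fun _ => rfl)

theorem scalar_end_of_isSplittingField (hE : IsSplittingField h E) [IsSimpleModule (Bismash h E) M]
    (g : Module.End (Bismash h E) M) : ∃ c : E, ∀ v, g v = c • v := by
  obtain ⟨I, hI, ⟨e⟩⟩ := isSimpleModule_iff_quot_maximal.1 ‹IsSimpleModule (Bismash h E) M›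
  have := isSimpleModule_iff_isCoatom.2 hI.1
  obtain ⟨c, hc⟩ := hE I this (e.toLinearMap ∘ₗ g ∘ₗ e.symm.toLinearMap)
  refine ⟨c, fun v => e.injective ?_⟩
  have := hc (e v)
  simp only [LinearMap.comp_apply, LinearEquiv.coe_coe, LinearEquiv.symm_apply_apply] at this
  rw [this]
  exact (map_smul (e.toLinearMap.restrictScalars E) c v).symm

/-- A splitting field stays one under extension of the field. -/
theorem scalar_end_of_extend (hE : IsSplittingField h E) {E' : Type*} [Field E'] [Algebra E E']
    {W : Type*} [AddCommGroup W] [Module E' W] [Module (Bismash h E') W]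
    [IsScalarTower E' (Bismash h E') W] [IsSimpleModule (Bismash h E') W]
    (g : Module.End (Bismash h E') W) : ∃ c : E', ∀ v, g v = c • v := by
  classical
  let : Module E W := Module.compHom W (algebraMap E E')
  let : Module (Bismash h E) W := Module.compHom W (extend h E E')
  have smulA : ∀ (f : Bismash h E) (v : W), f • v = extend h E E' f • v := fun _ _ => rfl
  have smulE : ∀ (r : E) (v : W), r • v = algebraMap E E' r • v := fun _ _ => rfl
  have : IsScalarTower E (Bismash h E) W :=
    ⟨fun r f v => by rw [smulA, smulE, smulA, extend_smul, smul_assoc]⟩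
  have := IsSimpleModule.nontrivial (Bismash h E') W
  obtain ⟨v, hv⟩ := exists_ne (0 : W)
  let N : Submodule (Bismash h E) W := Submodule.span (Bismash h E) {v}
  have hN : Module.Finite E N := by
    have hsurj : Function.Surjective
        ((LinearMap.toSpanSingleton (Bismash h E) W v).rangeRestrict) :=
      LinearMap.surjective_rangeRestrict _
    have hr : LinearMap.range (LinearMap.toSpanSingleton (Bismash h E) W v) = N :=
      (LinearMap.span_singleton_eq_range _ _ _).symm
    rw [← hr]
    exact Module.Finite.of_surjective
      ((LinearMap.toSpanSingleton (Bismash h E) W v).rangeRestrict.restrictScalars E) hsurj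
  have : Nontrivial N := ⟨⟨⟨v, Submodule.mem_span_singleton_self v⟩, 0, fun e =>
    hv (congrArg Subtype.val e)⟩⟩
  obtain ⟨S, hS⟩ := exists_isSimpleModule_submodule h (E := E) (M := N)
  have := IsSimpleModule.nontrivial (Bismash h E) S
  obtain ⟨s, hs⟩ := exists_ne (0 : S)
  -- `f` acts on `S` as a projection onto the line spanned by `s`
  obtain ⟨ℓ, hℓ⟩ := Module.Projective.exists_dual_ne_zero E hs
  obtain ⟨f, hf, -⟩ := exists_smul_eq_of_scalar_end (E := E) (A := Bismash h E)
    (fun _ : Unit => S) () (scalar_end_of_isSplittingField h hE) (fun i hi => (hi rfl).elim)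
    (((ℓ s)⁻¹ • ℓ).smulRight s)
  let s' : W := ((s : N) : W)
  have hs' : s' ≠ 0 := by simpa [s'] using hs
  have hfS : ∀ x : S, extend h E E' f • ((x : N) : W) ∈ Submodule.span E' {s'} := by
    intro x
    have := congrArg (fun y : S => ((y : N) : W)) (hf x)
    have e : extend h E E' f • ((x : N) : W) = ((ℓ s)⁻¹ * ℓ x) • s' := this
    rw [e, smulE]
    exact Submodule.smul_mem _ _ (Submodule.mem_span_singleton_self _)
  have hfs : extend h E E' f • s' = s' := by
    have := congrArg (fun y : S => ((y : N) : W)) (hf s)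
    have e : extend h E E' f • s' = ((ℓ s)⁻¹ * ℓ s) • s' := this
    rw [e, inv_mul_cancel₀ hℓ, one_smul]
  -- the `E'`-span of `S` is a submodule, hence everything
  let U : Submodule (Bismash h E') W :=
    { carrier := Submodule.span E' (Set.range fun x : S => ((x : N) : W))
      add_mem' := add_mem
      zero_mem' := zero_mem _
      smul_mem' := by
        intro b w hw
        change b • w ∈ Submodule.span E' (Set.range fun x : S => ((x : N) : W))
        induction b using induction_p with
        | zero => rw [zero_smul]; exact zero_mem _
        | add b b' hb hb' => rw [add_smul]; exact add_mem hb hb'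
        | smul_p r x a =>
          rw [smul_assoc]
          refine Submodule.smul_mem _ _ ?_
          induction hw using Submodule.span_induction with
          | mem w hw =>
            obtain ⟨y, rfl⟩ := hw
            refine Submodule.subset_span ⟨p h E x a • y, ?_⟩
            change extend h E E' (p h E x a) • ((y : N) : W) = _
            rw [extend_p]
          | zero => rw [smul_zero]; exact zero_mem _
          | add w w' _ _ h1 h2 => rw [smul_add]; exact add_mem h1 h2
          | smul c w _ h1 => rw [smul_comm]; exact Submodule.smul_mem _ _ h1 }
  have hU : U = ⊤ := (eq_bot_or_eq_top U).resolve_left fun e => hs' <| by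
    have : s' ∈ U := Submodule.subset_span ⟨s, rfl⟩
    rwa [e, Submodule.mem_bot] at this
  -- so `f` projects `W` to the line `E' s'`, and an endomorphism preserves this line
  have hfW : ∀ w : W, extend h E E' f • w ∈ Submodule.span E' {s'} := by
    intro w
    have hw : w ∈ U := hU ▸ Submodule.mem_top
    replace hw : w ∈ Submodule.span E' (Set.range fun x : S => ((x : N) : W)) := hw
    induction hw using Submodule.span_induction with
    | mem w hw => obtain ⟨y, rfl⟩ := hw; exact hfS y
    | zero => rw [smul_zero]; exact zero_mem _
    | add w w' _ _ h1 h2 => rw [smul_add]; exact add_mem h1 h2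
    | smul c w _ h1 => rw [smul_comm]; exact Submodule.smul_mem _ _ h1
  have hg : g s' ∈ Submodule.span E' {s'} := by
    have := hfW (g s')
    rwa [← map_smul, hfs] at this
  obtain ⟨c, hc⟩ := Submodule.mem_span_singleton.1 hg
  refine ⟨c, fun w => ?_⟩
  have hker : LinearMap.ker (g - c • (1 : Module.End (Bismash h E') W)) = ⊤ :=
    (eq_bot_or_eq_top _).resolve_left fun e => hs' <| by
      have : s' ∈ LinearMap.ker (g - c • (1 : Module.End (Bismash h E') W)) := by
        rw [LinearMap.mem_ker, LinearMap.sub_apply, LinearMap.smul_apply, Module.End.one_apply,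
          hc, sub_self]
      rwa [e, Submodule.mem_bot] at this
  have hw : w ∈ LinearMap.ker (g - c • (1 : Module.End (Bismash h E') W)) :=
    hker ▸ Submodule.mem_top
  rw [LinearMap.mem_ker, LinearMap.sub_apply, LinearMap.smul_apply, Module.End.one_apply] at hw
  exact sub_eq_zero.1 hw

end Modules

end Bismash

end

/-! ### Conjugacy of `a` and `a ^ N` over a splitting number field -/

section Frobenius

open Polynomial

/-- Let `N` be the cardinality of a residue field of the integrally closed domain `o` with fraction
field `L`. If the order `m` of the root of unity `ω` is invertible in the residue field, then
`ω ^ N` is a root of every polynomial over `L` with root `ω`: the minimal polynomial of `ω` has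
coefficients in `o`, so that the Frobenius map permutes the roots of its reduction, and reduction is
injective on `m`-th roots of unity. -/
theorem aeval_pow_card_eq_zero_of_aeval_eq_zero {o L A K' k' F₀ : Type*} [CommRing o] [IsDomain o]
    [IsIntegrallyClosed o] [Field L] [Algebra o L] [IsFractionRing o L] [CommRing A] [Field K']
    [Algebra L K'] [Algebra o K'] [IsScalarTower o L K'] [Field k'] [Field F₀] [Fintype F₀]
    (i : A →+* K') (hi : Function.Injective i) (φ : A →+* k') (θ : o →+* A)
    (hθ : ∀ y, i (θ y) = algebraMap o K' y) (ρ : o →+* F₀) (τ : F₀ →+* k')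
    (hρ : ∀ y, φ (θ y) = τ (ρ y)) {ω : A} {m : ℕ} (hm : 0 < m) (hω : ω ^ m = 1)
    (hmk : (m : k') ≠ 0) (g : L[X]) (hg : aeval (i ω) g = 0) :
    aeval (i ω ^ Fintype.card F₀) g = 0 := by
  set N := Fintype.card F₀
  have hint : IsIntegral o (i ω) := by
    refine ⟨X ^ m - 1, monic_X_pow_sub_C 1 hm.ne', ?_⟩
    simp [← map_pow, hω]
  have hinj : Function.Injective (algebraMap o K') := by
    rw [IsScalarTower.algebraMap_eq o L K', RingHom.coe_comp]
    exact (algebraMap L K').injective.comp (IsFractionRing.injective o L)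
  have : FaithfulSMul o K' := (faithfulSMul_iff_algebraMap_injective o K').2 hinj
  set f := minpoly o (i ω) with hf
  have hfL : minpoly L (i ω) = f.map (algebraMap o L) :=
    minpoly.isIntegrallyClosed_eq_field_fractions' L hint
  suffices hfN : eval₂ θ (ω ^ N) f = 0 by
    have h1 : aeval (i ω ^ N) (minpoly L (i ω)) = 0 := by
      rw [hfL, aeval_map_algebraMap, aeval_def, ← map_pow]
      have h2 : algebraMap o K' = i.comp θ := RingHom.ext fun y => (hθ y).symm
      rw [h2, ← hom_eval₂, hfN, map_zero]
    obtain ⟨g', rfl⟩ := minpoly.dvd L (i ω) hg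
    rw [map_mul, h1, zero_mul]
  have hfω : eval₂ θ ω f = 0 := by
    apply hi
    rw [hom_eval₂, map_zero]
    have h2 : algebraMap o K' = i.comp θ := RingHom.ext fun y => (hθ y).symm
    rw [← h2]
    exact minpoly.aeval o (i ω)
  have hfk : eval₂ (φ.comp θ) (φ ω ^ N) f = 0 := by
    have h2 : φ.comp θ = τ.comp ρ := RingHom.ext hρ
    have h3 : eval₂ (φ.comp θ) (φ ω) f = 0 := by rw [← hom_eval₂, hfω, map_zero]
    rw [h2, ← eval₂_map, eval₂_eq_eval_map] at h3 ⊢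
    rw [← expand_eval, ← map_expand, FiniteField.expand_card, Polynomial.map_pow, eval_pow, h3,
      zero_pow Fintype.card_ne_zero]
  obtain ⟨g', hg'⟩ : f ∣ X ^ m - 1 :=
    minpoly.isIntegrallyClosed_dvd hint (by
      rw [map_sub, map_pow, aeval_X, map_one, ← map_pow, hω, map_one, sub_self])
  have hprod : eval₂ θ (ω ^ N) f * eval₂ θ (ω ^ N) g' = 0 := by
    rw [← eval₂_mul, ← hg']
    rw [eval₂_sub, eval₂_X_pow, eval₂_one, ← pow_mul, mul_comm N m, pow_mul, hω, one_pow, sub_self]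
  have : IsDomain A := hi.isDomain i
  refine (mul_eq_zero.1 hprod).resolve_right fun h0 => hmk ?_
  have hgk : eval₂ (φ.comp θ) (φ ω ^ N) g' = 0 := by
    rw [← map_pow, ← hom_eval₂, h0, map_zero]
  -- a double root of `X ^ m - 1` would make `m` zero
  have hder := congrArg (fun r => eval₂ (φ.comp θ) (φ ω ^ N) (derivative r)) hg'
  simp only [derivative_mul, eval₂_add, eval₂_mul, hfk, hgk, mul_zero, zero_mul, add_zero] at hder
  have hunit : IsUnit (φ ω) := IsUnit.of_pow_eq_one (n := m) (by rw [← map_pow, hω, map_one]) hm.ne'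
  have h5 : (m : k') * ((φ ω ^ N) ^ (m - 1)) = 0 := by
    simpa [derivative_X_pow, eval₂_mul] using hder
  exact (mul_eq_zero.1 h5).resolve_right (pow_ne_zero _ (pow_ne_zero _ hunit.ne_zero))

end Frobenius

noncomputable section

namespace Bismash

section Conjugacy

universe u v

variable {Q : Type u} [Group Q] {F G : Subgroup Q} (h : F.IsComplement' G) [Fintype F] [Fintype G]

/-- Over a field of characteristic zero, the trace of `p_x # (a ^ N)` on a module equals that of
`p_x # a` if `ζ ↦ ζ ^ N` preserves the algebraic relations of the roots of unity involved. -/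
theorem trace_p_pow_eq {L K' : Type*} [Field L] [Field K'] [CharZero K'] [Algebra L K']
    {m N : ℕ} (hm : 0 < m) (hN : 0 < N) {ζ : K'} (hζ : IsPrimitiveRoot ζ m)
    (hconj : ∀ g : Polynomial L, Polynomial.aeval ζ g = 0 → Polynomial.aeval (ζ ^ N) g = 0)
    {x : G} {a : F} (hx : lact h x a = x) (ha : a ^ m = 1) (M : Type*) [AddCommGroup M]
    [Module L M] [Module (Bismash h L) M] [IsScalarTower L (Bismash h L) M] [Module.Finite L M] :
    LinearMap.trace L M (op h (p h L x (a ^ N))) = LinearMap.trace L M (op h (p h L x a)) := by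
  have : NeZero m := ⟨hm.ne'⟩
  have hT : (op h (p h L x a) : Module.End L M) ^ (m + 1) = op h (p h L x a) := by
    rw [← op_pow, p_pow h L hx (Nat.succ_pos m), pow_succ, ha, one_mul]
  obtain ⟨n, hn⟩ := LinearMap.exists_trace_pow_eq_sum hζ _ hT
  let g : Polynomial L := ∑ j ∈ Finset.range m, Polynomial.C (n j : L) * Polynomial.X ^ j
    - Polynomial.C (LinearMap.trace L M (op h (p h L x a)))
  have hg : ∀ s, Polynomial.aeval (ζ ^ s) g = ∑ j ∈ Finset.range m, (n j : K') * (ζ ^ j) ^ s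
      - algebraMap L K' (LinearMap.trace L M (op h (p h L x a))) := by
    intro s
    simp only [g, map_sub, map_sum, map_mul, Polynomial.aeval_C, map_natCast, map_pow,
      Polynomial.aeval_X]
    congr 1
    refine Finset.sum_congr rfl fun j _ => ?_
    rw [← pow_mul, ← pow_mul, mul_comm s j]
  have h1 : Polynomial.aeval ζ g = 0 := by
    have h2 := hg 1
    rw [← hn 1 one_pos, pow_one, pow_one, sub_self] at h2
    exact h2
  have h3 := hconj g h1
  rw [hg, ← hn N hN, ← op_pow, p_pow h L hx hN, sub_eq_zero] at h3
  exact (algebraMap L K').injective h3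

/-- Over a splitting field of characteristic zero, elements of the stabilizer of `x` that have the
same character values are conjugate in the stabilizer. The regular character of the product with the
central element `conjSum` detects conjugacy, and a central element acts on every composition factor
of the regular module by a scalar. -/
theorem exists_conj_of_trace_eq {L : Type v} [Field L] [CharZero L] (hsplit : IsSplittingField h L)
    {x : G} {a b : F} (hx : lact h x a = x)
    (htr : ∀ (M : Type (max u v)) [AddCommGroup M] [Module L M] [Module (Bismash h L) M]
      [IsScalarTower L (Bismash h L) M] [Module.Finite L M],
      LinearMap.trace L M (op h (p h L x b)) = LinearMap.trace L M (op h (p h L x a))) :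
    ∃ c : F, lact h x c = x ∧ b = c⁻¹ * a * c := by
  classical
  set z := conjSum h L x a⁻¹ with hz
  have hcomm := commute_conjSum h L (lact_inv_of_fixed h hx)
  -- `z` acts by a scalar on irreducible modules; traces are additive along submodules
  have key : ∀ (n : ℕ) (M : Type (max u v)) [AddCommGroup M] [Module L M] [Module (Bismash h L) M]
      [IsScalarTower L (Bismash h L) M] [Module.Finite L M], Module.finrank L M = n →
      LinearMap.trace L M (op h (z * p h L x b)) = LinearMap.trace L M (op h (z * p h L x a)) := by
    intro n
    induction n using Nat.strong_induction_on with
    | _ n ih =>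
      intro M _ _ _ _ _ hn
      rcases subsingleton_or_nontrivial M with hM | hM
      · rw [Subsingleton.elim (op h (z * p h L x b) : Module.End L M) (op h (z * p h L x a))]
      obtain ⟨N, hN⟩ := exists_isSimpleModule_submodule h (E := L) (M := M)
      have hNnt := IsSimpleModule.nontrivial (Bismash h L) N
      rw [trace_op_eq_add h N, trace_op_eq_add h N]
      congr 1
      · obtain ⟨c, hc⟩ := scalar_end_of_isSplittingField h hsplit
          (M := N) { toFun := fun v => z • v
                     map_add' := smul_add z
                     map_smul' := fun f v => by
                      rw [smul_smul, (hcomm f).eq, ← smul_smul, RingHom.id_apply] }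
        have hc' : (op h z : Module.End L N) = c • 1 := LinearMap.ext hc
        rw [op_mul, op_mul, hc', smul_mul_assoc, smul_mul_assoc, one_mul, one_mul, map_smul,
          map_smul, htr]
      · refine ih _ ?_ (M ⧸ N) rfl
        have h1 := Submodule.finrank_quotient_add_finrank (N.restrictScalars L)
        have h2 : 0 < Module.finrank L (N.restrictScalars L) :=
          (Module.finrank_pos : 0 < Module.finrank L N)
        have h3 : Module.finrank L (M ⧸ N) = Module.finrank L (M ⧸ N.restrictScalars L) := rfl
        omega
  -- on the regular module, both sides count elements of the stabilizer
  have hreg := key _ (Bismash h L) rfl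
  rw [trace_regular, trace_regular, conjSum_mul_p_apply h L (lact_inv_of_fixed h hx),
    conjSum_mul_p_apply h L (lact_inv_of_fixed h hx)] at hreg
  have hF : (Fintype.card F : L) ≠ 0 := Nat.cast_ne_zero.2 Fintype.card_ne_zero
  have hcard := Nat.cast_injective (mul_left_cancel₀ hF hreg)
  have hpos : 0 < (Finset.univ.filter fun c : F => lact h x c = x ∧ c⁻¹ * a⁻¹ * c * a = 1).card :=
    Finset.card_pos.2 ⟨1, by simp⟩
  rw [← hcard] at hpos
  obtain ⟨c, hc⟩ := Finset.card_pos.1 hpos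
  obtain ⟨-, hc1, hc2⟩ := Finset.mem_filter.1 hc
  refine ⟨c, hc1, ?_⟩
  rw [← inv_inj, ← mul_eq_one_iff_eq_inv.1 hc2]
  group

end Conjugacy

end Bismash

end

/-! ### A finite splitting field -/

section FiniteField

open Polynomial in
theorem FiniteField.mem_range_algebraMap_of_pow_card_eq {F₀ D : Type*} [Field F₀] [Fintype F₀]
    [Field D] [Algebra F₀ D] {d : D} (hd : d ^ Fintype.card F₀ = d) :
    d ∈ (algebraMap F₀ D).range := by
  have hm : (X ^ Fintype.card F₀ - X : F₀[X]) ≠ 0 :=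
    FiniteField.X_pow_card_sub_X_ne_zero F₀ Fintype.one_lt_card
  have hs : (X ^ Fintype.card F₀ - X : F₀[X]).Splits := by
    rw [splits_iff_card_roots, FiniteField.roots_X_pow_card_sub_X,
      FiniteField.X_pow_card_sub_X_natDegree_eq F₀ Fintype.one_lt_card]
    rfl
  refine hs.mem_range_of_isRoot hm ?_
  simp [hd]

/-- A high power of `q` kills the `q`-part of an element; the exponent can be taken to be a power
of a given `q ^ f`. -/
theorem exists_coprime_orderOf_pow_pow {H : Type*} [Group H] [Finite H] (a : H) {q : ℕ}
    (hq : q.Prime) {f : ℕ} (hf : 0 < f) : ∃ r, (orderOf (a ^ (q ^ f) ^ r)).Coprime q := by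
  refine ⟨(orderOf a).factorization q, ?_⟩
  have hn : orderOf a ≠ 0 := (orderOf_pos a).ne'
  refine Nat.Coprime.coprime_dvd_left ?_ (Nat.coprime_ordCompl hq hn).symm
  apply orderOf_dvd_of_pow_eq_one
  rw [← pow_mul, ← orderOf_dvd_iff_pow_eq_one]
  conv_lhs => rw [← Nat.ordProj_mul_ordCompl_eq_self (orderOf a) q]
  refine mul_dvd_mul ?_ dvd_rfl
  rw [← pow_mul]
  exact pow_dvd_pow q (Nat.le_mul_of_pos_left _ hf)

end FiniteField

noncomputable section

namespace Bismash

section SplittingFinite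

variable {Q : Type*} [Group Q] {F G : Subgroup Q} (h : F.IsComplement' G) [Fintype F] [Fintype G]

/-- A finite field `F₀` with `N` elements is a splitting field as soon as `a ^ N` is conjugate to
`a` in the stabilizer of `x`, for all `q`-regular `a` in this stabilizer. The endomorphism ring of a
simple module is a finite field `D`, and the trace over `D` of the action of each `p_x # a` is
fixed by the `N`-th power map, so lies in `F₀`; by density all elements of `D` are such traces. -/
theorem isSplittingField_of_conj {F₀ : Type*} [Field F₀] [Fintype F₀] {q : ℕ} [Fact q.Prime]
    [CharP F₀ q] (hconj : ∀ (x : G) (a : F), lact h x a = x → (orderOf a).Coprime q →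
      ∃ c : F, lact h x c = x ∧ a ^ Fintype.card F₀ = c⁻¹ * a * c) :
    IsSplittingField h F₀ := by
  classical
  intro I hI g
  set A := Bismash h F₀
  set S := A ⧸ I
  obtain ⟨⟨f, hf0⟩, -, hN⟩ := FiniteField.card F₀ q
  replace hN : Fintype.card F₀ = q ^ f := hN
  have : Finite S := Module.finite_of_finite F₀
  have : Finite (Module.End A S) := Finite.of_injective (fun φ => (φ : S → S))
    DFunLike.coe_injective
  let _ : Field (Module.End A S) := littleWedderburn (Module.End A S)
  have hcompat : ∀ (r : F₀) (v : S), (algebraMap F₀ (Module.End A S) r) v = r • v := fun r v => rfl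
  have : CharP (Module.End A S) q :=
    charP_of_injective_algebraMap (algebraMap F₀ (Module.End A S)).injective q
  have : Module.Finite (Module.End A S) S := Module.Finite.of_finite
  let T : A →+* Module.End (Module.End A S) S := Module.toModuleEnd (Module.End A S) (S := A) S
  let t : A → Module.End A S := fun b => LinearMap.trace (Module.End A S) S (T b)
  have ht_comm : ∀ b c, t (b * c) = t (c * b) := by
    intro b c
    simp only [t, map_mul]
    exact LinearMap.trace_mul_comm _ _ _
  have ht_pow : ∀ b n, t (b ^ q ^ n) = t b ^ q ^ n := by
    intro b n
    simp only [t, map_pow]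
    exact LinearMap.trace_pow_char_pow q n _
  have ht_add : ∀ b c, t (b + c) = t b + t c := by
    intro b c; simp only [t, map_add]
  have ht_smul : ∀ (r : F₀) b, t (r • b) = algebraMap F₀ (Module.End A S) r * t b := by
    intro r b
    have : T (r • b) = (algebraMap F₀ (Module.End A S) r) • T b := by
      refine LinearMap.ext fun v => ?_
      exact smul_assoc r b v
    simp only [t, this, map_smul, smul_eq_mul]
  have hreg : ∀ (x : G) (a : F), lact h x a = x → (orderOf a).Coprime q →
      t (p h F₀ x a) ∈ (algebraMap F₀ (Module.End A S)).range := by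
    intro x a hx ha
    apply FiniteField.mem_range_algebraMap_of_pow_card_eq
    obtain ⟨c, hc, hac⟩ := hconj x a hx ha
    have hcinv := lact_inv_of_fixed h hc
    have h1 := p_conj h F₀ (c := c) hx
    rw [hc] at h1
    rw [hN, ← ht_pow, p_pow h F₀ hx (pow_pos (Fact.out : q.Prime).pos f), ← hN, hac, ← h1,
      mul_assoc, ht_comm, mul_assoc, p_mul_p, if_pos hc.symm, mul_inv_cancel, p_mul_p,
      if_pos hx.symm, mul_one]
  -- a power of `a` is regular, and iterates of the Frobenius map are injective
  have hfix : ∀ (x : G) (a : F), lact h x a = x →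
      t (p h F₀ x a) ∈ (algebraMap F₀ (Module.End A S)).range := by
    intro x a hx
    obtain ⟨r, hr⟩ := exists_coprime_orderOf_pow_pow a (Fact.out : q.Prime) hf0
    obtain ⟨y, hy⟩ := hreg x (a ^ (q ^ f) ^ r) (lact_pow_of_fixed h hx _) hr
    refine ⟨y, ?_⟩
    have hpos : 0 < (q ^ f) ^ r := pow_pos (pow_pos (Fact.out : q.Prime).pos f) r
    rw [← p_pow h F₀ hx hpos, ← pow_mul, ht_pow] at hy
    have hy' : y ^ q ^ (f * r) = y := by
      rw [pow_mul, ← hN]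
      exact FiniteField.pow_card_pow r y
    rw [← hy', map_pow] at hy
    exact iterateFrobenius_inj (Module.End A S) q (f * r) hy
  have hall : ∀ b, t b ∈ (algebraMap F₀ (Module.End A S)).range := by
    intro b
    induction b using induction_p with
    | zero => exact ⟨0, by simp [t]⟩
    | add b b' h1 h2 => rw [ht_add]; exact add_mem h1 h2
    | smul_p r x a =>
      rw [ht_smul]
      refine mul_mem ⟨r, rfl⟩ ?_
      by_cases hx : lact h x a = x
      · exact hfix x a hx
      · -- outside the stabilizer, `p_x # a` is a product whose reverse product vanishes
        have h1 : p h F₀ x a = p h F₀ x 1 * p h F₀ x a := by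
          rw [p_mul_p, if_pos (by simp), one_mul]
        rw [h1, ht_comm, p_mul_p, if_neg (fun e => hx e.symm)]
        exact ⟨0, by simp [t]⟩
  have := IsSimpleModule.nontrivial A S
  obtain ⟨s, hs⟩ := exists_ne (0 : S)
  obtain ⟨ℓ, hℓ⟩ := Module.Projective.exists_dual_ne_zero (Module.End A S) hs
  have := Fintype.ofFinite S
  -- an element `b` that acts as a `D`-linear map of rank one and trace `g`
  obtain ⟨b, hb⟩ := jacobson_density (((g * (ℓ s)⁻¹) • ℓ).smulRight s) Finset.univ
  have hT : T b = ((g * (ℓ s)⁻¹) • ℓ).smulRight s :=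
    LinearMap.ext fun v => (hb v (Finset.mem_univ v)).symm
  have htb : t b = g := by
    simp only [t, hT, LinearMap.trace_smulRight, LinearMap.smul_apply, smul_eq_mul]
    exact inv_mul_cancel_right₀ hℓ g
  obtain ⟨c, hc⟩ := hall b
  refine ⟨c, fun v => ?_⟩
  rw [← htb, ← hc, hcompat]

end SplittingFinite

/-! ### The residue field is a splitting field -/

section ResidueSplitting

open IsLocalRing NumberField

/-- The ring of integers of a number field contained in `K` maps to every integrally closed
subring `R` with fraction field `K`. -/
theorem exists_ringOfIntegers_hom (L R K : Type*) [Field L] [NumberField L] [CommRing R]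
    [IsDomain R] [IsIntegrallyClosed R] [Field K] [Algebra R K] [IsFractionRing R K] [Algebra L K] :
    ∃ θ : 𝓞 L →+* R, ∀ y : 𝓞 L, algebraMap R K (θ y) = algebraMap L K y := by
  have hint : ∀ y : 𝓞 L, ∃ r : R, algebraMap R K r = algebraMap L K y := by
    intro y
    apply IsIntegrallyClosed.algebraMap_eq_of_integral
    have h1 : IsIntegral ℤ (algebraMap L K y) :=
      (RingOfIntegers.isIntegral_coe y).map (algebraMap L K).toIntAlgHom
    exact h1.tower_top
  choose θ hθ using hint
  have hinj := IsFractionRing.injective R K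
  refine ⟨{ toFun := θ, map_one' := hinj ?_, map_mul' := fun y z => hinj ?_, map_zero' := hinj ?_,
            map_add' := fun y z => hinj ?_ }, hθ⟩ <;> simp [hθ]

variable {Q : Type*} [Group Q] {F G : Subgroup Q} (h : F.IsComplement' G) [Fintype F] [Fintype G]

/-- If a number field contained in `K` is a splitting field, then the residue field of `R` contains
a finite splitting field, namely the residue field of the number field. -/
theorem scalar_end_residueField {L : Type*} [Field L] [NumberField L]
    (hsplit : IsSplittingField h L) {q : ℕ} [Fact q.Prime] {R K : Type*} [CommRing R] [IsDomain R]
    [IsDiscreteValuationRing R] [CharP (ResidueField R) q] [Field K] [Algebra R K]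
    [IsFractionRing R K] [Algebra L K] {R' K' : Type*} [CommRing R'] [IsDomain R']
    [IsDiscreteValuationRing R'] [Field K'] [Algebra R' K'] [IsFractionRing R' K'] [Algebra R R']
    [IsLocalHom (algebraMap R R')] [Algebra K K'] [Algebra R K'] [IsScalarTower R R' K']
    [IsScalarTower R K K'] {ω : R'} (hω : IsPrimitiveRoot ω (ordCompl[q] (Fintype.card F)))
    {W : Type*} [AddCommGroup W] [Module (ResidueField R) W]
    [Module (Bismash h (ResidueField R)) W]
    [IsScalarTower (ResidueField R) (Bismash h (ResidueField R)) W]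
    [IsSimpleModule (Bismash h (ResidueField R)) W]
    (g : Module.End (Bismash h (ResidueField R)) W) :
    ∃ c : ResidueField R, ∀ v, g v = c • v := by
  have hq : q.Prime := Fact.out
  obtain ⟨θ, hθ⟩ := exists_ringOfIntegers_hom L R K
  -- the prime of the number field below the maximal ideal of `R`
  let I : Ideal (𝓞 L) := RingHom.ker ((residue R).comp θ)
  have hI0 : I ≠ ⊥ := by
    intro e
    have h1 : ((q : ℕ) : 𝓞 L) ∈ I := by
      rw [RingHom.mem_ker, map_natCast, CharP.cast_eq_zero]
    rw [e, Ideal.mem_bot, Nat.cast_eq_zero] at h1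
    exact hq.ne_zero h1
  have hIp : I.IsPrime := RingHom.ker_isPrime _
  have hImax : I.IsMaximal := hIp.isMaximal hI0
  let _ : Field (𝓞 L ⧸ I) := Ideal.Quotient.field I
  have : Finite (𝓞 L ⧸ I) := Ideal.finiteQuotientOfFreeOfNeBot I hI0
  let _ : Fintype (𝓞 L ⧸ I) := Fintype.ofFinite _
  let _ : Algebra (𝓞 L ⧸ I) (ResidueField R) := (RingHom.kerLift ((residue R).comp θ)).toAlgebra
  have : CharP (𝓞 L ⧸ I) q := (RingHom.charP_iff
    (algebraMap (𝓞 L ⧸ I) (ResidueField R)) (algebraMap (𝓞 L ⧸ I) (ResidueField R)).injective q).2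
    inferInstance
  have : CharP (ResidueField R') q :=
    charP_of_injective_algebraMap (algebraMap (ResidueField R) (ResidueField R')).injective q
  let _ : Algebra L K' := ((algebraMap K K').comp (algebraMap L K)).toAlgebra
  have : CharZero K' := charZero_of_injective_algebraMap (algebraMap L K').injective
  set m := ordCompl[q] (Fintype.card F) with hm
  have hm0 : 0 < m := Nat.ordCompl_pos q Fintype.card_ne_zero
  have hmq : m.Coprime q := (Nat.coprime_ordCompl hq Fintype.card_ne_zero).symm
  have hmk : (m : ResidueField R') ≠ 0 := by
    intro e
    rw [CharP.cast_eq_zero_iff (ResidueField R') q] at e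
    exact hq.coprime_iff_not_dvd.1 hmq.symm e
  have hinj := IsFractionRing.injective R' K'
  have hζ : IsPrimitiveRoot (algebraMap R' K' ω) m := hω.map_of_injective hinj
  have hroot := fun g hg => aeval_pow_card_eq_zero_of_aeval_eq_zero (o := 𝓞 L) (L := L)
    (algebraMap R' K') hinj (residue R') ((algebraMap R R').comp θ)
    (fun y => by
      rw [RingHom.comp_apply, ← IsScalarTower.algebraMap_apply,
        IsScalarTower.algebraMap_apply R K K', hθ, IsScalarTower.algebraMap_apply (𝓞 L) L K']
      rfl)
    (Ideal.Quotient.mk I) ((algebraMap (ResidueField R) (ResidueField R')).comp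
      (algebraMap (𝓞 L ⧸ I) (ResidueField R)))
    (fun y => rfl) hm0 hω.pow_eq_one hmk g hg
  have hF₀ : IsSplittingField h (𝓞 L ⧸ I) := by
    refine isSplittingField_of_conj h (q := q) fun x a hx ha => ?_
    have ham : a ^ m = 1 := by
      apply orderOf_dvd_iff_pow_eq_one.1
      have h1 : orderOf a ∣ q ^ (Fintype.card F).factorization q * m := by
        rw [hm, Nat.ordProj_mul_ordCompl_eq_self]; exact orderOf_dvd_card
      exact (ha.pow_right _).dvd_of_dvd_mul_left h1
    exact exists_conj_of_trace_eq h hsplit hx fun M _ _ _ _ _ =>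
      trace_p_pow_eq h hm0 Fintype.card_pos hζ hroot hx ham M
  exact scalar_end_of_extend h hF₀ g

end ResidueSplitting

/-! ### Dual modules -/

section Dual

variable {Q : Type*} [Group Q] {F G : Subgroup Q} (h : F.IsComplement' G) [Fintype F] [Fintype G]
variable {k : Type*} [Field k] {N : Type*} [AddCommGroup N] [Module k N] [Module (Bismash h k) N]
  [IsScalarTower k (Bismash h k) N]

theorem charpoly_dualMap [Module.Finite k N] (T : Module.End k N) :
    (Module.Dual.transpose (R := k) T).charpoly = T.charpoly := by
  classical
  let b := Module.Free.chooseBasis k N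
  rw [← LinearMap.charpoly_toMatrix T b, ← LinearMap.charpoly_toMatrix _ b.dualBasis,
    LinearMap.toMatrix_transpose, Matrix.charpoly_transpose]

/-- If `U` is dual to `N` by a pairing for which the antipode is the adjoint, then `f` acts on `U`
with the characteristic polynomial of the action of `S(f)` on `N`. -/
theorem charpoly_op_eq_of_equiv_dual [Module.Finite k N] {U : Type*} [AddCommGroup U] [Module k U]
    [Module (Bismash h k) U] [IsScalarTower k (Bismash h k) U] [Module.Finite k U]
    (e : U ≃ₗ[k] Module.Dual k N)
    (he : ∀ (f : Bismash h k) u v, e (f • u) v = e u (antipode h f • v)) (f : Bismash h k) :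
    (op h f : Module.End k U).charpoly = (op h (antipode h f) : Module.End k N).charpoly := by
  rw [← charpoly_dualMap (op h (antipode h f)), ← LinearEquiv.charpoly_conj e]
  congr 1
  refine LinearMap.ext fun φ => LinearMap.ext fun v => ?_
  rw [LinearEquiv.conj_apply_apply, op_apply, he, LinearEquiv.apply_symm_apply]
  rfl

variable (k N) in
/-- The dual of a module, with the action `(f • φ)(v) = φ(S(f) v)`. -/
@[reducible] def dualModule : Module (Bismash h k) (Module.Dual k N) where
  smul f φ := φ ∘ₗ op h (antipode h f)
  one_smul φ := by
    refine LinearMap.ext fun v => ?_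
    have h1 : antipode h (1 : Bismash h k) = 1 := by
      have := antipode_mul h (1 : Bismash h k) (antipode h 1)
      rw [one_mul, antipode_antipode, one_mul] at this
      exact this.symm
    change φ (antipode h (1 : Bismash h k) • v) = φ v
    rw [h1, one_smul]
  mul_smul f g φ := by
    refine LinearMap.ext fun v => ?_
    change φ (antipode h (f * g) • v) = φ (antipode h g • antipode h f • v)
    rw [antipode_mul, mul_smul]
  smul_zero f := rfl
  smul_add f φ ψ := rfl
  add_smul f g φ := by
    refine LinearMap.ext fun v => ?_
    change φ (antipode h (f + g) • v) = φ (antipode h f • v) + φ (antipode h g • v)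
    rw [map_add, add_smul, map_add]
  zero_smul φ := by
    refine LinearMap.ext fun v => ?_
    change φ (antipode h (0 : Bismash h k) • v) = 0
    rw [map_zero, zero_smul, map_zero]

theorem isScalarTower_dualModule :
    letI := dualModule h k N
    IsScalarTower k (Bismash h k) (Module.Dual k N) := by
  let _ := dualModule h k N
  refine ⟨fun r f φ => LinearMap.ext fun v => ?_⟩
  change φ (antipode h (r • f) • v) = r * φ (antipode h f • v)
  rw [(antipode h).map_smul, smul_assoc, φ.map_smul, smul_eq_mul]

theorem isSimpleModule_dualModule [Module.Finite k N] [IsSimpleModule (Bismash h k) N] :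
    letI := dualModule h k N
    IsSimpleModule (Bismash h k) (Module.Dual k N) := by
  let _ := dualModule h k N
  have := isScalarTower_dualModule h (k := k) (N := N)
  have := IsSimpleModule.nontrivial (Bismash h k) N
  have hnt : Nontrivial (Module.Dual k N) := by
    obtain ⟨v, hv⟩ := exists_ne (0 : N)
    obtain ⟨ℓ, hℓ⟩ := Module.Projective.exists_dual_ne_zero k hv
    exact ⟨ℓ, 0, fun e => hℓ (by rw [e, LinearMap.zero_apply])⟩
  refine { toNontrivial := inferInstance, eq_bot_or_eq_top := fun U => ?_ }
  -- the annihilator of a submodule of the dual is a submodule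
  let U' : Submodule (Bismash h k) N :=
    { carrier := {v | ∀ φ ∈ U, φ v = 0}
      add_mem' := fun ha hb φ hφ => by rw [map_add, ha φ hφ, hb φ hφ, add_zero]
      zero_mem' := fun φ _ => map_zero φ
      smul_mem' := by
        intro f v hv φ hφ
        have := hv (antipode h f • φ) (U.smul_mem _ hφ)
        change φ (antipode h (antipode h f) • v) = 0 at this
        rwa [antipode_antipode] at this }
  have hmem : ∀ v, v ∈ U' ↔ v ∈ (U.restrictScalars k).dualCoannihilator := fun v => by
    rw [Submodule.mem_dualCoannihilator]; rfl
  rcases eq_bot_or_eq_top U' with e | e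
  · right
    have h1 : (U.restrictScalars k).dualCoannihilator = ⊥ := by
      rw [eq_bot_iff]
      intro v hv
      rw [← hmem, e, Submodule.mem_bot] at hv
      exact hv
    have h2 := Subspace.dualCoannihilator_dualAnnihilator_eq (W := U.restrictScalars k)
    rw [h1, Submodule.dualAnnihilator_bot] at h2
    rw [eq_top_iff]
    intro φ _
    have : φ ∈ U.restrictScalars k := h2 ▸ Submodule.mem_top
    exact this
  · left
    rw [eq_bot_iff]
    intro φ hφ
    rw [Submodule.mem_bot]
    refine LinearMap.ext fun v => ?_
    have : v ∈ U' := e ▸ Submodule.mem_top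
    exact this φ hφ

end Dual

/-! ### Brauer characters -/

section Brauer

open IsLocalRing

variable {Q : Type*} [Group Q] {F G : Subgroup Q} (h : F.IsComplement' G) [Fintype F] [Fintype G]
variable (q : ℕ) [Fact q.Prime] {R' : Type*} [CommRing R'] [IsDomain R']
  [IsDiscreteValuationRing R']
variable (k K' : Type*) [Field k] [CharP k q] [Field K'] [Algebra k (ResidueField R')]
  [Algebra R' K'] [IsFractionRing R' K']
variable (ω : R')

theorem brauerCharacter_eq_of_charpoly_eq {W W' : Type*} [AddCommGroup W] [Module k W]
    [Module.Finite k W] [Module (Bismash h k) W] [IsScalarTower k (Bismash h k) W]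
    [AddCommGroup W'] [Module k W'] [Module.Finite k W'] [Module (Bismash h k) W']
    [IsScalarTower k (Bismash h k) W'] {w w' : BReg h q}
    (e : (op h (p h k w.1.1 w.1.2) : Module.End k W).charpoly
      = (op h (p h k w'.1.1 w'.1.2) : Module.End k W').charpoly) :
    brauerCharacter h q k K' ω W w = brauerCharacter h q k K' ω W' w' := by
  unfold brauerCharacter
  rw [e]

theorem brauerCharacter_congr {W W' : Type*} [AddCommGroup W] [Module k W]
    [Module.Finite k W] [Module (Bismash h k) W] [IsScalarTower k (Bismash h k) W]
    [AddCommGroup W'] [Module k W'] [Module.Finite k W'] [Module (Bismash h k) W']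
    [IsScalarTower k (Bismash h k) W'] (e : W ≃ₗ[Bismash h k] W') :
    brauerCharacter h q k K' ω W = brauerCharacter h q k K' ω W' := by
  funext w
  apply brauerCharacter_eq_of_charpoly_eq
  rw [← LinearEquiv.charpoly_conj (e.restrictScalars k)]
  congr 1
  refine LinearMap.ext fun v => ?_
  change e (p h k w.1.1 w.1.2 • e.symm v) = _
  rw [map_smul, LinearEquiv.apply_symm_apply]
  rfl

theorem brauerCharacter_eq_add_of_exact {N M P : Type*} [AddCommGroup N] [Module k N]
    [Module (Bismash h k) N] [IsScalarTower k (Bismash h k) N] [AddCommGroup M] [Module k M]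
    [Module (Bismash h k) M] [IsScalarTower k (Bismash h k) M] [AddCommGroup P] [Module k P]
    [Module (Bismash h k) P] [IsScalarTower k (Bismash h k) P] [Module.Finite k N]
    [Module.Finite k M] [Module.Finite k P] (i : N →ₗ[Bismash h k] M) (g : M →ₗ[Bismash h k] P)
    (hi : Function.Injective i) (hg : Function.Surjective g) (hig : Function.Exact i g) :
    brauerCharacter h q k K' ω M
      = brauerCharacter h q k K' ω N + brauerCharacter h q k K' ω P := by
  funext w
  rw [Pi.add_apply]
  unfold brauerCharacter
  rw [← Finset.sum_add_distrib]
  refine Finset.sum_congr rfl fun j _ => ?_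
  rw [charpoly_op_eq_mul_of_exact h i g hi hg hig, Polynomial.map_mul,
    Polynomial.rootMultiplicity_mul
      (mul_ne_zero ((LinearMap.charpoly_monic _).map _).ne_zero
        ((LinearMap.charpoly_monic _).map _).ne_zero),
    Nat.cast_add, add_mul]

theorem brauerCharacter_eq_add_quotient {M : Type*} [AddCommGroup M] [Module k M]
    [Module (Bismash h k) M] [IsScalarTower k (Bismash h k) M] [Module.Finite k M]
    (N : Submodule (Bismash h k) M) : brauerCharacter h q k K' ω M
      = brauerCharacter h q k K' ω N + brauerCharacter h q k K' ω (M ⧸ N) :=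
  brauerCharacter_eq_add_of_exact h q k K' ω N.subtype N.mkQ N.injective_subtype
    N.mkQ_surjective (LinearMap.exact_subtype_mkQ N)

theorem brauerCharacter_of_subsingleton {M : Type*} [AddCommGroup M] [Module k M]
    [Module (Bismash h k) M] [IsScalarTower k (Bismash h k) M] [Module.Finite k M]
    [Subsingleton M] : brauerCharacter h q k K' ω M = 0 := by
  have := brauerCharacter_eq_add_of_exact h q k K' ω (LinearMap.id : M →ₗ[Bismash h k] M)
    (LinearMap.id : M →ₗ[Bismash h k] M) Function.injective_id Function.surjective_id
    (fun v => by simp [Subsingleton.elim v 0])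
  simpa using this

/-- The Brauer character of a dual module. -/
theorem brauerCharacter_of_equiv_dual {N U : Type*} [AddCommGroup N] [Module k N]
    [Module (Bismash h k) N] [IsScalarTower k (Bismash h k) N] [Module.Finite k N] [AddCommGroup U]
    [Module k U] [Module (Bismash h k) U] [IsScalarTower k (Bismash h k) U] [Module.Finite k U]
    (e : U ≃ₗ[k] Module.Dual k N)
    (he : ∀ (f : Bismash h k) u v, e (f • u) v = e u (antipode h f • v)) :
    brauerCharacter h q k K' ω U = brauerCharacter h q k K' ω N ∘ BReg.antipode h := by
  funext w
  apply brauerCharacter_eq_of_charpoly_eq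
  rw [charpoly_op_eq_of_equiv_dual h e he, antipode_p_eq]

theorem BReg.antipode_antipode {q : ℕ} (w : BReg h q) : (w.antipode h).antipode h = w := by
  apply Subtype.ext
  have h1 := act_lact_inv h w.1.1 w.1.2
  exact Prod.ext ((congrArg (·⁻¹) h1.2).trans (inv_inv _))
    ((congrArg (·⁻¹) h1.1).trans (inv_inv _))

variable {k}

theorem mem_irreducibleBrauerCharacters (W : Type*) [AddCommGroup W] [Module k W]
    [Module (Bismash h k) W] [IsScalarTower k (Bismash h k) W] [Module.Finite k W]
    [IsSimpleModule (Bismash h k) W] :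
    brauerCharacter h q k K' ω W ∈ irreducibleBrauerCharacters h q k K' ω := by
  obtain ⟨I, hI, ⟨e⟩⟩ := isSimpleModule_iff_quot_maximal.1 ‹IsSimpleModule (Bismash h k) W›
  exact ⟨I, isSimpleModule_iff_isCoatom.2 hI.1, brauerCharacter_congr h q k K' ω e⟩

theorem comp_antipode_mem_irreducibleBrauerCharacters {ψ : BReg h q → K'}
    (hψ : ψ ∈ irreducibleBrauerCharacters h q k K' ω) :
    ψ ∘ BReg.antipode h ∈ irreducibleBrauerCharacters h q k K' ω := by
  obtain ⟨I, hI, rfl⟩ := hψ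
  let _ := dualModule h k (Bismash h k ⧸ I)
  have := isScalarTower_dualModule h (k := k) (N := Bismash h k ⧸ I)
  have := isSimpleModule_dualModule h (k := k) (N := Bismash h k ⧸ I)
  rw [← brauerCharacter_of_equiv_dual h q k K' ω (LinearEquiv.refl k _) (fun _ _ _ => rfl)]
  exact mem_irreducibleBrauerCharacters h q K' ω _

end Brauer

/-! ### Linear independence of irreducible Brauer characters -/

section Independence

open IsLocalRing

variable {Q : Type*} [Group Q] {F G : Subgroup Q} (h : F.IsComplement' G) [Fintype F] [Fintype G]

theorem natCast_residueField_ne_zero {R' : Type*} [CommRing R']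
    [IsLocalRing R'] {q m : ℕ} [Fact q.Prime]
    [CharP (ResidueField R') q] (hmq : m.Coprime q) : (m : ResidueField R') ≠ 0 := by
  intro e
  rw [CharP.cast_eq_zero_iff (ResidueField R') q] at e
  exact (Fact.out : q.Prime).coprime_iff_not_dvd.1 hmq.symm e

/-- A primitive `m`-th root of unity stays primitive in the residue field if the residue
characteristic does not divide `m`. -/
theorem isPrimitiveRoot_residue {R' : Type*} [CommRing R'] [IsDomain R'] [IsLocalRing R'] {m : ℕ}
    (hm : (m : ResidueField R') ≠ 0) {ω : R'} (hω : IsPrimitiveRoot ω m) :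
    IsPrimitiveRoot (residue R' ω) m := by
  have : NeZero (m : ResidueField R') := ⟨hm⟩
  have hm0 : 0 < m := Nat.pos_of_ne_zero fun e => hm (by rw [e, Nat.cast_zero])
  have h1 := (hω.isRoot_cyclotomic hm0).map (f := residue R')
  rwa [Polynomial.map_cyclotomic, Polynomial.isRoot_cyclotomic_iff] at h1

variable {q : ℕ} [Fact q.Prime] {R' : Type*} [CommRing R'] [IsDomain R']
  [IsDiscreteValuationRing R']
variable {k : Type*} (K' : Type*) [Field k] [CharP k q] [Field K'] [CharZero K']
  [Algebra k (ResidueField R')] [Algebra R' K'] [IsFractionRing R' K']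
variable {ω : R'}

theorem pow_ordCompl_eq_one {a : F} (ha : (orderOf a).Coprime q) :
    a ^ ordCompl[q] (Fintype.card F) = 1 := by
  apply orderOf_dvd_iff_pow_eq_one.1
  have h1 : orderOf a ∣ q ^ (Fintype.card F).factorization q * ordCompl[q] (Fintype.card F) := by
    rw [Nat.ordProj_mul_ordCompl_eq_self]; exact orderOf_dvd_card
  exact (ha.pow_right _).dvd_of_dvd_mul_left h1

theorem op_pow_ordCompl {E : Type*} [Field E] {W : Type*} [AddCommGroup W] [Module E W]
    [Module (Bismash h E) W] [IsScalarTower E (Bismash h E) W] (w : BReg h q) :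
    (op h (p h E w.1.1 w.1.2) : Module.End E W) ^ (ordCompl[q] (Fintype.card F) + 1)
      = op h (p h E w.1.1 w.1.2) := by
  rw [← op_pow, p_pow h E w.2.1 (Nat.succ_pos _), pow_succ, pow_ordCompl_eq_one w.2.2, one_mul]

/-- Brauer characters take values in `R'` and reduce to traces. -/
theorem exists_residue_eq_trace (hω : IsPrimitiveRoot ω (ordCompl[q] (Fintype.card F)))
    (W : Type*) [AddCommGroup W] [Module k W] [Module (Bismash h k) W]
    [IsScalarTower k (Bismash h k) W] [Module.Finite k W] (w : BReg h q) :
    ∃ r : R', brauerCharacter h q k K' ω W w = algebraMap R' K' r ∧ residue R' r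
      = algebraMap k (ResidueField R') (LinearMap.trace k W (op h (p h k w.1.1 w.1.2))) := by
  have : CharP (ResidueField R') q :=
    charP_of_injective_algebraMap (algebraMap k (ResidueField R')).injective q
  have hm0 : 0 < ordCompl[q] (Fintype.card F) := Nat.ordCompl_pos q Fintype.card_ne_zero
  have hmk : ((ordCompl[q] (Fintype.card F) : ℕ) : ResidueField R') ≠ 0 :=
    natCast_residueField_ne_zero (Nat.coprime_ordCompl Fact.out Fintype.card_ne_zero).symm
  refine ⟨∑ j ∈ Finset.range (ordCompl[q] (Fintype.card F)),
    (((op h (p h k w.1.1 w.1.2) : Module.End k W).charpoly.map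
      (algebraMap k (ResidueField R'))).rootMultiplicity (residue R' ω ^ j) : R') * ω ^ j, ?_, ?_⟩
  · simp [brauerCharacter]
  · rw [LinearMap.trace_eq_sum_rootMultiplicity hm0 (op_pow_ordCompl h w)
      (isPrimitiveRoot_residue hmk hω)]
    simp

/-- An integral relation between Brauer characters gives a relation between traces. -/
theorem sum_trace_eq_zero (hω : IsPrimitiveRoot ω (ordCompl[q] (Fintype.card F)))
    {ι : Type*} [Fintype ι] (W : ι → Type*)
    [∀ i, AddCommGroup (W i)] [∀ i, Module k (W i)] [∀ i, Module (Bismash h k) (W i)]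
    [∀ i, IsScalarTower k (Bismash h k) (W i)] [∀ i, Module.Finite k (W i)] (c : ι → ℤ)
    (hc : ∑ i, c i • brauerCharacter h q k K' ω (W i) = 0) (f : Bismash h k) :
    ∑ i, (c i : k) * LinearMap.trace k (W i) (op h f) = 0 := by
  classical
  have hinj := IsFractionRing.injective R' K'
  have hreg : ∀ (x : G) (a : F), lact h x a = x → (orderOf a).Coprime q →
      ∑ i, (c i : k) * LinearMap.trace k (W i) (op h (p h k x a)) = 0 := by
    intro x a hx ha
    let w : BReg h q := ⟨(x, a), hx, ha⟩
    choose r hr hr' using fun i => exists_residue_eq_trace h (k := k) K' hω (W i) w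
    have h1 : (∑ i, c i • brauerCharacter h q k K' ω (W i)) w = 0 := congrFun hc w
    rw [Finset.sum_apply] at h1
    simp only [Pi.smul_apply, hr, zsmul_eq_mul] at h1
    have h2 : ∑ i, (c i : R') * r i = 0 := by
      apply hinj
      simpa using h1
    have h3 := congrArg (residue R') h2
    simp only [map_sum, map_mul, map_intCast, hr', map_zero] at h3
    apply (algebraMap k (ResidueField R')).injective
    simpa using h3
  -- a power of `a` is regular, and iterates of the Frobenius map are injective
  have hfix : ∀ (x : G) (a : F), lact h x a = x →
      ∑ i, (c i : k) * LinearMap.trace k (W i) (op h (p h k x a)) = 0 := by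
    intro x a hx
    obtain ⟨r, hr⟩ := exists_coprime_orderOf_pow_pow a (Fact.out : q.Prime) one_pos
    rw [pow_one] at hr
    have h1 := hreg x (a ^ q ^ r) (lact_pow_of_fixed h hx _) hr
    simp only [← p_pow h k hx (pow_pos (Fact.out : q.Prime).pos r), op_pow,
      LinearMap.trace_pow_char_pow q r] at h1
    apply iterateFrobenius_inj k q r
    rw [map_zero, map_sum, ← h1]
    refine Finset.sum_congr rfl fun i _ => ?_
    rw [map_mul, map_intCast]
    rfl
  induction f using induction_p with
  | zero => simp [op_zero]
  | add f g hf hg =>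
    simp only [op_add, map_add, mul_add, Finset.sum_add_distrib]
    rw [hf, hg, add_zero]
  | smul_p r x a =>
    simp only [op_smul, map_smul, smul_eq_mul, mul_left_comm _ r, ← Finset.mul_sum]
    by_cases hx : lact h x a = x
    · rw [hfix x a hx, mul_zero]
    · -- outside the stabilizer, `p_x # a` is a product whose reverse product vanishes
      have h1 : ∀ i, LinearMap.trace k (W i) (op h (p h k x a)) = 0 := by
        intro i
        have h2 : p h k x a = p h k x 1 * p h k x a := by
          rw [p_mul_p, if_pos (by simp), one_mul]
        rw [h2, op_mul, LinearMap.trace_mul_comm, ← op_mul, p_mul_p, if_neg (fun e => hx e.symm),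
          op_zero, map_zero]
      simp [h1]

/-- Over a splitting field, the Brauer characters of pairwise non-isomorphic irreducible modules are
linearly independent over `ℤ`: by density, the coefficients of a relation vanish in `k`, so are
divisible by `q`, and the relation can be divided by `q` indefinitely. -/
theorem eq_zero_of_sum_brauerCharacter_eq_zero
    (hω : IsPrimitiveRoot ω (ordCompl[q] (Fintype.card F)))
    (hk : IsSplittingField h k) {ι : Type*} [Fintype ι]
    (W : ι → Type*) [∀ i, AddCommGroup (W i)] [∀ i, Module k (W i)]
    [∀ i, Module (Bismash h k) (W i)] [∀ i, IsScalarTower k (Bismash h k) (W i)]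
    [∀ i, Module.Finite k (W i)] [∀ i, IsSimpleModule (Bismash h k) (W i)]
    (hne : ∀ i j, i ≠ j → IsEmpty (W i ≃ₗ[Bismash h k] W j)) (c : ι → ℤ)
    (hc : ∑ i, c i • brauerCharacter h q k K' ω (W i) = 0) (i : ι) : c i = 0 := by
  classical
  have hdvd : ∀ c : ι → ℤ, ∑ i, c i • brauerCharacter h q k K' ω (W i) = 0 →
      ∀ i, (q : ℤ) ∣ c i := by
    intro c hc i
    have := IsSimpleModule.nontrivial (Bismash h k) (W i)
    obtain ⟨v, hv⟩ := exists_ne (0 : W i)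
    obtain ⟨ℓ, hℓ⟩ := Module.Projective.exists_dual_ne_zero k hv
    obtain ⟨f, hf, hf'⟩ := exists_smul_eq_of_scalar_end (E := k) (A := Bismash h k) W i
      (scalar_end_of_isSplittingField h hk) (fun j hj => hne i j hj.symm)
      (((ℓ v)⁻¹ • ℓ).smulRight v)
    have h1 := sum_trace_eq_zero h K' hω W c hc f
    rw [Finset.sum_eq_single i] at h1
    · have h2 : (op h f : Module.End k (W i)) = ((ℓ v)⁻¹ • ℓ).smulRight v := LinearMap.ext hf
      rw [h2, LinearMap.trace_smulRight, LinearMap.smul_apply, smul_eq_mul, inv_mul_cancel₀ hℓ,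
        mul_one] at h1
      exact (CharP.intCast_eq_zero_iff k q (c i)).1 h1
    · intro j _ hj
      have h2 : (op h f : Module.End k (W j)) = 0 := LinearMap.ext (hf' j hj)
      rw [h2, map_zero, mul_zero]
    · simp
  have hpow : ∀ (n : ℕ) (c : ι → ℤ), ∑ i, c i • brauerCharacter h q k K' ω (W i) = 0 →
      ∀ i, (q : ℤ) ^ n ∣ c i := by
    intro n
    induction n with
    | zero => simp
    | succ n ih =>
      intro c hc i
      choose c' hc' using hdvd c hc
      have hq0 : (q : ℤ) ≠ 0 := Nat.cast_ne_zero.2 (Fact.out : q.Prime).ne_zero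
      have h1 : ∑ i, c' i • brauerCharacter h q k K' ω (W i) = 0 := by
        have h2 : (q : ℤ) • ∑ i, c' i • brauerCharacter h q k K' ω (W i) = 0 := by
          rw [← hc, Finset.smul_sum]
          refine Finset.sum_congr rfl fun i _ => ?_
          rw [smul_smul, ← hc']
        exact (smul_eq_zero.1 h2).resolve_left hq0
      rw [hc' i, pow_succ']
      exact mul_dvd_mul_left _ (ih c' h1 i)
  by_contra hi
  have hlt : (c i).natAbs < q ^ (c i).natAbs := Nat.lt_pow_self (Fact.out : q.Prime).one_lt
  have h1 := Int.natAbs_dvd_natAbs.2 (hpow (c i).natAbs c hc i)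
  rw [Int.natAbs_pow, Int.natAbs_natCast] at h1
  exact absurd (Nat.le_of_dvd (Int.natAbs_pos.2 hi) h1) (not_le.2 hlt)

/-- Irreducible modules with equal Brauer characters are isomorphic. -/
theorem nonempty_equiv_of_brauerCharacter_eq (hω : IsPrimitiveRoot ω (ordCompl[q] (Fintype.card F)))
    (hk : IsSplittingField h k) {W W' : Type*}
    [AddCommGroup W] [Module k W] [Module (Bismash h k) W] [IsScalarTower k (Bismash h k) W]
    [Module.Finite k W] [IsSimpleModule (Bismash h k) W] [AddCommGroup W'] [Module k W']
    [Module (Bismash h k) W'] [IsScalarTower k (Bismash h k) W'] [Module.Finite k W']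
    [IsSimpleModule (Bismash h k) W']
    (e : brauerCharacter h q k K' ω W = brauerCharacter h q k K' ω W') :
    Nonempty (W ≃ₗ[Bismash h k] W') := by
  classical
  by_contra hne
  obtain ⟨I, hI, ⟨eI⟩⟩ := isSimpleModule_iff_quot_maximal.1 ‹IsSimpleModule (Bismash h k) W›
  obtain ⟨J, hJ, ⟨eJ⟩⟩ := isSimpleModule_iff_quot_maximal.1 ‹IsSimpleModule (Bismash h k) W'›
  let N : Bool → Submodule (Bismash h k) (Bismash h k) := fun b => if b then I else J
  have : ∀ b, IsSimpleModule (Bismash h k) (Bismash h k ⧸ N b) := by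
    intro b
    cases b
    · exact isSimpleModule_iff_isCoatom.2 hJ.1
    · exact isSimpleModule_iff_isCoatom.2 hI.1
  have hIJ : ∀ b b', b ≠ b' →
      IsEmpty ((Bismash h k ⧸ N b) ≃ₗ[Bismash h k] (Bismash h k ⧸ N b')) := by
    intro b b' hb
    refine ⟨fun φ => hne ?_⟩
    cases b <;> cases b'
    · exact absurd rfl hb
    · exact ⟨eI.trans (φ.symm.trans eJ.symm)⟩
    · exact ⟨eI.trans (φ.trans eJ.symm)⟩
    · exact absurd rfl hb
  have := eq_zero_of_sum_brauerCharacter_eq_zero h K' hω hk (fun b => Bismash h k ⧸ N b) hIJ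
    (fun b => if b then 1 else -1) (by
      rw [Fintype.sum_bool]
      have h1 : brauerCharacter h q k K' ω (Bismash h k ⧸ N true)
          = brauerCharacter h q k K' ω (Bismash h k ⧸ N false) :=
        (brauerCharacter_congr h q k K' ω eI).symm.trans
          (e.trans (brauerCharacter_congr h q k K' ω eJ))
      rw [h1]; simp) true
  simp at this

theorem isDecompositionNumber_unique (hω : IsPrimitiveRoot ω (ordCompl[q] (Fintype.card F)))
    (hk : IsSplittingField h k) {χ φ : BReg h q → K'} {d d' : ℤ}
    (hd : IsDecompositionNumber h q k K' ω χ φ d) (hd' : IsDecompositionNumber h q k K' ω χ φ d') :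
    d = d' := by
  classical
  obtain ⟨c, hc, e, rfl⟩ := hd
  obtain ⟨c', hc', e', rfl⟩ := hd'
  have hsupp : ∀ ψ : (c - c').support, (ψ : BReg h q → K') ∈
      irreducibleBrauerCharacters h q k K' ω := by
    intro ψ
    rcases Finset.mem_union.1 (Finsupp.support_sub ψ.2) with h1 | h1
    · exact hc h1
    · exact hc' h1
  choose I hI hψ using hsupp
  have hsum : (c - c').sum (fun ψ n => n • ψ) = 0 := by
    rw [Finsupp.sum_sub_index (fun ψ a b => sub_smul a b ψ), ← e, ← e', sub_self]
  have hz := eq_zero_of_sum_brauerCharacter_eq_zero h K' hω hk (fun ψ => Bismash h k ⧸ I ψ)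
    (fun ψ ψ' hne => ⟨fun eq => hne (Subtype.ext (by
      rw [hψ ψ, hψ ψ', brauerCharacter_congr h q k K' ω eq]))⟩)
    (fun ψ => (c - c') ψ) (by
      simp only [← hψ]
      rw [← hsum, Finsupp.sum]
      exact Finset.sum_coe_sort _ fun ψ => (c - c') ψ • ψ)
  by_contra hne
  have hmem : φ ∈ (c - c').support := by
    rw [Finsupp.mem_support_iff, Finsupp.sub_apply]
    exact sub_ne_zero.2 hne
  exact (Finsupp.mem_support_iff.1 hmem) (hz ⟨φ, hmem⟩)

end Independence

/-! ### Decomposition numbers as multiplicities -/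

section Multiplicity

open IsLocalRing

variable {Q : Type*} [Group Q] {F G : Subgroup Q} {h : F.IsComplement' G} [Fintype F] [Fintype G]
variable {q : ℕ} [Fact q.Prime] {R' : Type*} [CommRing R'] [IsDomain R']
  [IsDiscreteValuationRing R']
variable {k K' : Type*} [Field k] [CharP k q] [Field K'] [CharZero K']
  [Algebra k (ResidueField R')] [Algebra R' K'] [IsFractionRing R' K'] {ω : R'}

theorem IsDecompositionNumber.zero (φ : BReg h q → K') :
    IsDecompositionNumber h q k K' ω 0 φ 0 :=
  ⟨0, by simp, by simp, rfl⟩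

theorem IsDecompositionNumber.add {χ χ' φ : BReg h q → K'} {d d' : ℤ}
    (hd : IsDecompositionNumber h q k K' ω χ φ d)
    (hd' : IsDecompositionNumber h q k K' ω χ' φ d') :
    IsDecompositionNumber h q k K' ω (χ + χ') φ (d + d') := by
  classical
  obtain ⟨c, hc, rfl, rfl⟩ := hd
  obtain ⟨c', hc', rfl, rfl⟩ := hd'
  refine ⟨c + c', fun ψ hψ => ?_, ?_, rfl⟩
  · rcases Finset.mem_union.1 (Finsupp.support_add hψ) with h1 | h1
    · exact hc h1
    · exact hc' h1
  · rw [Finsupp.sum_add_index' (fun ψ => zero_smul _ ψ) (fun ψ a b => add_smul a b ψ)]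

open Classical in
theorem IsDecompositionNumber.irreducible {ψ : BReg h q → K'}
    (hψ : ψ ∈ irreducibleBrauerCharacters h q k K' ω) (φ : BReg h q → K') :
    IsDecompositionNumber h q k K' ω ψ φ (if ψ = φ then 1 else 0) := by
  refine ⟨Finsupp.single ψ 1, ?_, ?_, ?_⟩
  · rw [Finsupp.support_single _ one_ne_zero]
    simpa using hψ
  · rw [Finsupp.sum_single_index (zero_smul _ ψ), one_smul]
  · rw [Finsupp.single_apply]

/-- The multiplicity of a self-dual irreducible Brauer character does not change under dualizing. -/
theorem IsDecompositionNumber.comp_antipode {χ φ : BReg h q → K'} {d : ℤ}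
    (hφ : φ ∘ BReg.antipode h = φ) (hd : IsDecompositionNumber h q k K' ω χ φ d) :
    IsDecompositionNumber h q k K' ω (χ ∘ BReg.antipode h) φ d := by
  classical
  obtain ⟨c, hc, rfl, rfl⟩ := hd
  have hinv : Function.Involutive fun ψ : BReg h q → K' => ψ ∘ BReg.antipode h := fun ψ =>
    funext fun w => congrArg ψ (BReg.antipode_antipode h w)
  refine ⟨c.mapDomain fun ψ => ψ ∘ BReg.antipode h, fun ψ hψ => ?_, ?_, ?_⟩
  · obtain ⟨ψ', hψ', rfl⟩ := Finset.mem_image.1 (Finsupp.mapDomain_support hψ)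
    exact comp_antipode_mem_irreducibleBrauerCharacters h q K' ω (hc hψ')
  · rw [Finsupp.sum_mapDomain_index (fun ψ => zero_smul _ ψ) (fun ψ a b => add_smul a b ψ)]
    funext w
    simp [Finsupp.sum, Finset.sum_apply]
  · conv_lhs => rw [← hφ]
    exact Finsupp.mapDomain_apply hinv.injective c φ

theorem _root_.CompositionSeries.isSimpleModule_step {A M : Type*} [Ring A] [AddCommGroup M]
    [Module A M] (s : CompositionSeries (Submodule A M)) (i : Fin s.length) :
    IsSimpleModule A (s i.succ ⧸ (s i.castSucc).submoduleOf (s i.succ)) := by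
  have hcov : s i.castSucc ⋖ s i.succ := s.step i
  exact (covBy_iff_quot_is_simple hcov.le).1 hcov

/-- Composition multiplicities are the coefficients of the Brauer character. -/
theorem isDecompositionNumber_compositionMultiplicity
    (hω : IsPrimitiveRoot ω (ordCompl[q] (Fintype.card F))) (hk : IsSplittingField h k)
    (P : Type*) [AddCommGroup P] [Module k P] [Module (Bismash h k) P]
    [IsScalarTower k (Bismash h k) P] [Module.Finite k P] [IsSimpleModule (Bismash h k) P]
    (M : Type*) [AddCommGroup M] [Module k M] [Module (Bismash h k) M]
    [IsScalarTower k (Bismash h k) M] [Module.Finite k M] :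
    IsDecompositionNumber h q k K' ω (brauerCharacter h q k K' ω M)
      (brauerCharacter h q k K' ω P) (compositionMultiplicity (Bismash h k) P M) := by
  classical
  have := isNoetherian_of_finite h (E := k) M
  have := isArtinian_of_finite h (E := k) M
  have hs := exists_compositionSeries_of_isNoetherian_isArtinian (Bismash h k) M
  rw [compositionMultiplicity, dif_pos hs]
  obtain ⟨h0, h1⟩ := hs.choose_spec
  set s := hs.choose
  let iso : Fin s.length → Prop := fun j =>
    Nonempty (P ≃ₗ[Bismash h k] (s j.succ ⧸ (s j.castSucc).submoduleOf (s j.succ)))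
  -- along the composition series, each factor isomorphic to `P` contributes one
  have key : ∀ i : Fin (s.length + 1), IsDecompositionNumber h q k K' ω
      (brauerCharacter h q k K' ω (s i)) (brauerCharacter h q k K' ω P)
      ((Finset.univ.filter fun j : Fin s.length => j.castSucc < i ∧ iso j).card : ℤ) := by
    intro i
    induction i using Fin.induction with
    | zero =>
      have hbot : s 0 = ⊥ := h0
      have : Subsingleton (s 0) := by rw [hbot]; infer_instance
      rw [brauerCharacter_of_subsingleton]
      simpa using IsDecompositionNumber.zero _
    | succ i ih =>
      have hcov : s i.castSucc ⋖ s i.succ := s.step i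
      have hsimple := s.isSimpleModule_step i
      have hadd := brauerCharacter_eq_add_quotient h q k K' ω
        ((s i.castSucc).submoduleOf (s i.succ))
      rw [brauerCharacter_congr h q k K' ω (Submodule.submoduleOfEquivOfLe hcov.le)] at hadd
      rw [hadd]
      have hiso : brauerCharacter h q k K' ω (s i.succ ⧸ (s i.castSucc).submoduleOf (s i.succ))
          = brauerCharacter h q k K' ω P ↔ iso i :=
        ⟨fun e => nonempty_equiv_of_brauerCharacter_eq h K' hω hk e.symm,
          fun ⟨e⟩ => (brauerCharacter_congr h q k K' ω e).symm⟩
      have hcard : (Finset.univ.filter fun j : Fin s.length => j.castSucc < i.succ ∧ iso j).card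
          = (Finset.univ.filter fun j : Fin s.length => j.castSucc < i.castSucc ∧ iso j).card
            + if iso i then 1 else 0 := by
        have hsplit : (Finset.univ.filter fun j : Fin s.length => j.castSucc < i.succ ∧ iso j)
            = (Finset.univ.filter fun j : Fin s.length => j.castSucc < i.castSucc ∧ iso j)
              ∪ (if iso i then {i} else ∅) := by
          ext j
          have h2 : j.castSucc < i.succ ↔ j.castSucc < i.castSucc ∨ j = i := by
            simp only [Fin.lt_def, Fin.ext_iff, Fin.val_castSucc, Fin.val_succ]; omega
          rw [Finset.mem_filter, Finset.mem_union, Finset.mem_filter, h2]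
          by_cases hi : iso i
          · by_cases hj : j = i
            · subst hj; simp [hi]
            · simp only [hi, hj, if_true, Finset.mem_singleton, or_false]
          · by_cases hj : j = i
            · subst hj; simp [hi]
            · simp only [hi, hj, if_false, Finset.notMem_empty, or_false]
        rw [hsplit, Finset.card_union_of_disjoint]
        · split_ifs <;> simp
        · split_ifs <;> simp
      rw [hcard]
      push_cast
      have h2 := ih.add (IsDecompositionNumber.irreducible
        (mem_irreducibleBrauerCharacters h q K' ω
          (s i.succ ⧸ (s i.castSucc).submoduleOf (s i.succ))) (brauerCharacter h q k K' ω P))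
      simpa only [hiso] using h2
  have hlast := key (Fin.last _)
  have htop : s (Fin.last s.length) = ⊤ := h1
  rw [htop, brauerCharacter_congr h q k K' ω Submodule.topEquiv] at hlast
  have hcount : s.countFactors P = (Finset.univ.filter fun j : Fin s.length =>
      j.castSucc < Fin.last s.length ∧ iso j).card := by
    unfold CompositionSeries.countFactors
    rw [Nat.card_eq_fintype_card, Fintype.card_subtype]
    congr 1
    ext j
    simp [iso, Fin.castSucc_lt_last]
  rw [hcount]
  exact hlast

end Multiplicity

/-! ### Invariant forms -/

section Forms

variable {Q : Type*} [Group Q] {F G : Subgroup Q} (h : F.IsComplement' G) [Fintype F] [Fintype G]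
variable {E : Type*} [Field E] {M : Type*} [AddCommGroup M] [Module E M] [Module (Bismash h E) M]
  [IsScalarTower E (Bismash h E) M] {B : LinearMap.BilinForm E M} {ε : E}

theorem nondegenerate_of_forall_eq_mul (hε : ∀ v w, B v w = ε * B w v)
    (hsep : ∀ v, (∀ w, B v w = 0) → v = 0) : B.Nondegenerate :=
  ⟨hsep, fun w hw => hsep w fun v => by rw [hε, hw, mul_zero]⟩

variable [Module.Finite E M]

/-- Over a splitting field, an invariant form on an irreducible module is a multiple of any given
non-degenerate one. -/
theorem exists_eq_mul_of_isInvariant (hscal : ∀ g : Module.End (Bismash h E) M,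
      ∃ c : E, ∀ v, g v = c • v) (hnd : B.Nondegenerate)
    (hB : IsInvariant h B) {B' : LinearMap.BilinForm E M} (hB' : IsInvariant h B') :
    ∃ c : E, ∀ v w, B' v w = c * B v w := by
  have hg : ∀ v w, B ((B.toDual hnd).symm (B' v)) w = B' v w := fun v w =>
    LinearMap.BilinForm.apply_toDual_symm_apply ..
  -- `B'(v, w) = B(g v, w)` defines an endomorphism `g` of the module
  let g : Module.End (Bismash h E) M :=
    { toFun := fun v => (B.toDual hnd).symm (B' v)
      map_add' := fun v w => by rw [map_add, map_add]
      map_smul' := fun f v => by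
        refine sub_eq_zero.1 (hnd.1 _ fun w => ?_)
        rw [map_sub, LinearMap.sub_apply, sub_eq_zero]
        exact (hg _ w).trans ((hB'.adjoint h f v w).trans
          ((hg v _).symm.trans (hB.adjoint h f _ w).symm)) }
  obtain ⟨c, hc⟩ := hscal g
  refine ⟨c, fun v w => ?_⟩
  rw [← hg v w]
  have : (B.toDual hnd).symm (B' v) = c • v := hc v
  rw [this, map_smul, LinearMap.smul_apply, smul_eq_mul]

theorem indicator_eq_one (hnd : B.Nondegenerate) (hB : IsInvariant h B)
    (hs : ∀ v w, B v w = B w v) : indicator h E M = 1 :=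
  if_pos ⟨B, hnd, hB, hs⟩

theorem indicator_eq_neg_one (hscal : ∀ g : Module.End (Bismash h E) M,
      ∃ c : E, ∀ v, g v = c • v) (h2 : (2 : E) ≠ 0) [Nontrivial M] (hnd : B.Nondegenerate)
    (hB : IsInvariant h B) (hs : ∀ v w, B v w = -B w v) : indicator h E M = -1 := by
  unfold indicator
  rw [if_neg, if_pos ⟨B, hnd, hB, hs⟩]
  rintro ⟨B', hnd', hB', hs'⟩
  obtain ⟨c, hc⟩ := exists_eq_mul_of_isInvariant h hscal hnd hB hB'
  refine hnd'.ne_zero (LinearMap.ext fun v => LinearMap.ext fun w => ?_)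
  have h1 : B' v w = - B' v w := by
    nth_rewrite 1 [hs' v w]
    rw [hc, hc v w, hs w v, mul_neg]
  have h3 : 2 * B' v w = 0 := by linear_combination h1
  simpa [h2] using h3

/-- A self-dual irreducible module over a splitting field has an invariant form, which is symmetric
or skew-symmetric. -/
theorem exists_form_of_isSelfDual (hscal : ∀ g : Module.End (Bismash h E) M,
      ∃ c : E, ∀ v, g v = c • v) [Nontrivial M] (hM : IsSelfDual h E M) :
    ∃ B : LinearMap.BilinForm E M, B.Nondegenerate ∧ IsInvariant h B ∧ IsSymmOrSkew B := by
  obtain ⟨e, he⟩ := hM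
  let B : LinearMap.BilinForm E M := e.toLinearMap
  have hsep : ∀ v, (∀ w, B v w = 0) → v = 0 := fun v hv =>
    e.injective ((LinearMap.ext hv).trans (map_zero e).symm)
  have hnd : B.Nondegenerate := by
    refine ⟨hsep, fun w hw => ?_⟩
    by_contra hw0
    obtain ⟨ℓ, hℓ⟩ := Module.Projective.exists_dual_ne_zero E hw0
    apply hℓ
    have := hw (e.symm ℓ)
    rwa [show B (e.symm ℓ) = ℓ from e.apply_symm_apply ℓ] at this
  have hB : IsInvariant h B := (isInvariant_iff_adjoint h).2 he
  have hB' : IsInvariant h B.flip := by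
    rw [isInvariant_iff_adjoint]
    intro f v w
    change B w (f • v) = B (antipode h f • w) v
    have := hB.adjoint h (antipode h f) w v
    rw [antipode_antipode] at this
    exact this.symm
  obtain ⟨c, hc⟩ := exists_eq_mul_of_isInvariant h hscal hnd hB hB'
  have hcc : c * c = 1 := by
    by_contra hne
    refine hnd.ne_zero (LinearMap.ext fun v => LinearMap.ext fun w => ?_)
    have h1 : B v w = c * B w v := hc w v
    have h2 : B w v = c * B v w := hc v w
    have h3 : (c * c - 1) * B v w = 0 := by
      linear_combination (-1 : E) * h1 - c * h2
    simpa [sub_eq_zero, hne] using h3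
  refine ⟨B, hnd, hB, ?_⟩
  rcases mul_self_eq_one_iff.1 hcc with rfl | rfl
  · exact Or.inl fun v w => by simpa using hc w v
  · exact Or.inr fun v w => by simpa using hc w v

theorem mem_perp (hB : IsInvariant h B) {N : Submodule (Bismash h E) M} {v : M} :
    v ∈ perp h B hB N ↔ ∀ u ∈ N, B v u = 0 := Iff.rfl

/-- The map `M → N^*` attached to an invariant form, where `N^*` has the dual action. -/
def restrictDual (hB : IsInvariant h B) (N : Submodule (Bismash h E) M) :
    letI := dualModule h E N
    M →ₗ[Bismash h E] Module.Dual E N :=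
  letI := dualModule h E N
  { toFun := fun v => (B v) ∘ₗ (N.subtype.restrictScalars E)
    map_add' := fun v w => by rw [map_add, LinearMap.add_comp]
    map_smul' := fun f v => LinearMap.ext fun u => hB.adjoint h f v u }

theorem restrictDual_surjective (hnd : B.Nondegenerate) (hB : IsInvariant h B)
    (N : Submodule (Bismash h E) M) :
    Function.Surjective (letI := dualModule h E N; restrictDual h hB N) := by
  intro ℓ
  obtain ⟨φ, hφ⟩ := LinearMap.dualMap_surjective_of_injective
    (f := N.subtype.restrictScalars E) N.injective_subtype ℓ
  obtain ⟨v, hv⟩ := (B.toDual hnd).surjective φ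
  refine ⟨v, LinearMap.ext fun u => ?_⟩
  rw [← hφ, ← hv]
  rfl

theorem exact_restrictDual (hB : IsInvariant h B) (N : Submodule (Bismash h E) M) :
    Function.Exact (perp h B hB N).subtype (letI := dualModule h E N; restrictDual h hB N) := by
  intro v
  refine ⟨fun hv => ⟨⟨v, fun u hu => LinearMap.congr_fun hv (⟨u, hu⟩ : N)⟩, rfl⟩, ?_⟩
  rintro ⟨v, rfl⟩
  exact LinearMap.ext fun u => v.2 u u.2

theorem finrank_perp_add (hnd : B.Nondegenerate) (hB : IsInvariant h B)
    (N : Submodule (Bismash h E) M) :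
    Module.finrank E (perp h B hB N) + Module.finrank E N = Module.finrank E M := by
  let _ := dualModule h E N
  have := isScalarTower_dualModule h (k := E) (N := N)
  have h1 := LinearMap.finrank_range_add_finrank_ker ((restrictDual h hB N).restrictScalars E)
  have h2 : LinearMap.range ((restrictDual h hB N).restrictScalars E) = ⊤ :=
    LinearMap.range_eq_top.2 (restrictDual_surjective h hnd hB N)
  have h3 : LinearMap.ker ((restrictDual h hB N).restrictScalars E)
      = (perp h B hB N).restrictScalars E := by
    ext v
    rw [LinearMap.mem_ker]
    refine (exact_restrictDual h hB N v).trans ?_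
    simp
  rw [h2, h3, finrank_top, Subspace.dual_finrank_eq] at h1
  rw [← h1, add_comm]
  rfl

theorem perp_perp (hnd : B.Nondegenerate) (hB : IsInvariant h B) (hε : ∀ v w, B v w = ε * B w v)
    (N : Submodule (Bismash h E) M) : perp h B hB (perp h B hB N) = N := by
  have hle : N.restrictScalars E ≤ (perp h B hB (perp h B hB N)).restrictScalars E :=
    fun v hv u hu => by rw [hε, hu v hv, mul_zero]
  have h1 := finrank_perp_add h hnd hB N
  have h2 := finrank_perp_add h hnd hB (perp h B hB N)
  have h3 : Module.finrank E (N.restrictScalars E)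
      = Module.finrank E ((perp h B hB (perp h B hB N)).restrictScalars E) := by
    change Module.finrank E N = Module.finrank E (perp h B hB (perp h B hB N))
    omega
  have h4 := Submodule.eq_of_le_of_finrank_eq hle h3
  exact SetLike.ext fun v => (SetLike.ext_iff.1 h4 v).symm

/-- The form induced on `N^⊥ / (N ∩ N^⊥)` by a non-degenerate form. -/
theorem exists_form_wittKernel (hnd : B.Nondegenerate) (hB : IsInvariant h B)
    (hε : ∀ v w, B v w = ε * B w v) (N : Submodule (Bismash h E) M) :
    ∃ B' : LinearMap.BilinForm E (WittKernel h B hB N), B'.Nondegenerate ∧ IsInvariant h B' ∧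
      ∀ v w, B' v w = ε * B' w v := by
  let g : perp h B hB N →ₗ[E] WittKernel h B hB N :=
    (N.submoduleOf (perp h B hB N)).mkQ.restrictScalars E
  have hg : LinearMap.range g = ⊤ :=
    LinearMap.range_eq_top.2 (N.submoduleOf (perp h B hB N)).mkQ_surjective
  obtain ⟨s, hs⟩ := g.exists_rightInverse_of_surjective hg
  -- the values of the form on representatives do not depend on the choice of the section `s`
  have hs' : ∀ v : perp h B hB N,
      (s ((N.submoduleOf (perp h B hB N)).mkQ v) : M) - v ∈ N := by
    intro v
    change s ((N.submoduleOf (perp h B hB N)).mkQ v) - v ∈ N.submoduleOf (perp h B hB N)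
    exact (Submodule.Quotient.eq _).1 (LinearMap.congr_fun hs _)
  let ι : perp h B hB N →ₗ[E] M := (perp h B hB N).subtype.restrictScalars E
  let B' : LinearMap.BilinForm E (WittKernel h B hB N) := B.compl₁₂ (ι ∘ₗ s) (ι ∘ₗ s)
  have hB' : ∀ v w : perp h B hB N, B' ((N.submoduleOf (perp h B hB N)).mkQ v)
      ((N.submoduleOf (perp h B hB N)).mkQ w) = B v w := by
    intro v w
    set v' := s ((N.submoduleOf (perp h B hB N)).mkQ v) with hv'
    set w' := s ((N.submoduleOf (perp h B hB N)).mkQ w) with hw'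
    have h1 : B (v' : M) ((w' : M) - w) = 0 := (mem_perp h hB).1 v'.2 _ (hs' w)
    have h2 : B ((v' : M) - v) (w : M) = 0 := by
      rw [hε, (mem_perp h hB).1 w.2 _ (hs' v), mul_zero]
    change B (v' : M) (w' : M) = B v w
    rw [map_sub, sub_eq_zero] at h1
    rw [map_sub, LinearMap.sub_apply, sub_eq_zero] at h2
    rw [h1, h2]
  have hε' : ∀ v w, B' v w = ε * B' w v := by
    intro v w
    obtain ⟨v, rfl⟩ := Submodule.mkQ_surjective _ v
    obtain ⟨w, rfl⟩ := Submodule.mkQ_surjective _ w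
    rw [hB', hB', hε]
  refine ⟨B', nondegenerate_of_forall_eq_mul hε' fun v hv => ?_, ?_, hε'⟩
  · obtain ⟨v, rfl⟩ := Submodule.mkQ_surjective _ v
    have h1 : (v : M) ∈ perp h B hB (perp h B hB N) := fun u hu => by
      rw [← hB' v ⟨u, hu⟩]; exact hv _
    rw [perp_perp h hnd hB hε] at h1
    rw [← LinearMap.mem_ker, Submodule.ker_mkQ]
    exact h1
  · rw [isInvariant_iff_adjoint]
    intro f v w
    obtain ⟨v, rfl⟩ := Submodule.mkQ_surjective _ v
    obtain ⟨w, rfl⟩ := Submodule.mkQ_surjective _ w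
    rw [← map_smul, ← map_smul, hB', hB']
    exact hB.adjoint h f v w

end Forms

/-! ### Witt kernels and multiplicities -/

section Witt

open IsLocalRing

variable {Q : Type*} [Group Q] {F G : Subgroup Q} (h : F.IsComplement' G) [Fintype F] [Fintype G]
variable {q : ℕ} [Fact q.Prime] {R' : Type*} [CommRing R'] [IsDomain R']
  [IsDiscreteValuationRing R']
variable {k : Type*} (K' : Type*) [Field k] [CharP k q] [Field K'] [CharZero K']
  [Algebra k (ResidueField R')] [Algebra R' K'] [IsFractionRing R' K'] {ω : R'}

/-- `M / N^⊥` is the dual of `N`, so that its Brauer character is the dual one. -/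
theorem brauerCharacter_eq_add_wittKernel {M : Type*} [AddCommGroup M] [Module k M]
    [Module (Bismash h k) M] [IsScalarTower k (Bismash h k) M] [Module.Finite k M]
    {B : LinearMap.BilinForm k M} (hnd : B.Nondegenerate) (hB : IsInvariant h B)
    (N : Submodule (Bismash h k) M) :
    brauerCharacter h q k K' ω M = brauerCharacter h q k K' ω (WittKernel h B hB N)
      + brauerCharacter h q k K' ω (N.submoduleOf (perp h B hB N))
      + brauerCharacter h q k K' ω N ∘ BReg.antipode h := by
  let _ := dualModule h k N
  have := isScalarTower_dualModule h (k := k) (N := N)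
  rw [brauerCharacter_eq_add_of_exact h q k K' ω (perp h B hB N).subtype (restrictDual h hB N)
    (perp h B hB N).injective_subtype (restrictDual_surjective h hnd hB N)
    (exact_restrictDual h hB N),
    brauerCharacter_eq_add_quotient h q k K' ω (N.submoduleOf (perp h B hB N)),
    brauerCharacter_of_equiv_dual h q k K' ω (LinearEquiv.refl k (Module.Dual k N))
      (fun _ _ _ => rfl), add_comm (brauerCharacter h q k K' ω (N.submoduleOf _))]

variable {P : Type*} [AddCommGroup P] [Module k P] [Module (Bismash h k) P]
    [IsScalarTower k (Bismash h k) P] [Module.Finite k P] [IsSimpleModule (Bismash h k) P]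

/-- Passing from `M` to the Witt kernel `N^⊥ / N` of an isotropic submodule `N` does not change the
parity of the multiplicity of a self-dual `P`: the multiplicities in `N` and in `M / N^⊥ ≅ N^*` are
equal. -/
theorem odd_compositionMultiplicity_wittKernel
    (hω : IsPrimitiveRoot ω (ordCompl[q] (Fintype.card F))) (hk : IsSplittingField h k)
    (hP : brauerCharacter h q k K' ω P ∘ BReg.antipode h = brauerCharacter h q k K' ω P)
    {M : Type*} [AddCommGroup M] [Module k M]
    [Module (Bismash h k) M] [IsScalarTower k (Bismash h k) M] [Module.Finite k M]
    {B : LinearMap.BilinForm k M} (hnd : B.Nondegenerate) (hB : IsInvariant h B)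
    {N : Submodule (Bismash h k) M} (hN : ∀ u ∈ N, ∀ v ∈ N, B u v = 0) :
    Odd (compositionMultiplicity (Bismash h k) P (WittKernel h B hB N))
      ↔ Odd (compositionMultiplicity (Bismash h k) P M) := by
  have hle : N ≤ perp h B hB N := fun v hv u hu => hN v hv u hu
  have h1 := brauerCharacter_eq_add_wittKernel h (q := q) K' (ω := ω) hnd hB N
  rw [brauerCharacter_congr h q k K' ω (Submodule.submoduleOfEquivOfLe hle)] at h1
  have hd := isDecompositionNumber_compositionMultiplicity (q := q) (K' := K') hω hk P M
  have hdW := isDecompositionNumber_compositionMultiplicity (q := q) (K' := K') hω hk P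
    (WittKernel h B hB N)
  have hdN := isDecompositionNumber_compositionMultiplicity (q := q) (K' := K') hω hk P N
  rw [h1] at hd
  have h2 := isDecompositionNumber_unique h K' hω hk hd
    ((hdW.add hdN).add (hdN.comp_antipode hP))
  have h3 : compositionMultiplicity (Bismash h k) P M
      = compositionMultiplicity (Bismash h k) P (WittKernel h B hB N)
        + (compositionMultiplicity (Bismash h k) P N
          + compositionMultiplicity (Bismash h k) P N) := by
    omega
  rw [h3, Nat.odd_add]
  simp [← two_mul]

theorem brauerCharacter_prod (M N : Type*) [AddCommGroup M] [Module k M] [Module (Bismash h k) M]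
    [IsScalarTower k (Bismash h k) M] [Module.Finite k M] [AddCommGroup N] [Module k N]
    [Module (Bismash h k) N] [IsScalarTower k (Bismash h k) N] [Module.Finite k N] :
    brauerCharacter h q k K' ω (M × N)
      = brauerCharacter h q k K' ω M + brauerCharacter h q k K' ω N :=
  brauerCharacter_eq_add_of_exact h q k K' ω (LinearMap.inl (Bismash h k) M N)
    (LinearMap.snd (Bismash h k) M N) LinearMap.inl_injective LinearMap.snd_surjective
    Function.Exact.inl_snd

/-- If a self-dual irreducible `P` occurs with odd multiplicity in a module with a non-degenerate
invariant form, then `P` has such a form of the same symmetry. For an irreducible submodule `N` of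
the module, either the form restricts to a non-degenerate one on `N`, and `N ≅ P` possibly, or one
passes to `N^⊥ / (N ∩ N^⊥)`, where the multiplicity of `P` has the same parity. -/
theorem exists_form_of_odd (hω : IsPrimitiveRoot ω (ordCompl[q] (Fintype.card F)))
    (hk : IsSplittingField h k)
    (hP : brauerCharacter h q k K' ω P ∘ BReg.antipode h = brauerCharacter h q k K' ω P) {ε : k}
    (n : ℕ) : ∀ (M : Type*) [AddCommGroup M] [Module k M]
    [Module (Bismash h k) M] [IsScalarTower k (Bismash h k) M] [Module.Finite k M]
    (B : LinearMap.BilinForm k M), B.Nondegenerate → IsInvariant h B →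
    (∀ v w, B v w = ε * B w v) → Odd (compositionMultiplicity (Bismash h k) P M) →
    Module.finrank k M = n → ∃ B' : LinearMap.BilinForm k P, B'.Nondegenerate ∧
      IsInvariant h B' ∧ ∀ v w, B' v w = ε * B' w v := by
  classical
  induction n using Nat.strong_induction_on with
  | _ n ih =>
  intro M _ _ _ _ _ B hnd hB hε hodd hn
  have hd := isDecompositionNumber_compositionMultiplicity (q := q) (K' := K') hω hk P M
  have hM : Nontrivial M := by
    by_contra hM
    have := not_nontrivial_iff_subsingleton.1 hM
    rw [brauerCharacter_of_subsingleton] at hd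
    have h0 := isDecompositionNumber_unique h K' hω hk hd (.zero _)
    rw [Nat.cast_eq_zero.1 h0] at hodd
    exact absurd hodd (by decide)
  obtain ⟨N, hN⟩ := exists_isSimpleModule_submodule h (E := k) (M := M)
  have hNnt := IsSimpleModule.nontrivial (Bismash h k) N
  obtain ⟨B', hnd', hB', hε'⟩ := exists_form_wittKernel h hnd hB hε N
  have hlt : Module.finrank k (WittKernel h B hB N) < n := by
    have h1 := finrank_perp_add h hnd hB N
    let g : perp h B hB N →ₗ[k] WittKernel h B hB N :=
      (N.submoduleOf (perp h B hB N)).mkQ.restrictScalars k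
    have hg : Function.Surjective g := (N.submoduleOf (perp h B hB N)).mkQ_surjective
    have h2 := LinearMap.finrank_le_finrank_of_surjective hg
    have h3 : 0 < Module.finrank k N := Module.finrank_pos
    omega
  by_cases hiso : N ≤ perp h B hB N
  · refine ih _ hlt _ B' hnd' hB' hε' ?_ rfl
    rwa [odd_compositionMultiplicity_wittKernel h K' hω hk hP hnd hB
      (fun u hu v hv => hiso hu v hv)]
  · have hbot : N ⊓ perp h B hB N = ⊥ :=
      ((isSimpleModule_iff_isAtom.1 hN).le_iff.1 inf_le_left).resolve_right fun e =>
        hiso (inf_eq_left.1 e)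
    by_cases hNP : brauerCharacter h q k K' ω P = brauerCharacter h q k K' ω N
    · obtain ⟨e⟩ := nonempty_equiv_of_brauerCharacter_eq h K' hω hk hNP
      let i : P →ₗ[k] M := (N.subtype ∘ₗ e.toLinearMap).restrictScalars k
      have hi : ∀ v, i v = e v := fun _ => rfl
      have hsymm : ∀ v w, B.compl₁₂ i i v w = ε * B.compl₁₂ i i w v := fun v w => hε _ _
      refine ⟨B.compl₁₂ i i, nondegenerate_of_forall_eq_mul hsymm fun v hv => ?_, ?_, hsymm⟩
      · have h1 : (e v : M) ∈ N ⊓ perp h B hB N := by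
          refine ⟨(e v).2, fun u hu => ?_⟩
          have := hv (e.symm ⟨u, hu⟩)
          rw [LinearMap.compl₁₂_apply, hi, hi, e.apply_symm_apply] at this
          exact this
        rw [hbot, Submodule.mem_bot, ZeroMemClass.coe_eq_zero] at h1
        exact e.injective (h1.trans (map_zero e).symm)
      · rw [isInvariant_iff_adjoint]
        intro f v w
        rw [LinearMap.compl₁₂_apply, LinearMap.compl₁₂_apply, hi, hi, hi, hi, map_smul, map_smul]
        exact hB.adjoint h f _ _
    · refine ih _ hlt _ B' hnd' hB' hε' ?_ rfl
      have : Subsingleton (N.submoduleOf (perp h B hB N)) := by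
        refine ⟨fun x y => ?_⟩
        have h0 : ∀ z : N.submoduleOf (perp h B hB N), z = 0 := fun z => by
          have h1 : ((z : perp h B hB N) : M) ∈ N ⊓ perp h B hB N := ⟨z.2, z.1.2⟩
          rw [hbot, Submodule.mem_bot] at h1
          exact Subtype.ext (Subtype.ext h1)
        rw [h0 x, h0 y]
      rw [brauerCharacter_eq_add_wittKernel h K' hnd hB N,
        brauerCharacter_of_subsingleton h q k K' ω
          (M := N.submoduleOf (perp h B hB N)), add_zero] at hd
      have hdN : IsDecompositionNumber h q k K' ω (brauerCharacter h q k K' ω N)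
          (brauerCharacter h q k K' ω P) (if brauerCharacter h q k K' ω N
            = brauerCharacter h q k K' ω P then 1 else 0) :=
        .irreducible (mem_irreducibleBrauerCharacters h q K' ω N) _
      rw [if_neg (Ne.symm hNP)] at hdN
      have h2 := isDecompositionNumber_unique h K' hω hk hd
        ((isDecompositionNumber_compositionMultiplicity (q := q) (K' := K') hω hk P
          (WittKernel h B hB N)).add (hdN.comp_antipode hP))
      rw [add_zero, Nat.cast_inj] at h2
      rwa [← h2]

end Witt

/-! ### Reductions of lattices -/

section Lattices

open IsLocalRing

variable {Q : Type*} [Group Q] {F G : Subgroup Q} (h : F.IsComplement' G) [Fintype F] [Fintype G]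
variable {R K V : Type*} [CommRing R] [IsDomain R] [IsDiscreteValuationRing R]
variable [Field K] [Algebra R K] [IsFractionRing R K]
variable [AddCommGroup V] [Module R V] [Module K V] [IsScalarTower R K V]
variable [Module (Bismash h K) V] [IsScalarTower K (Bismash h K) V]

namespace Reduction

variable {h} {M N : RBSubmodule h R K V} {hMN : ∀ r ∈ maximalIdeal R, ∀ v ∈ M, r • v ∈ N}

instance : IsScalarTower R (ResidueField R) (Reduction h M N hMN) :=
  IsScalarTower.of_algebraMap_smul fun r y => residue_smul r y

theorem finite (hM : M.toSubmodule.FG) : Module.Finite (ResidueField R) (Reduction h M N hMN) := by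
  have : Module.Finite R M.toSubmodule := Module.Finite.iff_fg.2 hM
  have : Module.Finite R (Reduction h M N hMN) := Module.Finite.of_surjective (mk hMN) mk_surjective
  exact Module.Finite.of_restrictScalars_finite R _ _

variable {M' N' : RBSubmodule h R K V} {hMN' : ∀ r ∈ maximalIdeal R, ∀ v ∈ M', r • v ∈ N'}

/-- The map `M / N → M' / N'` induced by an endomorphism of `V` that commutes with `𝓑`. -/
def map (φ : V →ₗ[R] V) (hφ : ∀ x a v, φ (p h K x a • v) = p h K x a • φ v)
    (hM : ∀ v ∈ M, φ v ∈ M') (hN : ∀ v ∈ N, φ v ∈ N') :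
    Reduction h M N hMN →ₗ[Bismash h (ResidueField R)] Reduction h M' N' hMN' :=
  let T : Reduction h M N hMN →ₗ[R] Reduction h M' N' hMN' :=
    Submodule.mapQ (N.toSubmodule.submoduleOf M.toSubmodule)
      (N'.toSubmodule.submoduleOf M'.toSubmodule) (φ.restrict hM) fun v hv => hN (v : V) hv
  { toFun := T
    map_add' := map_add T
    map_smul' := fun f y => by
      have hop : ∀ (x : G) (a : F) (y : Reduction h M N hMN),
          T (operator x a y) = operator x a (T y) := by
        intro x a y
        obtain ⟨v, rfl⟩ := mk_surjective y
        change mk hMN' ⟨φ (p h K x a • (v : V)), _⟩ = mk hMN' ⟨p h K x a • φ v, _⟩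
        congr 2
        exact hφ x a v
      have hres : ∀ (c : ResidueField R) (y : Reduction h M N hMN), T (c • y) = c • T y := by
        intro c y
        obtain ⟨r, rfl⟩ := residue_surjective c
        rw [residue_smul, map_smul, residue_smul]
      rw [RingHom.id_apply, smul_eq, smul_eq]
      simp only [map_sum, hres, hop] }

end Reduction

theorem smul_mem_scale {π : R} (hπ : Irreducible π) (M : RBSubmodule h R K V) :
    ∀ r ∈ maximalIdeal R, ∀ v ∈ M, r • v ∈ scale h π M := by
  intro r hr v hv
  obtain ⟨s, rfl⟩ := exists_eq_mul_of_mem_maximalIdeal hπ hr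
  exact ⟨s • v, M.smul_mem s hv, (mul_smul _ _ _).symm⟩

theorem IsLattice.toIsLattice {M : RBSubmodule h R K V} (hM : IsLattice h M) :
    Submodule.IsLattice K M.toSubmodule := ⟨hM.fg, hM.span_eq_top⟩

/-- The action of `p_x # a` on a lattice has the characteristic polynomial of the action on `V`. -/
theorem charpoly_operatorAux_map [Module.Finite K V] {M : RBSubmodule h R K V} (hM : IsLattice h M)
    [Module.Free R M.toSubmodule] [Module.Finite R M.toSubmodule] (x : G) (a : F) :
    (Reduction.operatorAux M x a).charpoly.map (algebraMap R K)
      = (op h (p h K x a) : Module.End K V).charpoly := by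
  classical
  have := hM.toIsLattice
  let b := Module.Free.chooseBasis R M.toSubmodule
  rw [← LinearMap.charpoly_toMatrix _ b, ← LinearMap.charpoly_toMatrix _ (b.extendOfIsLattice K),
    ← Matrix.charpoly_map]
  congr 1
  ext i j
  rw [Matrix.map_apply, LinearMap.toMatrix_apply, LinearMap.toMatrix_apply]
  have h1 : op h (p h K x a) (b.extendOfIsLattice K j)
      = ∑ i, algebraMap R K (b.repr (Reduction.operatorAux M x a (b j)) i)
        • b.extendOfIsLattice K i := by
    have h2 := congrArg Subtype.val (b.sum_repr (Reduction.operatorAux M x a (b j)))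
    rw [Module.Basis.extendOfIsLattice_apply]
    refine h2.symm.trans ?_
    rw [AddSubmonoidClass.coe_finsetSum]
    refine Finset.sum_congr rfl fun i _ => ?_
    rw [Module.Basis.extendOfIsLattice_apply, algebraMap_smul]
    rfl
  rw [h1, Module.Basis.repr_sum_self]

variable {π : R} (hπ : Irreducible π)

/-- The reduction `M / πM` of a lattice has the images of an `R`-basis of `M` as a basis. -/
def reductionBasis {ι : Type*} [Fintype ι] {M : RBSubmodule h R K V}
    (b : Module.Basis ι R M.toSubmodule) :
    Module.Basis ι (ResidueField R) (Reduction h M (scale h π M) (smul_mem_scale h hπ M)) :=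
  Module.Basis.mk (v := fun i => Reduction.mk (smul_mem_scale h hπ M) (b i))
    (by
      rw [Fintype.linearIndependent_iff]
      intro g hg i
      choose r hr using fun i => residue_surjective (g i)
      simp only [← hr, Reduction.residue_smul, ← map_smul, ← map_sum] at hg
      obtain ⟨w, hw, hwe⟩ := Reduction.mk_eq_zero.1 hg
      have h1 : π • (⟨w, hw⟩ : M.toSubmodule) = ∑ i, r i • b i := Subtype.ext hwe
      have h2 := DFunLike.congr_fun (congrArg b.repr h1) i
      rw [Module.Basis.repr_sum_self, map_smul, Finsupp.smul_apply, smul_eq_mul] at h2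
      rw [← hr, ← h2, residue_eq_zero_iff]
      exact mul_mem_maximalIdeal hπ _)
    (by
      rintro y -
      obtain ⟨v, rfl⟩ := Reduction.mk_surjective y
      rw [← b.sum_repr v, map_sum]
      refine Submodule.sum_mem _ fun i _ => ?_
      rw [map_smul, ← Reduction.residue_smul]
      exact Submodule.smul_mem _ _ (Submodule.subset_span ⟨i, rfl⟩))

theorem reductionBasis_apply {ι : Type*} [Fintype ι] {M : RBSubmodule h R K V}
    (b : Module.Basis ι R M.toSubmodule) (i : ι) :
    reductionBasis h hπ b i = Reduction.mk (smul_mem_scale h hπ M) (b i) :=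
  Module.Basis.mk_apply _ _ _

theorem charpoly_operatorAux_map_residue {M : RBSubmodule h R K V}
    [Module.Free R M.toSubmodule] [Module.Finite R M.toSubmodule]
    [Module.Finite (ResidueField R) (Reduction h M (scale h π M) (smul_mem_scale h hπ M))]
    (x : G) (a : F) :
    (Reduction.operatorAux M x a).charpoly.map (residue R)
      = (op h (p h (ResidueField R) x a) : Module.End (ResidueField R)
          (Reduction h M (scale h π M) (smul_mem_scale h hπ M))).charpoly := by
  classical
  let b := Module.Free.chooseBasis R M.toSubmodule
  rw [← LinearMap.charpoly_toMatrix _ b, ← LinearMap.charpoly_toMatrix _ (reductionBasis h hπ b),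
    ← Matrix.charpoly_map]
  congr 1
  ext i j
  rw [Matrix.map_apply, LinearMap.toMatrix_apply, LinearMap.toMatrix_apply]
  have h1 : op h (p h (ResidueField R) x a) (reductionBasis h hπ b j)
      = ∑ i, residue R (b.repr (Reduction.operatorAux M x a (b j)) i)
        • reductionBasis h hπ b i := by
    simp only [reductionBasis_apply, Reduction.residue_smul, ← map_smul, ← map_sum, b.sum_repr]
    exact Reduction.p_smul_mk x a (b j)
  rw [h1, Module.Basis.repr_sum_self]

variable {q : ℕ} [Fact q.Prime] [CharP (ResidueField R) q]
variable {R' : Type*} (K' : Type*) [CommRing R'] [IsDomain R'] [IsDiscreteValuationRing R']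
  [Field K'] [Algebra R' K'] [IsFractionRing R' K'] [CharZero K']
  [Algebra R R'] [IsLocalHom (algebraMap R R')] [Algebra K K'] [Algebra R K']
  [IsScalarTower R R' K'] [IsScalarTower R K K'] {ω : R'}

/-- The Brauer character of the reduction of a lattice in `V` is the restriction of the character
of `V`: both are read off the characteristic polynomials over `R'`, whose roots are `0` and powers
of `ω`. -/
theorem brauerCharacter_reduction (hω : IsPrimitiveRoot ω (ordCompl[q] (Fintype.card F)))
    [Module.Finite K V] {M : RBSubmodule h R K V} (hM : IsLattice h M)
    [Module.Finite (ResidueField R) (Reduction h M (scale h π M) (smul_mem_scale h hπ M))] :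
    brauerCharacter h q (ResidueField R) K' ω
      (Reduction h M (scale h π M) (smul_mem_scale h hπ M)) = character h q K K' V := by
  funext w
  have := hM.toIsLattice
  have : CharP (ResidueField R') q :=
    charP_of_injective_algebraMap (algebraMap (ResidueField R) (ResidueField R')).injective q
  have hm0 : 0 < ordCompl[q] (Fintype.card F) := Nat.ordCompl_pos q Fintype.card_ne_zero
  have hmk : ((ordCompl[q] (Fintype.card F) : ℕ) : ResidueField R') ≠ 0 :=
    natCast_residueField_ne_zero (Nat.coprime_ordCompl Fact.out Fintype.card_ne_zero).symm
  have hinj := IsFractionRing.injective R' K'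
  have hωK : IsPrimitiveRoot (algebraMap R' K' ω) (ordCompl[q] (Fintype.card F)) :=
    hω.map_of_injective hinj
  set f : Polynomial R' := (Reduction.operatorAux M w.1.1 w.1.2).charpoly.map (algebraMap R R')
    with hf
  have h1 : f.map (algebraMap R' K')
      = (op h (p h K w.1.1 w.1.2) : Module.End K V).charpoly.map (algebraMap K K') := by
    rw [hf, ← charpoly_operatorAux_map h hM, Polynomial.map_map, Polynomial.map_map,
      ← IsScalarTower.algebraMap_eq, ← IsScalarTower.algebraMap_eq]
  have h2 : f.map (residue R') = (op h (p h (ResidueField R) w.1.1 w.1.2) :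
      Module.End (ResidueField R)
        (Reduction h M (scale h π M) (smul_mem_scale h hπ M))).charpoly.map
        (algebraMap (ResidueField R) (ResidueField R')) := by
    rw [hf, ← charpoly_operatorAux_map_residue h hπ, Polynomial.map_map, Polynomial.map_map]
    rfl
  have hT : (op h (p h K w.1.1 w.1.2) : Module.End K V) ^ (ordCompl[q] (Fintype.card F) + 1)
      = op h (p h K w.1.1 w.1.2) := op_pow_ordCompl h w
  unfold brauerCharacter character
  rw [LinearMap.trace_eq_sum_rootMultiplicity hm0 hT hωK, ← h2, ← h1]
  refine Finset.sum_congr rfl fun j hj => ?_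
  rw [map_pow, Polynomial.rootMultiplicity_map_eq_of_isPrimitiveRoot hinj (residue R')
    ((LinearMap.charpoly_monic _).map _) ?_ hm0 (isPrimitiveRoot_residue hmk hω) ?_
    (Finset.mem_range.1 hj)]
  · rw [h1]
    exact LinearMap.splits_charpoly_of_pow_eq_self hm0 hT hωK
  · rw [h1]
    exact fun μ hμ => LinearMap.eq_zero_or_eq_pow_of_mem_roots_charpoly hm0 hT hωK hμ

end Lattices

/-! ### The modules `L / πL^*` and `L^* / L` -/

section YZ

open IsLocalRing

variable {Q : Type*} [Group Q] {F G : Subgroup Q} (h : F.IsComplement' G) [Fintype F] [Fintype G]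
variable {R K V : Type*} [CommRing R] [IsDomain R] [IsDiscreteValuationRing R]
variable [Field K] [Algebra R K] [IsFractionRing R K]
variable [AddCommGroup V] [Module R V] [Module K V] [IsScalarTower R K V]
variable [Module (Bismash h K) V] [IsScalarTower K (Bismash h K) V]
variable {B : LinearMap.BilinForm K V} (hB : IsInvariant h B) (hs : IsSymmOrSkew B)
variable {L : RBSubmodule h R K V} {π : R}

theorem le_dual (hL : IsIntegralLattice h B L) : L ≤ dual h hB hs L :=
  fun _ hv w hw => hL.2 w hw _ hv

/-- A maximal integral lattice is its own bidual: the bidual is integral as well. -/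
theorem dual_dual_le (hL : IsMaximalIntegralLattice h B L) (hπ : Irreducible π) :
    dual h hB hs (dual h hB hs L) ≤ L := by
  have hle : dual h hB hs (dual h hB hs L) ≤ dual h hB hs L :=
    fun v hv w hw => hv w (le_dual h hB hs hL.1 hw)
  have hLle : L ≤ dual h hB hs (dual h hB hs L) := fun v hv w hw =>
    hs.swap (algebraMap R K).range.toAddSubgroup (hw v hv)
  refine hL.2 _ ⟨⟨?_, ?_⟩, fun v hv w hw => hw v (hle hv)⟩ hLle
  · -- multiplication by `π` embeds the bidual into `L`
    have := Module.Finite.iff_fg.2 hL.1.1.fg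
    have hinj : Function.Injective (LinearMap.lsmul R V π) := by
      intro v w hvw
      have hπ0 : algebraMap R K π ≠ 0 := by simpa using hπ.ne_zero
      have h1 : algebraMap R K π • v = algebraMap R K π • w := by
        rw [algebraMap_smul, algebraMap_smul]; exact hvw
      exact (smul_right_injective V hπ0) h1
    refine Submodule.fg_of_fg_map_injective _ hinj ?_
    have hle' : (dual h hB hs (dual h hB hs L)).toSubmodule.map (LinearMap.lsmul R V π)
        ≤ L.toSubmodule := by
      rintro _ ⟨v, hv, rfl⟩
      exact smul_dual_le h hB hs hL hπ (hle hv)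
    exact Submodule.FG.of_le_of_isNoetherian hle'
  · exact top_le_iff.1 (hL.1.1.span_eq_top ▸ Submodule.span_mono hLle)

variable (hL : IsMaximalIntegralLattice h B L) (hπ : Irreducible π)

theorem formY_apply_eq_mul {ε : R} (hε : ∀ v w, B v w = algebraMap R K ε * B w v)
    (y z : Y h hB hs hL hπ) :
    formY h hB hs hL hπ y z = residue R ε * formY h hB hs hL hπ z y := by
  obtain ⟨v, rfl⟩ := Reduction.mk_surjective y
  obtain ⟨w, rfl⟩ := Reduction.mk_surjective z
  obtain ⟨r, hr⟩ := hL.1.2 w w.2 v v.2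
  unfold formY
  rw [Reduction.form_mk _ _ _ _ _ v w (ε * r) (by rw [map_mul, hr, hε v w, one_mul]),
    Reduction.form_mk _ _ _ _ _ w v r (by rw [hr, one_mul]), map_mul]

theorem formZ_apply_eq_mul {ε : R} (hε : ∀ v w, B v w = algebraMap R K ε * B w v)
    (y z : Z h hB hs hL hπ) :
    formZ h hB hs hL hπ y z = residue R ε * formZ h hB hs hL hπ z y := by
  obtain ⟨v, rfl⟩ := Reduction.mk_surjective y
  obtain ⟨w, rfl⟩ := Reduction.mk_surjective z
  obtain ⟨r, hr⟩ := v.2 _ (smul_dual_le h hB hs hL hπ w.2)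
  rw [form_smul_left] at hr
  unfold formZ
  rw [Reduction.form_mk _ _ _ _ _ v w (ε * r) (by rw [map_mul, hr, hε v w]; ring),
    Reduction.form_mk _ _ _ _ _ w v r hr, map_mul]

theorem IsSymmOrSkew.exists_eq_mul (hs : IsSymmOrSkew B) :
    ∃ ε : R, ∀ v w, B v w = algebraMap R K ε * B w v := by
  rcases hs with hs | hs
  · exact ⟨1, fun v w => by rw [map_one, one_mul, hs]⟩
  · exact ⟨-1, fun v w => by rw [map_neg, map_one, neg_one_mul, hs]⟩

theorem formY_nondegenerate : (formY h hB hs hL hπ).Nondegenerate := by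
  obtain ⟨ε, hε⟩ := IsSymmOrSkew.exists_eq_mul (R := R) hs
  refine nondegenerate_of_forall_eq_mul (formY_apply_eq_mul h hB hs hL hπ hε) fun y hy => ?_
  obtain ⟨v, rfl⟩ := Reduction.mk_surjective y
  have hπ0 : algebraMap R K π ≠ 0 := by simpa using hπ.ne_zero
  refine Reduction.mk_eq_zero.2 ⟨(algebraMap R K π)⁻¹ • (v : V), fun w hw => ?_, ?_⟩
  · obtain ⟨r, hr⟩ := hL.1.2 v v.2 w hw
    have h1 := hy (Reduction.mk _ ⟨w, hw⟩)
    unfold formY at h1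
    rw [Reduction.form_mk _ _ _ _ _ v ⟨w, hw⟩ r (by rw [hr, one_mul]), residue_eq_zero_iff] at h1
    obtain ⟨s, rfl⟩ := exists_eq_mul_of_mem_maximalIdeal hπ h1
    refine hs.swap (algebraMap R K).range.toAddSubgroup ⟨s, ?_⟩
    rw [map_smul, LinearMap.smul_apply, ← hr, map_mul, smul_eq_mul, inv_mul_cancel_left₀ hπ0]
  · rw [LinearMap.lsmul_apply, ← algebraMap_smul K π, smul_smul, mul_inv_cancel₀ hπ0, one_smul]

theorem formZ_nondegenerate : (formZ h hB hs hL hπ).Nondegenerate := by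
  obtain ⟨ε, hε⟩ := IsSymmOrSkew.exists_eq_mul (R := R) hs
  refine nondegenerate_of_forall_eq_mul (formZ_apply_eq_mul h hB hs hL hπ hε) fun y hy => ?_
  obtain ⟨v, rfl⟩ := Reduction.mk_surjective y
  have hπ0 : algebraMap R K π ≠ 0 := by simpa using hπ.ne_zero
  refine Reduction.mk_eq_zero.2 (dual_dual_le h hB hs hL hπ fun w hw => ?_)
  obtain ⟨r, hr⟩ := hw _ (smul_dual_le h hB hs hL hπ v.2)
  rw [form_smul_left] at hr
  have h1 := hy (Reduction.mk _ ⟨w, hw⟩)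
  unfold formZ at h1
  rw [Reduction.form_mk _ _ _ _ _ v ⟨w, hw⟩ r hr, residue_eq_zero_iff] at h1
  obtain ⟨s, rfl⟩ := exists_eq_mul_of_mem_maximalIdeal hπ h1
  refine hs.swap (algebraMap R K).range.toAddSubgroup ⟨s, ?_⟩
  rw [map_mul] at hr
  exact mul_left_cancel₀ hπ0 hr

/-- Multiplication by `π`, as a map `L^* / L → L / πL`. -/
def fromZ : Z h hB hs hL hπ →ₗ[Bismash h (ResidueField R)]
    Reduction h L (scale h π L) (smul_mem_scale h hπ L) :=
  Reduction.map (LinearMap.lsmul R V π) (fun _ _ _ => (op_smul_comm h _ _ _).symm)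
    (fun _ hv => smul_dual_le h hB hs hL hπ hv) (fun v hv => ⟨v, hv, rfl⟩)

/-- The projection `L / πL → L / πL^*`. -/
def toY : Reduction h L (scale h π L) (smul_mem_scale h hπ L) →ₗ[Bismash h (ResidueField R)]
    Y h hB hs hL hπ :=
  Reduction.map LinearMap.id (fun _ _ _ => rfl) (fun _ hv => hv)
    (by rintro _ ⟨v, hv, rfl⟩; exact ⟨v, le_dual h hB hs hL.1 hv, rfl⟩)

theorem fromZ_injective : Function.Injective (fromZ h hB hs hL hπ) := by
  rw [injective_iff_map_eq_zero]
  intro y hy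
  obtain ⟨v, rfl⟩ := Reduction.mk_surjective y
  obtain ⟨w, hw, e⟩ := Reduction.mk_eq_zero.1 hy
  have hπ0 : algebraMap R K π ≠ 0 := by simpa using hπ.ne_zero
  have h1 : algebraMap R K π • w = algebraMap R K π • (v : V) := by
    rw [algebraMap_smul, algebraMap_smul]; exact e
  rw [Reduction.mk_eq_zero, ← smul_right_injective V hπ0 h1]
  exact hw

theorem toY_surjective : Function.Surjective (toY h hB hs hL hπ) := by
  intro y
  obtain ⟨v, rfl⟩ := Reduction.mk_surjective y
  exact ⟨Reduction.mk _ v, rfl⟩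

theorem exact_fromZ_toY : Function.Exact (fromZ h hB hs hL hπ) (toY h hB hs hL hπ) := by
  intro y
  constructor
  · obtain ⟨v, rfl⟩ := Reduction.mk_surjective y
    intro hv
    obtain ⟨w, hw, e⟩ := Reduction.mk_eq_zero.1 hv
    refine ⟨Reduction.mk _ ⟨w, hw⟩, ?_⟩
    change Reduction.mk _ _ = Reduction.mk _ _
    congr 1
    exact Subtype.ext e
  · rintro ⟨z, rfl⟩
    obtain ⟨v, rfl⟩ := Reduction.mk_surjective z
    exact Reduction.mk_eq_zero.2 ⟨v, v.2, rfl⟩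

theorem finite_Y : Module.Finite (ResidueField R) (Y h hB hs hL hπ) := Reduction.finite hL.1.1.fg

theorem finite_Z : Module.Finite (ResidueField R) (Z h hB hs hL hπ) :=
  have : Module.Finite (ResidueField R)
    (Reduction h L (scale h π L) (smul_mem_scale h hπ L)) := Reduction.finite hL.1.1.fg
  Module.Finite.of_injective ((fromZ h hB hs hL hπ).restrictScalars (ResidueField R))
    (fromZ_injective h hB hs hL hπ)

/-! ### Existence of maximal integral lattices -/

section Existence

variable [IsSimpleModule (Bismash h K) V]

theorem span_gen_eq_top {v : V} (hv : v ≠ 0) :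
    Submodule.span K ((gen (R := R) (K := K) h v).toSubmodule : Set V) = ⊤ := by
  let N : Submodule (Bismash h K) V :=
    { carrier := Submodule.span K ((gen (R := R) (K := K) h v).toSubmodule : Set V)
      add_mem' := add_mem
      zero_mem' := zero_mem _
      smul_mem' := by
        intro f w hw
        change f • w ∈ Submodule.span K ((gen (R := R) (K := K) h v).toSubmodule : Set V)
        induction f using induction_p with
        | zero => rw [zero_smul]; exact zero_mem _
        | add f f' hf hf' => rw [add_smul]; exact add_mem hf hf'
        | smul_p r x a =>
          rw [smul_assoc]
          refine Submodule.smul_mem _ _ ?_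
          induction hw using Submodule.span_induction with
          | mem w hw => exact Submodule.subset_span ((gen h v).stable x a w hw)
          | zero => rw [smul_zero]; exact zero_mem _
          | add w w' _ _ h1 h2 => rw [smul_add]; exact add_mem h1 h2
          | smul c w _ h1 => rw [smul_comm]; exact Submodule.smul_mem _ _ h1 }
  have hvN : v ∈ N := Submodule.subset_span (mem_gen h v)
  have hN : N = ⊤ := (eq_bot_or_eq_top N).resolve_left fun e => hv <| by
    rwa [e, Submodule.mem_bot] at hvN
  exact top_le_iff.1 fun w _ => (hN ▸ Submodule.mem_top : w ∈ N)

theorem exists_isIntegralLattice (B : LinearMap.BilinForm K V) :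
    ∃ L : RBSubmodule h R K V, IsIntegralLattice h B L := by
  have := IsSimpleModule.nontrivial (Bismash h K) V
  obtain ⟨v, hv⟩ := exists_ne (0 : V)
  -- a common denominator `r` of the values on the generators `p_x # a • v`
  obtain ⟨⟨r, hr0⟩, hr⟩ := IsLocalization.exist_integer_multiples_of_finite (nonZeroDivisors R)
    (fun i : (G × F) × (G × F) => B (p h K i.1.1 i.1.2 • v) (p h K i.2.1 i.2.2 • v))
  have hr0' : algebraMap R K r ≠ 0 := by simpa using nonZeroDivisors.ne_zero hr0
  have hu : r • v ≠ 0 := by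
    rw [← algebraMap_smul K r v]; exact smul_ne_zero hr0' hv
  refine ⟨gen h (r • v), ⟨gen_fg h _, span_gen_eq_top h hu⟩, fun u hu w hw => ?_⟩
  refine Submodule.span_induction (p := fun u _ => B u w ∈ (algebraMap R K).range)
    ?_ ?_ ?_ ?_ hu
  · rintro _ ⟨i, rfl⟩
    refine Submodule.span_induction (p := fun w _ => B (p h K i.1 i.2 • (r • v)) w
      ∈ (algebraMap R K).range) ?_ ?_ ?_ ?_ hw
    · rintro _ ⟨j, rfl⟩
      obtain ⟨s, hs⟩ := hr (i, j)
      refine ⟨r * s, ?_⟩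
      dsimp only
      rw [op_smul_comm, op_smul_comm, form_smul_left, form_smul_right, map_mul, hs]
      exact congrArg (algebraMap R K r * ·) (Algebra.smul_def r _)
    · rw [map_zero]; exact zero_mem _
    · intro y z _ _ hy hz; rw [map_add]; exact add_mem hy hz
    · intro s y _ hy; rw [form_smul_right]; exact range_mul_mem s hy
  · rw [map_zero, LinearMap.zero_apply]; exact zero_mem _
  · intro y z _ _ hy hz; rw [map_add, LinearMap.add_apply]; exact add_mem hy hz
  · intro s y _ hy; rw [form_smul_left]; exact range_mul_mem s hy

/-- All integral lattices that contain an integral lattice `L` lie in `L^*`, which is finitely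
generated, so that there is a maximal one. -/
theorem exists_isMaximalIntegralLattice [Module.Finite K V] (hnd : B.Nondegenerate) :
    ∃ L : RBSubmodule h R K V, IsMaximalIntegralLattice h B L := by
  classical
  obtain ⟨L₀, hL₀⟩ := exists_isIntegralLattice h (R := R) B
  have := hL₀.1.toIsLattice
  let b := (Module.Free.chooseBasis R L₀.toSubmodule).extendOfIsLattice K
  let D : Submodule R V := B.dualSubmodule (Submodule.span R (Set.range b))
  have hD : D.FG := by
    have := B.dualSubmodule_span_of_basis (R := R) hnd b
    rw [show D = _ from this]
    exact Submodule.fg_span (Set.finite_range _)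
  have := Module.Finite.iff_fg.2 hD
  have hb : Submodule.span R (Set.range b) ≤ L₀.toSubmodule := by
    rw [Submodule.span_le]
    rintro _ ⟨i, rfl⟩
    rw [Module.Basis.extendOfIsLattice_apply]
    exact Subtype.prop _
  have hle : ∀ L : RBSubmodule h R K V, IsIntegralLattice h B L → L₀ ≤ L → L.toSubmodule ≤ D :=
    fun L hL hL₀L v hv w hw => Submodule.mem_one.2 (hL.2 v hv w (hL₀L (hb hw)))
  let S : Set (Submodule R D) := {N | ∃ L : RBSubmodule h R K V, IsIntegralLattice h B L ∧
    L₀ ≤ L ∧ L.toSubmodule.submoduleOf D = N}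
  obtain ⟨_, ⟨L, hL, hL₀L, rfl⟩, hmax⟩ := set_has_maximal_iff_noetherian.2
    (inferInstance : IsNoetherian R D) S ⟨_, L₀, hL₀, le_refl L₀.toSubmodule, rfl⟩
  refine ⟨L, hL, fun L' hL' hLL' => ?_⟩
  have hL₀L' : L₀ ≤ L' := le_trans (show L₀.toSubmodule ≤ L.toSubmodule from hL₀L) hLL'
  have hsub : L.toSubmodule.submoduleOf D ≤ L'.toSubmodule.submoduleOf D := fun v hv => hLL' hv
  have hnot := hmax _ ⟨L', hL', hL₀L', rfl⟩
  have heq : L'.toSubmodule.submoduleOf D ≤ L.toSubmodule.submoduleOf D := by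
    by_contra hne
    exact hnot (lt_of_le_not_ge hsub hne)
  exact fun v hv => heq (x := ⟨v, hle L' hL' hL₀L' hv⟩) hv

end Existence

end YZ

/-! ### Multiplicities in `L / πL^*` and `L^* / L` -/

section Parity

open IsLocalRing

variable {Q : Type*} [Group Q] {F G : Subgroup Q} (h : F.IsComplement' G) [Fintype F] [Fintype G]
variable {q : ℕ} [Fact q.Prime]
variable {R K V : Type*} [CommRing R] [IsDomain R] [IsDiscreteValuationRing R]
  [CharP (ResidueField R) q]
variable [Field K] [Algebra R K] [IsFractionRing R K]
variable {R' : Type*} (K' : Type*) [CommRing R'] [IsDomain R'] [IsDiscreteValuationRing R']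
  [Field K'] [Algebra R' K'] [IsFractionRing R' K'] [CharZero K']
  [Algebra R R'] [IsLocalHom (algebraMap R R')] [Algebra K K'] [Algebra R K']
  [IsScalarTower R R' K'] [IsScalarTower R K K'] {ω : R'}
variable [AddCommGroup V] [Module R V] [Module K V] [IsScalarTower R K V]
variable [Module (Bismash h K) V] [IsScalarTower K (Bismash h K) V] [Module.Finite K V]
variable {B : LinearMap.BilinForm K V} (hB : IsInvariant h B) (hs : IsSymmOrSkew B)
variable {L : RBSubmodule h R K V} {π : R}
variable (hL : IsMaximalIntegralLattice h B L) (hπ : Irreducible π)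

/-- The composition factors of `Y` and `Z` together are those of `L / πL`. -/
theorem compositionMultiplicity_add_eq (hω : IsPrimitiveRoot ω (ordCompl[q] (Fintype.card F)))
    (hk : IsSplittingField h (ResidueField R)) {P : Type*} [AddCommGroup P]
    [Module (ResidueField R) P] [Module.Finite (ResidueField R) P]
    [Module (Bismash h (ResidueField R)) P]
    [IsScalarTower (ResidueField R) (Bismash h (ResidueField R)) P]
    [IsSimpleModule (Bismash h (ResidueField R)) P] {d : ℤ}
    (hd : IsDecompositionNumber h q (ResidueField R) K' ω (character h q K K' V)
      (brauerCharacter h q (ResidueField R) K' ω P) d) :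
    (compositionMultiplicity (Bismash h (ResidueField R)) P (Y h hB hs hL hπ) : ℤ)
      + compositionMultiplicity (Bismash h (ResidueField R)) P (Z h hB hs hL hπ) = d := by
  have := finite_Y h hB hs hL hπ
  have := finite_Z h hB hs hL hπ
  have : Module.Finite (ResidueField R)
    (Reduction h L (scale h π L) (smul_mem_scale h hπ L)) := Reduction.finite hL.1.1.fg
  rw [← brauerCharacter_reduction h hπ K' hω hL.1.1,
    brauerCharacter_eq_add_of_exact h q (ResidueField R) K' ω (fromZ h hB hs hL hπ)
      (toY h hB hs hL hπ) (fromZ_injective h hB hs hL hπ) (toY_surjective h hB hs hL hπ)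
      (exact_fromZ_toY h hB hs hL hπ), add_comm] at hd
  exact isDecompositionNumber_unique h K' hω hk
    ((isDecompositionNumber_compositionMultiplicity hω hk P _).add
      (isDecompositionNumber_compositionMultiplicity hω hk P _)) hd

/-- An irreducible module with self-dual Brauer character and odd decomposition number inherits the
symmetry of the invariant form. -/
theorem exists_form_of_odd_decompositionNumber (hB : IsInvariant h B) (hs : IsSymmOrSkew B)
    (hL : IsMaximalIntegralLattice h B L) (hπ : Irreducible π)
    (hω : IsPrimitiveRoot ω (ordCompl[q] (Fintype.card F)))
    (hk : IsSplittingField h (ResidueField R)) {P : Type*} [AddCommGroup P]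
    [Module (ResidueField R) P] [Module.Finite (ResidueField R) P]
    [Module (Bismash h (ResidueField R)) P]
    [IsScalarTower (ResidueField R) (Bismash h (ResidueField R)) P]
    [IsSimpleModule (Bismash h (ResidueField R)) P]
    (hP : brauerCharacter h q (ResidueField R) K' ω P ∘ BReg.antipode h
      = brauerCharacter h q (ResidueField R) K' ω P) {d : ℤ}
    (hd : IsDecompositionNumber h q (ResidueField R) K' ω (character h q K K' V)
      (brauerCharacter h q (ResidueField R) K' ω P) d) (hodd : Odd d)
    {ε : R} (hε : ∀ v w, B v w = algebraMap R K ε * B w v) :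
    ∃ B' : LinearMap.BilinForm (ResidueField R) P, B'.Nondegenerate ∧
      IsInvariant h B' ∧ ∀ v w, B' v w = residue R ε * B' w v := by
  have := finite_Y h hB hs hL hπ
  have := finite_Z h hB hs hL hπ
  rw [← compositionMultiplicity_add_eq h K' hB hs hL hπ hω hk hd] at hodd
  by_cases hYodd : Odd (compositionMultiplicity (Bismash h (ResidueField R)) P (Y h hB hs hL hπ))
  · exact exists_form_of_odd h K' hω hk hP _ _ _ (formY_nondegenerate h hB hs hL hπ)
      (formY_isInvariant h hB hs hL hπ) (formY_apply_eq_mul h hB hs hL hπ hε) hYodd rfl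
  · have hZodd :
        Odd (compositionMultiplicity (Bismash h (ResidueField R)) P (Z h hB hs hL hπ)) := by
      rw [Int.odd_add, Int.odd_coe_nat, Int.even_coe_nat] at hodd
      rw [← Nat.not_even_iff_odd]
      exact fun he => hYodd (hodd.2 he)
    exact exists_form_of_odd h K' hω hk hP _ _ _ (formZ_nondegenerate h hB hs hL hπ)
      (formZ_isInvariant h hB hs hL hπ) (formZ_apply_eq_mul h hB hs hL hπ hε) hZodd rfl

end Parity

end Bismash

end

theorem mainTheorem6 {Q : Type*} [Group Q] {F G : Subgroup Q} [Fintype F] [Fintype G]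
    (h : F.IsComplement' G)
    -- the field `𝕃`, a number field that splits `H_ℚ`
    {𝕃 : Type*} [Field 𝕃] [NumberField 𝕃] (hsplit : Bismash.IsSplittingField h 𝕃)
    -- the `q`-modular system `(K, R, k = R / 𝔭)`, `q` an odd prime, with `𝕃 ⊆ K`
    {q : ℕ} [Fact q.Prime] (hq : q ≠ 2)
    {R K : Type*} [CommRing R] [IsDomain R] [IsDiscreteValuationRing R]
    [CharP (IsLocalRing.ResidueField R) q]
    [Field K] [Algebra R K] [IsFractionRing R K] [Algebra 𝕃 K]
    {π : R} (hπ : Irreducible π)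
    -- a `q`-modular system `(K', R')` above it, containing the roots of unity needed for
    -- Brauer characters
    {R' K' : Type*} [CommRing R'] [IsDomain R'] [IsDiscreteValuationRing R']
    [Field K'] [Algebra R' K'] [IsFractionRing R' K']
    [Algebra R R'] [IsLocalHom (algebraMap R R')] [Algebra K K'] [Algebra R K']
    [IsScalarTower R R' K'] [IsScalarTower R K K']
    {ω : R'} (hω : IsPrimitiveRoot ω (ordCompl[q] (Fintype.card F)))
    -- the self-dual irreducible module `V`
    {V : Type*} [AddCommGroup V] [Module R V] [Module K V] [IsScalarTower R K V]
    [Module (Bismash h K) V] [IsScalarTower K (Bismash h K) V]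
    [IsSimpleModule (Bismash h K) V] (hV : Bismash.IsSelfDual h K V)
    -- the irreducible module `P`
    {P : Type*} [AddCommGroup P] [Module (IsLocalRing.ResidueField R) P]
    [Module.Finite (IsLocalRing.ResidueField R) P]
    [Module (Bismash h (IsLocalRing.ResidueField R)) P]
    [IsScalarTower (IsLocalRing.ResidueField R) (Bismash h (IsLocalRing.ResidueField R)) P]
    [IsSimpleModule (Bismash h (IsLocalRing.ResidueField R)) P]
    -- (1) `φ^* = φ ∘ S = φ`
    (hP : ∀ w : Bismash.BReg h q,
      Bismash.brauerCharacter h q (IsLocalRing.ResidueField R) K' ω P (w.antipode h)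
        = Bismash.brauerCharacter h q (IsLocalRing.ResidueField R) K' ω P w)
    -- (2) the decomposition number is odd
    {d : ℤ} (hd : Bismash.IsDecompositionNumber h q (IsLocalRing.ResidueField R) K' ω
      (Bismash.character h q K K' V)
      (Bismash.brauerCharacter h q (IsLocalRing.ResidueField R) K' ω P) d)
    (hodd : Odd d) :
    (∀ (B : LinearMap.BilinForm K V) (_ : B.Nondegenerate) (hB : Bismash.IsInvariant h B)
      (hs : Bismash.IsSymmOrSkew B) (L : Bismash.RBSubmodule h R K V)
      (hL : Bismash.IsMaximalIntegralLattice h B L)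
      (Y₁ : Submodule (Bismash h (IsLocalRing.ResidueField R)) (Bismash.Y h hB hs hL hπ))
      (Z₁ : Submodule (Bismash h (IsLocalRing.ResidueField R)) (Bismash.Z h hB hs hL hπ)),
      Bismash.IsMaximalIsotropic h (Bismash.formY h hB hs hL hπ) Y₁ →
      Bismash.IsMaximalIsotropic h (Bismash.formZ h hB hs hL hπ) Z₁ →
      Odd (compositionMultiplicity (Bismash h (IsLocalRing.ResidueField R)) P
        (Bismash.WittKernel h (Bismash.formY h hB hs hL hπ)
            (Bismash.formY_isInvariant h hB hs hL hπ) Y₁ ×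
          Bismash.WittKernel h (Bismash.formZ h hB hs hL hπ)
            (Bismash.formZ_isInvariant h hB hs hL hπ) Z₁))) ∧
    Bismash.indicator h (IsLocalRing.ResidueField R) P = Bismash.indicator h K V ∧
    Bismash.indicator h K V ≠ 0 := by
  let _ : Algebra 𝕃 K' := ((algebraMap K K').comp (algebraMap 𝕃 K)).toAlgebra
  have : CharZero K := charZero_of_injective_algebraMap (algebraMap 𝕃 K).injective
  have : CharZero K' := charZero_of_injective_algebraMap (algebraMap 𝕃 K').injective
  have : Module.Finite K V := Bismash.finite_of_isSimpleModule h (E := K) V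
  have := IsSimpleModule.nontrivial (Bismash h K) V
  have := IsSimpleModule.nontrivial (Bismash h (IsLocalRing.ResidueField R)) P
  have hscal : ∀ g : Module.End (Bismash h K) V, ∃ c : K, ∀ v, g v = c • v :=
    Bismash.scalar_end_of_extend h hsplit
  have hk : Bismash.IsSplittingField h (IsLocalRing.ResidueField R) := fun _ _ f =>
    Bismash.scalar_end_residueField h hsplit (K := K) (K' := K') hω f
  have hP' : Bismash.brauerCharacter h q (IsLocalRing.ResidueField R) K' ω P
      ∘ Bismash.BReg.antipode h
      = Bismash.brauerCharacter h q (IsLocalRing.ResidueField R) K' ω P := funext hP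
  refine ⟨fun B hnd hB hs L hL Y₁ Z₁ hY₁ hZ₁ => ?_, ?_⟩
  · have := Bismash.finite_Y h hB hs hL hπ
    have := Bismash.finite_Z h hB hs hL hπ
    have hadd := Bismash.compositionMultiplicity_add_eq h K' hB hs hL hπ hω hk hd
    have hY := Bismash.odd_compositionMultiplicity_wittKernel h K' hω hk hP'
      (Bismash.formY_nondegenerate h hB hs hL hπ) (Bismash.formY_isInvariant h hB hs hL hπ) hY₁.1
    have hZ := Bismash.odd_compositionMultiplicity_wittKernel h K' hω hk hP'
      (Bismash.formZ_nondegenerate h hB hs hL hπ) (Bismash.formZ_isInvariant h hB hs hL hπ) hZ₁.1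
    have hprod := Bismash.isDecompositionNumber_compositionMultiplicity (q := q) (K' := K') hω hk P
      (Bismash.WittKernel h (Bismash.formY h hB hs hL hπ)
          (Bismash.formY_isInvariant h hB hs hL hπ) Y₁ ×
        Bismash.WittKernel h (Bismash.formZ h hB hs hL hπ)
          (Bismash.formZ_isInvariant h hB hs hL hπ) Z₁)
    rw [Bismash.brauerCharacter_prod] at hprod
    have hsum := Bismash.isDecompositionNumber_unique h K' hω hk hprod
      ((Bismash.isDecompositionNumber_compositionMultiplicity hω hk P _).add
        (Bismash.isDecompositionNumber_compositionMultiplicity hω hk P _))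
    rw [← hadd, Int.odd_add, Int.odd_coe_nat, Int.even_coe_nat] at hodd
    rw [← Int.odd_coe_nat, hsum, Int.odd_add, Int.odd_coe_nat, Int.even_coe_nat, hY,
      ← Nat.not_odd_iff_even, hZ, Nat.not_odd_iff_even]
    exact hodd
  · obtain ⟨B, hnd, hB, hs⟩ := Bismash.exists_form_of_isSelfDual h hscal hV
    obtain ⟨L, hL⟩ := Bismash.exists_isMaximalIntegralLattice h (R := R) hnd
    -- `P` inherits a form of the symmetry of `B`, given by `ε = 1` or `ε = -1`
    have hform := fun (ε : R) hε => Bismash.exists_form_of_odd_decompositionNumber h K' hB hs hL hπ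
      hω hk hP' hd hodd (ε := ε) hε
    have hs' := hs
    rcases hs' with hsymm | hskew
    · obtain ⟨B', hnd', hB', hε'⟩ := hform 1 (fun v w => by rw [map_one, one_mul, hsymm])
      rw [Bismash.indicator_eq_one h hnd hB hsymm, Bismash.indicator_eq_one h hnd' hB'
        (fun v w => by rw [hε', map_one, one_mul])]
      exact ⟨rfl, one_ne_zero⟩
    · obtain ⟨B', hnd', hB', hε'⟩ := hform (-1)
        (fun v w => by rw [map_neg, map_one, neg_one_mul, hskew])
      have h2 : (2 : IsLocalRing.ResidueField R) ≠ 0 := by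
        intro e
        have h3 := (CharP.cast_eq_zero_iff (IsLocalRing.ResidueField R) q 2).1 (by exact_mod_cast e)
        exact hq ((Nat.prime_dvd_prime_iff_eq Fact.out Nat.prime_two).1 h3)
      rw [Bismash.indicator_eq_neg_one h hscal two_ne_zero hnd hB hskew,
        Bismash.indicator_eq_neg_one h (Bismash.scalar_end_of_isSplittingField h hk) h2 hnd' hB'
        (fun v w => by rw [hε', map_neg, map_one, neg_one_mul])]
      exact ⟨rfl, by norm_num⟩
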